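/- Let $L>0$ and let $\Gamma$ be the graph of a continuous, strictly decreasing function $f$ on $[0,L]$ with $f(0)=L$ and $f(L)=0$; let $g:[0,L]\to[0,L]$ be the inverse function of $f$, and let $\operatorname{Area}(\Gamma)=\int_0^L f(x)\,dx$. Let $\sigma,\tau>-1/2$. For $r,s>0$ put $$N(r,s)=\#\{(j,k):\ j,k\ge 1 \text{ integers},\ (j+\sigma)s/r\le L,\ k+\tau\le rs\,f((j+\sigma)s/r)\},$$ and let $S(r)$ be the set of $s>0$ at which $N(r,\cdot)$ attains its maximum over $(0,\infty)$. Write $x^-=\max\{-x,0\}$. Let $a_1,a_2,a_3,b_1,b_2,b_3>0$, and assume one of the following two sets of hypotheses. (Concave case.) $f$ is concave on $[0,L]$, with $$\max\Big\{f\Big(\tfrac{1-\sigma^-}{2-\sigma^-}L\Big),\,g\Big(\tfrac{1-\tau^-}{2-\tau^-}L\Big)\Big\}<2\Big(\tfrac12-\sigma^--\tau^-\Big)L,$$ and $a_3=b_3=1/2$. Moreover there is a point $(\alpha,\beta)\in\Gamma$ with $\alpha,\beta>0$ such that: $f\in C^2(0,\alpha]$ with $f'<0$ and $f''<0$ there,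 and there is a partition $0=\alpha_0<\dots<\alpha_l=\alpha$ with $f''$ monotonic on each $(\alpha_{i-1},\alpha_i)$; $g\in C^2(0,\beta]$ with $g'<0$ and $g''<0$ there, and there is a partition $0=\beta_0<\dots<\beta_m=\beta$ with $g''$ monotonic on each $(\beta_{j-1},\beta_j)$; and there are positive functions $\delta(r),\epsilon(r)$ with, as $r\to\infty$, $$\delta(r)=O(r^{-2a_1}),\quad f''(\delta(r))^{-1}=O(r^{1-4a_2}),\quad \epsilon(r)=O(r^{-2b_1}),\quad g''(\epsilon(r))^{-1}=O(r^{1-4b_2}).$$ (Convex case.) $f$ is convex on $[0,L]$, with $$\min\Big\{(1-\sigma^-)f\Big(\tfrac{1-\sigma^-}{2-\sigma^-}L\Big),\,(1-\tau^-)g\Big(\tfrac{1-\tau^-}{2-\tau^-}L\Big)\Big\}>2(\sigma^-+\tau^-)L,$$ $$\min\Big\{(1+\sigma)f\Big(\tfrac{1+\sigma}{2+\sigma}x\Big)-f(x):\tfrac{1+\sigma}{2+\sigma}L\le x\le L\Big\}>0,\qquad \min\Big\{(1+\tau)g\Big(\tfrac{1+\tau}{2+\tau}y\Big)-g(y):\tfrac{1+\tau}{2+\tau}L\le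 y\le L\Big\}>0.$$ Moreover there is a point $(\alpha,\beta)\in\Gamma$ with $\alpha,\beta>0$ such that: $f\in C^2[\alpha,L)$ with $f'<0$ and $f''>0$ there, and there is a partition $\alpha=\alpha_0<\dots<\alpha_l=L$ with $f''$ monotonic on each $(\alpha_{i-1},\alpha_i)$; $g\in C^2[\beta,L)$ with $g'<0$ and $g''>0$ there, and there is a partition $\beta=\beta_0<\dots<\beta_m=L$ with $g''$ monotonic on each $(\beta_{j-1},\beta_j)$; there are positive functions $\delta(r),\epsilon(r)$ with, as $r\to\infty$, $$\delta(r)=O(r^{-2a_1}),\quad f''(L-\delta(r))^{-1}=O(r^{1-4a_2}),\quad \epsilon(r)=O(r^{-2b_1}),\quad g''(L-\epsilon(r))^{-1}=O(r^{1-4b_2});$$ and $f(x)=L+O(x^{2a_3})$ as $x\to0^+$, $g(y)=L+O(y^{2b_3})$ as $y\to0^+$. Put $$s^*=\sqrt{\frac{\tau+1/2}{\sigma+1/2}},\qquad \mathcal E=\min\{\tfrac16,a_1,a_2,a_3,b_1,b_2,b_3\}.$$ Then $N(r,\cdot)$ attains its maximum for every $r>0$ (that is, $S(r)\ne\emptyset$);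 the maximizing stretch factors approach $s^*$ as $r\to\infty$, and more precisely there is a constant $C$, independent of $r$, with $$S(r)\subset[s^*-Cr^{-\mathcal E},\,s^*+Cr^{-\mathcal E}]\qquad\text{for all large } r.$$ Further, as $r\to\infty$, $$\max_{s>0}N(r,s)=r^2\operatorname{Area}(\Gamma)-2rL\sqrt{(\sigma+1/2)(\tau+1/2)}+O(r^{1-2\mathcal E}).$$ -/

import Mathlib

open Set Filter Topology Asymptotics

namespace ShiftedLattice

/-- The curve `Γ` in the first quadrant with both intercepts equal to `L > 0`: it is the graph of a
continuous, strictly decreasing function `f` on `[0, L]` with `f 0 = L` and `f L = 0`, and `g` is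
the inverse function of `f`, also defined on `[0, L]`. Values outside `[0, L]` are irrelevant. -/
structure IsDecreasingCurve (L : ℝ) (f g : ℝ → ℝ) : Prop where
  pos : 0 < L
  continuousOn : ContinuousOn f (Icc 0 L)
  strictAntiOn : StrictAntiOn f (Icc 0 L)
  map_zero : f 0 = L
  map_intercept : f L = 0
  mapsTo_inverse : MapsTo g (Icc 0 L) (Icc 0 L)
  invOn : InvOn g f (Icc 0 L) (Icc 0 L)

/-- The area enclosed by `Γ` and the coordinate axes. -/
noncomputable def area (L : ℝ) (f : ℝ → ℝ) : ℝ := ∫ x in (0 : ℝ)..L, f x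

/-- The number `N(r, s)` of shifted positive-integer lattice points `(j + σ, k + τ)`, `j, k ≥ 1`,
lying inside or on the stretched and scaled curve `y = r s f (s x / r)`, `0 ≤ s x / r ≤ L`. -/
noncomputable def count (L : ℝ) (f : ℝ → ℝ) (σ τ r s : ℝ) : ℕ :=
  {p : ℕ × ℕ | 1 ≤ p.1 ∧ 1 ≤ p.2 ∧ ((p.1 : ℝ) + σ) * s / r ≤ L ∧
    (p.2 : ℝ) + τ ≤ r * s * f (((p.1 : ℝ) + σ) * s / r)}.ncard

/-- The set `S(r)` of stretch factors `s > 0` that maximize `N(r, s)`. -/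
def maximizers (L : ℝ) (f : ℝ → ℝ) (σ τ r : ℝ) : Set ℝ :=
  {s | 0 < s ∧ ∀ t, 0 < t → count L f σ τ r t ≤ count L f σ τ r s}

/-- The supremum over `s > 0` of `N(r, s)`; it is the maximum as soon as `S(r)` is nonempty. -/
noncomputable def maxCount (L : ℝ) (f : ℝ → ℝ) (σ τ r : ℝ) : ℕ :=
  sSup (count L f σ τ r '' Ioi 0)

/-- The parameter assumption for concave curves; `σ⁻ = max (-σ) 0` is the negative part. -/
structure ConcaveParameterAssumption (L : ℝ) (f g : ℝ → ℝ) (σ τ : ℝ) : Prop where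
  concave : ConcaveOn ℝ (Icc 0 L) f
  bound : max (f ((1 - σ⁻) / (2 - σ⁻) * L)) (g ((1 - τ⁻) / (2 - τ⁻) * L))
    < 2 * (1 / 2 - σ⁻ - τ⁻) * L

/-- The number `μ_h(ρ)`, the minimum of `(1 + ρ) h (c x) - h x` over `c L ≤ x ≤ L`, where
`c = (1 + ρ) / (2 + ρ)`. For `h` continuous on `[0, L]` this infimum is attained. -/
noncomputable def mu (L : ℝ) (h : ℝ → ℝ) (ρ : ℝ) : ℝ :=
  sInf ((fun x => (1 + ρ) * h ((1 + ρ) / (2 + ρ) * x) - h x) '' Icc ((1 + ρ) / (2 + ρ) * L) L)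

/-- The parameter assumption for convex curves. -/
structure ConvexParameterAssumption (L : ℝ) (f g : ℝ → ℝ) (σ τ : ℝ) : Prop where
  convex : ConvexOn ℝ (Icc 0 L) f
  bound : 2 * (σ⁻ + τ⁻) * L <
    min ((1 - σ⁻) * f ((1 - σ⁻) / (2 - σ⁻) * L)) ((1 - τ⁻) * g ((1 - τ⁻) / (2 - τ⁻) * L))
  mu_f_pos : 0 < mu L f σ
  mu_g_pos : 0 < mu L g τ

/-- There is a partition `a = p 0 < p 1 < ⋯ < p l = b` such that `h` is monotonic (increasing or
decreasing) on each open subinterval. -/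
def PiecewiseMonotonic (h : ℝ → ℝ) (a b : ℝ) : Prop :=
  ∃ (l : ℕ) (p : Fin (l + 1) → ℝ), StrictMono p ∧ p 0 = a ∧ p (Fin.last l) = b ∧
    ∀ i : Fin l, MonotoneOn h (Ioo (p i.castSucc) (p i.succ)) ∨
      AntitoneOn h (Ioo (p i.castSucc) (p i.succ))

/-- One half of the weaker concave condition: the requirements on `h` (which is `f` or `g`) over
`(0, α]`. Derivatives at the endpoint `α` are one-sided. -/
structure ConcaveBranch (h : ℝ → ℝ) (α a₁ a₂ : ℝ) : Prop where
  contDiffOn : ContDiffOn ℝ 2 h (Ioc 0 α)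
  deriv_neg : ∀ x ∈ Ioc 0 α, derivWithin h (Ioc 0 α) x < 0
  deriv2_neg : ∀ x ∈ Ioc 0 α, iteratedDerivWithin 2 h (Ioc 0 α) x < 0
  piecewise : PiecewiseMonotonic (iteratedDerivWithin 2 h (Ioc 0 α)) 0 α
  growth : ∃ δ : ℝ → ℝ, (∀ r, 0 < r → 0 < δ r) ∧
    δ =O[atTop] (fun r : ℝ => r ^ (-2 * a₁)) ∧
    (fun r => (iteratedDerivWithin 2 h (Ioc 0 α) (δ r))⁻¹) =O[atTop]
      (fun r : ℝ => r ^ (1 - 4 * a₂))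

/-- The weaker concave condition with exponents `a₁, a₂, a₃, b₁, b₂, b₃`. -/
structure WeakerConcaveCondition (L : ℝ) (f g : ℝ → ℝ) (a₁ a₂ a₃ b₁ b₂ b₃ : ℝ) : Prop where
  concave : ConcaveOn ℝ (Icc 0 L) f
  a₁_pos : 0 < a₁
  a₂_pos : 0 < a₂
  b₁_pos : 0 < b₁
  b₂_pos : 0 < b₂
  a₃_eq : a₃ = 1 / 2
  b₃_eq : b₃ = 1 / 2
  branches : ∃ α β : ℝ, 0 < α ∧ α ≤ L ∧ 0 < β ∧ f α = β ∧
    ConcaveBranch f α a₁ a₂ ∧ ConcaveBranch g β b₁ b₂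

/-- One half of the weaker convex condition: the requirements on `h` (which is `f` or `g`) over
`[α, L)` and near `0`. Derivatives at the endpoint `α` are one-sided. -/
structure ConvexBranch (L : ℝ) (h : ℝ → ℝ) (α a₁ a₂ a₃ : ℝ) : Prop where
  contDiffOn : ContDiffOn ℝ 2 h (Ico α L)
  deriv_neg : ∀ x ∈ Ico α L, derivWithin h (Ico α L) x < 0
  deriv2_pos : ∀ x ∈ Ico α L, 0 < iteratedDerivWithin 2 h (Ico α L) x
  piecewise : PiecewiseMonotonic (iteratedDerivWithin 2 h (Ico α L)) α L
  growth : ∃ δ : ℝ → ℝ, (∀ r, 0 < r → 0 < δ r) ∧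
    δ =O[atTop] (fun r : ℝ => r ^ (-2 * a₁)) ∧
    (fun r => (iteratedDerivWithin 2 h (Ico α L) (L - δ r))⁻¹) =O[atTop]
      (fun r : ℝ => r ^ (1 - 4 * a₂))
  near_zero : (fun x => h x - L) =O[𝓝[>] 0] (fun x : ℝ => x ^ (2 * a₃))

/-- The weaker convex condition with exponents `a₁, a₂, a₃, b₁, b₂, b₃`. -/
structure WeakerConvexCondition (L : ℝ) (f g : ℝ → ℝ) (a₁ a₂ a₃ b₁ b₂ b₃ : ℝ) : Prop where
  convex : ConvexOn ℝ (Icc 0 L) f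
  a₁_pos : 0 < a₁
  a₂_pos : 0 < a₂
  a₃_pos : 0 < a₃
  b₁_pos : 0 < b₁
  b₂_pos : 0 < b₂
  b₃_pos : 0 < b₃
  branches : ∃ α β : ℝ, 0 < α ∧ α ≤ L ∧ 0 < β ∧ f α = β ∧
    ConvexBranch L f α a₁ a₂ a₃ ∧ ConvexBranch L g β b₁ b₂ b₃

/-- The exponent `E = min {1/6, a₁, a₂, a₃, b₁, b₂, b₃}`. -/
noncomputable def rateExponent (a₁ a₂ a₃ b₁ b₂ b₃ : ℝ) : ℝ :=
  min (1 / 6) (min (min a₁ (min a₂ a₃)) (min b₁ (min b₂ b₃)))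

/-- The limiting stretch factor `s* = √((τ + 1/2) / (σ + 1/2))`. -/
noncomputable def optimalStretch (σ τ : ℝ) : ℝ := √((τ + 1 / 2) / (σ + 1 / 2))

end ShiftedLattice

open ShiftedLattice

/-! Write `E` for `rateExponent`. The theorem follows from two facts. The first is the estimate
`N(r,s) = r² Area - r L ((σ+1/2) s + (τ+1/2)/s) + O(r^(1-2E))`, uniform for `s` in compact subsets
of `(0,∞)` (`CountEstimate`). The second is that maximizers eventually stay in a fixed compact
subset (`eventually_maximizers_subset`). The bracket exceeds its minimum, attained at `s*`, by
exactly `(σ+1/2)(s-s*)²/s` (`mainTerm_eq`). A maximizer satisfies `N(r,s) ≥ N(r,s*)`, so `r (s-s*)²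
= O(r^(1-2E))`. This gives the rate `r^(-E)`, and the maximal value follows as well.

For the estimate, cut `Γ` at `(α, f α)`. Count by columns where `f` is Lipschitz and by rows where
`g` is, and correct by a rectangle: in the concave case the two families overlap in it, in the
convex case they leave it out (`count_add_eq`, `count_eq_add`). A column of height `y` contributes
`⌊y-τ⌋ = y - τ - 1/2 - ψ(y-τ)`, where `ψ` is the sawtooth. The sum of heights is handled by
Euler–Maclaurin, with convexity or concavity in place of smoothness. The sawtooth terms it produces
at the cut cancel against those of the rectangle.

It remains to bound `∑ ψ`. Difference quotients of the periodic second Bernoulli function bound `ψ`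
from both sides, and its Fourier series converges absolutely. This reduces the matter to exponential
sums, which are controlled by Kusmin–Landau and van der Corput's second derivative test. Since `f''`
need not be bounded or bounded away from zero, the columns are grouped by the dyadic size of the
second difference (`abs_sum_sawtooth_le_of_monotone`). Young's inequality then turns the sum of cube
roots of second differences into a telescoping sum. The outcome is `O(r^(2/3) + √(r / min |f''|))`
on an interval. Columns within `δ(r)` of the degenerate end are bounded trivially by `O(r δ(r) +
1)`. The growth hypotheses are exactly what makes all of this `O(r^(1-2E))`
(`branchBound_of_pieces`). In the convex case `a₃` and `b₃` control the columns too short to hold a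
point.

For compactness, when `s ≥ 1` the count is compared with the integral of the profile by trapezoids
or chords. The parameter assumptions leave a deficit of order `r s`, or else a fixed proportion of
the area up to a constant (`CountUpperBound`), whereas `N(r,s*) ≥ r² Area - C r`. The case `s ≤ 1`
reduces to this one by reflection in the diagonal, which exchanges `f` with `g`, `σ` with `τ` and
`s` with `1/s` (`count_symm`). -/

namespace ShiftedLattice

/-! ### The Kusmin–Landau inequality -/

/-- The additive character `x ↦ exp (2 π i x)`. -/
noncomputable def unitExp (x : ℝ) : ℂ := Complex.exp (((2 * Real.pi * x : ℝ) : ℂ) * Complex.I)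

lemma norm_unitExp (x : ℝ) : ‖unitExp x‖ = 1 := Complex.norm_exp_ofReal_mul_I _

lemma unitExp_add (x y : ℝ) : unitExp (x + y) = unitExp x * unitExp y := by
  unfold unitExp
  rw [← Complex.exp_add]
  congr 1
  push_cast
  ring

lemma unitExp_int (k : ℤ) : unitExp k = 1 := by
  unfold unitExp
  rw [Complex.exp_eq_one_iff]
  exact ⟨k, by push_cast; ring⟩

lemma unitExp_re (x : ℝ) : (unitExp x).re = Real.cos (2 * Real.pi * x) := by
  unfold unitExp
  rw [Complex.exp_ofReal_mul_I_re]

lemma unitExp_neg (x : ℝ) : unitExp (-x) = (starRingEnd ℂ) (unitExp x) := by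
  unfold unitExp
  rw [← Complex.exp_conj, map_mul, Complex.conj_ofReal, Complex.conj_I]
  congr 1
  push_cast
  ring

/-- The coefficient `1 / (1 - e(δ))`. -/
noncomputable def kernelCoeff (δ : ℝ) : ℂ :=
  1 / 2 + ((Real.cos (Real.pi * δ) / Real.sin (Real.pi * δ) / 2 : ℝ) : ℂ) * Complex.I

lemma one_sub_unitExp_mul_kernelCoeff {δ : ℝ} (h : Real.sin (Real.pi * δ) ≠ 0) :
    (1 - unitExp δ) * kernelCoeff δ = 1 := by
  have h1 : unitExp δ = ⟨Real.cos (2 * (Real.pi * δ)), Real.sin (2 * (Real.pi * δ))⟩ := by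
    unfold unitExp
    apply Complex.ext
    · rw [Complex.exp_ofReal_mul_I_re, mul_assoc]
    · rw [Complex.exp_ofReal_mul_I_im, mul_assoc]
  have hs := Real.sin_sq_add_cos_sq (Real.pi * δ)
  rw [h1, kernelCoeff]
  obtain ⟨q, hq⟩ : ∃ q, q = Real.cos (Real.pi * δ) / Real.sin (Real.pi * δ) := ⟨_, rfl⟩
  have hq' : q * Real.sin (Real.pi * δ) = Real.cos (Real.pi * δ) := by rw [hq]; field_simp
  rw [← hq]
  apply Complex.ext
  · simp [Real.cos_two_mul, Real.sin_two_mul]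
    linear_combination Real.cos (Real.pi * δ) * hq'
  · simp [Real.cos_two_mul, Real.sin_two_mul]
    linear_combination Real.sin (Real.pi * δ) * hq' - q * hs

lemma two_mul_le_sin_pi_mul {θ δ : ℝ} (h0 : 0 < θ) (h1 : θ ≤ δ) (h2 : δ ≤ 1 - θ) :
    2 * θ ≤ Real.sin (Real.pi * δ) := by
  have hpi := Real.pi_pos
  rcases le_total δ (1 / 2) with h | h
  · have := Real.mul_le_sin (x := Real.pi * δ) (by nlinarith) (by nlinarith)
    have h3 : 2 / Real.pi * (Real.pi * δ) = 2 * δ := by field_simp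
    linarith
  · have := Real.mul_le_sin (x := Real.pi * (1 - δ)) (by nlinarith) (by nlinarith)
    have h3 : 2 / Real.pi * (Real.pi * (1 - δ)) = 2 * (1 - δ) := by field_simp
    have h4 : Real.sin (Real.pi * (1 - δ)) = Real.sin (Real.pi * δ) := by
      rw [← Real.sin_pi_sub]; congr 1; ring
    linarith

lemma cot_antitone {a b : ℝ} (ha : 0 < Real.sin (Real.pi * a)) (hb : 0 < Real.sin (Real.pi * b))
    (hab : a ≤ b) (hab' : b - a ≤ 1) :
    Real.cos (Real.pi * b) / Real.sin (Real.pi * b)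
      ≤ Real.cos (Real.pi * a) / Real.sin (Real.pi * a) := by
  rw [div_le_div_iff₀ hb ha]
  have : 0 ≤ Real.sin (Real.pi * (b - a)) := by
    apply Real.sin_nonneg_of_nonneg_of_le_pi
    · exact mul_nonneg Real.pi_pos.le (by linarith)
    · nlinarith [Real.pi_pos]
  rw [mul_sub, Real.sin_sub] at this
  linarith

lemma abs_cot_le {θ δ : ℝ} (h0 : 0 < θ) (h1 : θ ≤ δ) (h2 : δ ≤ 1 - θ) :
    |Real.cos (Real.pi * δ) / Real.sin (Real.pi * δ)| ≤ 1 / (2 * θ) := by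
  have h := two_mul_le_sin_pi_mul h0 h1 h2
  have h3 : 0 < Real.sin (Real.pi * δ) := by linarith
  rw [abs_div, abs_of_pos h3]
  exact div_le_div₀ zero_le_one (Real.abs_cos_le_one _) (by linarith) h

lemma norm_kernelCoeff_le {θ δ : ℝ} (h0 : 0 < θ) (h1 : θ ≤ δ) (h2 : δ ≤ 1 - θ) :
    ‖kernelCoeff δ‖ ≤ 1 / (2 * θ) := by
  have h := abs_cot_le h0 h1 h2
  have h4 : (1 : ℝ) / 2 ≤ 1 / (2 * θ) / 2 := by
    rw [div_div]
    exact one_div_le_one_div_of_le (by linarith) (by linarith)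
  calc ‖kernelCoeff δ‖ ≤ ‖(1 / 2 : ℂ)‖ + ‖((Real.cos (Real.pi * δ) / Real.sin (Real.pi * δ) / 2 : ℝ)
        : ℂ) * Complex.I‖ := norm_add_le _ _
    _ = 1 / 2 + |Real.cos (Real.pi * δ) / Real.sin (Real.pi * δ)| / 2 := by
        rw [norm_mul, Complex.norm_I, mul_one, Complex.norm_real, Real.norm_eq_abs, abs_div]
        norm_num
    _ ≤ _ := by linarith

/-- Each term is `e(x n) = (e(x n) - e(x (n+1))) * kernelCoeff δ` with `δ` the step, so this is
partial summation. The real part of `kernelCoeff` is constantly `1/2`. Its increments are therefore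
purely imaginary, all of one sign because the cotangent decreases, and their norms telescope.
Keeping the boundary term inside the norm is what lets the induction close. -/
lemma norm_sum_add_boundary_le (x : ℕ → ℝ) (N : ℕ) {θ : ℝ} (hθ : 0 < θ)
    (hmono : ∀ n < N, x (n + 1) - x n ≤ x (n + 2) - x (n + 1))
    (hlo : ∀ n ≤ N, θ ≤ x (n + 1) - x n) (hhi : ∀ n ≤ N, x (n + 1) - x n ≤ 1 - θ) :
    ‖∑ n ∈ Finset.range (N + 1), unitExp (x n) + unitExp (x (N + 1)) * kernelCoeff (x (N + 1) - x N)‖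
      ≤ ‖kernelCoeff (x 1 - x 0)‖ +
        (Real.cos (Real.pi * (x 1 - x 0)) / Real.sin (Real.pi * (x 1 - x 0)) -
          Real.cos (Real.pi * (x (N + 1) - x N)) / Real.sin (Real.pi * (x (N + 1) - x N))) / 2 := by
  have hsin : ∀ n ≤ N, 0 < Real.sin (Real.pi * (x (n + 1) - x n)) := fun n hn => by
    have := two_mul_le_sin_pi_mul hθ (hlo n hn) (hhi n hn)
    linarith
  have key : ∀ n ≤ N, unitExp (x n) + unitExp (x (n + 1)) * kernelCoeff (x (n + 1) - x n)
      = unitExp (x n) * kernelCoeff (x (n + 1) - x n) := by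
    intro n hn
    have h1 := one_sub_unitExp_mul_kernelCoeff (hsin n hn).ne'
    have h2 : unitExp (x (n + 1)) = unitExp (x n) * unitExp (x (n + 1) - x n) := by
      rw [← unitExp_add]; congr 1; ring
    rw [h2]
    linear_combination (-unitExp (x n)) * h1
  induction N with
  | zero => 
    rw [Finset.sum_range_one, key 0 le_rfl, norm_mul, norm_unitExp]
    simp
  | succ N ih =>
    have ih' := ih (fun n hn => hmono n (by omega)) (fun n hn => hlo n (by omega))
      (fun n hn => hhi n (by omega)) (fun n hn => hsin n (by omega)) (fun n hn => key n (by omega))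
    rw [Finset.sum_range_succ, add_assoc, key (N + 1) le_rfl]
    have e1 : ∑ n ∈ Finset.range (N + 1), unitExp (x n)
        + unitExp (x (N + 1)) * kernelCoeff (x (N + 1 + 1) - x (N + 1))
        = (∑ n ∈ Finset.range (N + 1), unitExp (x n)
          + unitExp (x (N + 1)) * kernelCoeff (x (N + 1) - x N))
          + unitExp (x (N + 1)) *
            (kernelCoeff (x (N + 1 + 1) - x (N + 1)) - kernelCoeff (x (N + 1) - x N)) := by ring
    rw [e1]
    refine (norm_add_le _ _).trans ?_
    rw [norm_mul, norm_unitExp, one_mul]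
    have hc := cot_antitone (hsin N (by omega)) (hsin (N + 1) le_rfl) (hmono N (by omega))
      (by have := hlo N (by omega); have := hhi (N + 1) le_rfl; linarith)
    have e2 : kernelCoeff (x (N + 1 + 1) - x (N + 1)) - kernelCoeff (x (N + 1) - x N)
        = (((Real.cos (Real.pi * (x (N + 1 + 1) - x (N + 1))) /
            Real.sin (Real.pi * (x (N + 1 + 1) - x (N + 1))) -
           Real.cos (Real.pi * (x (N + 1) - x N)) / Real.sin (Real.pi * (x (N + 1) - x N))) / 2 : ℝ)
            : ℂ) * Complex.I := by
      unfold kernelCoeff; push_cast; ring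
    rw [e2, norm_mul, Complex.norm_I, mul_one, Complex.norm_real, Real.norm_eq_abs,
      abs_of_nonpos (by linarith)]
    linarith

/-- The Kusmin–Landau inequality for sequences. -/
lemma kusmin_landau (x : ℕ → ℝ) (N : ℕ) (k : ℤ) {θ : ℝ} (hθ : 0 < θ)
    (hmono : ∀ n, n + 1 < N → x (n + 1) - x n ≤ x (n + 2) - x (n + 1))
    (hlo : ∀ n < N, k + θ ≤ x (n + 1) - x n) (hhi : ∀ n < N, x (n + 1) - x n ≤ k + 1 - θ) :
    ‖∑ n ∈ Finset.range N, unitExp (x n)‖ ≤ 2 / θ := by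
  rcases N with _ | N
  · simp; positivity
  -- Subtracting `k * n` leaves the exponentials unchanged and moves the steps into `[θ, 1 - θ]`.
  set y : ℕ → ℝ := fun n => x n - k * n with hy
  have hxy : ∀ n, unitExp (x n) = unitExp (y n) := by
    intro n
    have : x n = y n + ((k * n : ℤ) : ℝ) := by simp [hy]
    rw [this, unitExp_add, unitExp_int, mul_one]
  have hd : ∀ n, y (n + 1) - y n = x (n + 1) - x n - k := by
    intro n; simp only [hy]; push_cast; ring
  have hlo' : ∀ n ≤ N, θ ≤ y (n + 1) - y n := fun n hn => by
    rw [hd]; linarith [hlo n (by omega)]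
  have hhi' : ∀ n ≤ N, y (n + 1) - y n ≤ 1 - θ := fun n hn => by
    rw [hd]; linarith [hhi n (by omega)]
  have h := norm_sum_add_boundary_le y N hθ
    (fun n hn => by rw [hd, hd (n + 1)]; linarith [hmono n (by omega)]) hlo' hhi'
  simp_rw [hxy]
  have h1 := norm_kernelCoeff_le hθ (hlo' 0 (by omega)) (hhi' 0 (by omega))
  have h2 := norm_kernelCoeff_le hθ (hlo' N (by omega)) (hhi' N (by omega))
  have h3 := abs_le.1 (abs_cot_le hθ (hlo' 0 (by omega)) (hhi' 0 (by omega)))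
  have h4 := abs_le.1 (abs_cot_le hθ (hlo' N (by omega)) (hhi' N (by omega)))
  have h5 : ‖∑ n ∈ Finset.range (N + 1), unitExp (y n)‖ ≤
      ‖∑ n ∈ Finset.range (N + 1), unitExp (y n) + unitExp (y (N + 1)) * kernelCoeff (y (N + 1) - y N)‖
      + ‖unitExp (y (N + 1)) * kernelCoeff (y (N + 1) - y N)‖ := by
    have := norm_sub_le (∑ n ∈ Finset.range (N + 1), unitExp (y n) +
      unitExp (y (N + 1)) * kernelCoeff (y (N + 1) - y N))
      (unitExp (y (N + 1)) * kernelCoeff (y (N + 1) - y N))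
    rwa [add_sub_cancel_right] at this
  rw [norm_mul, norm_unitExp, one_mul] at h5
  have h6 : 2 / θ = 4 * (1 / (2 * θ)) := by field_simp; norm_num
  have h7 : 0 < 1 / (2 * θ) := by positivity
  simp only [zero_add] at h1 h3
  rw [h6]
  linarith [h3.2, h4.1]

lemma exists_eq_Ico_of_ordConnected (s : Finset ℕ)
    (h : ∀ a ∈ s, ∀ b ∈ s, ∀ c, a ≤ c → c ≤ b → c ∈ s) :
    ∃ m m' : ℕ, m ≤ m' ∧ s = Finset.Ico m m' := by
  rcases s.eq_empty_or_nonempty with rfl | hne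
  · exact ⟨0, 0, le_rfl, by simp⟩
  · refine ⟨s.min' hne, s.max' hne + 1, ?_, ?_⟩
    · exact (s.min'_le _ (s.max'_mem hne)).trans (Nat.le_succ _)
    · ext n
      rw [Finset.mem_Ico]
      constructor
      · exact fun hn => ⟨s.min'_le _ hn, Nat.lt_succ_of_le (s.le_max' _ hn)⟩
      · exact fun hn => h _ (s.min'_mem hne) _ (s.max'_mem hne) _ hn.1 (Nat.le_of_lt_succ hn.2)

/-! ### Van der Corput's second derivative test -/

/-- The second difference of a sequence. -/
def secondDiff (x : ℕ → ℝ) (n : ℕ) : ℝ := x (n + 2) - 2 * x (n + 1) + x n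

section SecondDerivativeTest

variable {x : ℕ → ℝ} {N : ℕ} {l : ℝ}

lemma mul_le_diff_sub_diff (hlo : ∀ n < N, l ≤ secondDiff x n) {a b : ℕ} (hab : a ≤ b)
    (hb : b ≤ N) : l * ((b : ℝ) - a) ≤ (x (b + 1) - x b) - (x (a + 1) - x a) := by
  induction b, hab using Nat.le_induction with
  | base => simp
  | succ b hab ih =>
    have h1 := ih (by omega)
    have h2 := hlo b (by omega)
    unfold secondDiff at h2
    push_cast
    rw [show b + 1 + 1 = b + 2 from rfl]
    linarith

lemma diff_sub_diff_le (hhi : ∀ n < N, secondDiff x n ≤ l) {a b : ℕ} (hab : a ≤ b)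
    (hb : b ≤ N) : (x (b + 1) - x b) - (x (a + 1) - x a) ≤ l * ((b : ℝ) - a) := by
  induction b, hab using Nat.le_induction with
  | base => simp
  | succ b hab ih =>
    have h1 := ih (by omega)
    have h2 := hhi b (by omega)
    unfold secondDiff at h2
    push_cast
    rw [show b + 1 + 1 = b + 2 from rfl]
    linarith

/-- Nonnegative second differences make the first differences nondecreasing, so those lying in an
order-connected set occur at consecutive indices. -/
lemma filter_diff_mem_eq_Ico (hl : 0 ≤ l) (hlo : ∀ n < N, l ≤ secondDiff x n) (I : Set ℝ)
    [I.OrdConnected] [DecidablePred (· ∈ I)] :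
    ∃ m m' : ℕ, m ≤ m' ∧
      (Finset.range N).filter (fun n => x (n + 1) - x n ∈ I) = Finset.Ico m m' := by
  apply exists_eq_Ico_of_ordConnected
  intro a ha b hb c hac hcb
  simp only [Finset.mem_filter, Finset.mem_range] at ha hb ⊢
  have h1 := mul_le_diff_sub_diff hlo hac (by omega)
  have h2 := mul_le_diff_sub_diff hlo hcb (by omega)
  have h3 : 0 ≤ l * ((c : ℝ) - a) :=
    mul_nonneg hl (sub_nonneg.2 (by exact_mod_cast hac))
  have h4 : 0 ≤ l * ((b : ℝ) - c) :=
    mul_nonneg hl (sub_nonneg.2 (by exact_mod_cast hcb))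
  exact ⟨by omega, Set.OrdConnected.out ‹_› ha.2 hb.2 ⟨by linarith, by linarith⟩⟩

lemma card_filter_diff_mem_Icc_le (hl : 0 < l) (hlo : ∀ n < N, l ≤ secondDiff x n) {u v : ℝ}
    (huv : u ≤ v) [DecidablePred (· ∈ Icc u v)] :
    (((Finset.range N).filter (fun n => x (n + 1) - x n ∈ Icc u v)).card : ℝ) ≤ (v - u) / l + 1 := by
  obtain ⟨m, m', hmm, hs⟩ := filter_diff_mem_eq_Ico hl.le hlo (Icc u v)
  rw [hs, Nat.card_Ico]
  rcases hmm.eq_or_lt with rfl | hlt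
  · simp; have := div_nonneg (sub_nonneg.2 huv) hl.le; linarith
  have hm : m ∈ Finset.Ico m m' := by simp [hlt]
  have hm' : m' - 1 ∈ Finset.Ico m m' := by simp; omega
  rw [← hs, Finset.mem_filter, Finset.mem_range] at hm hm'
  have h1 := mul_le_diff_sub_diff hlo (show m ≤ m' - 1 by omega) hm'.1.le
  have h2 := hm.2.1
  have h3 := hm'.2.2
  rw [Nat.cast_sub hmm]
  rw [Nat.cast_sub (by omega)] at h1
  rw [← sub_le_iff_le_add, le_div_iff₀ hl]
  push_cast at h1
  linarith

lemma norm_sum_filter_diff_mem_Icc_le (hl : 0 < l) (hlo : ∀ n < N, l ≤ secondDiff x n) (k : ℤ)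
    {θ : ℝ} (hθ : 0 < θ) [DecidablePred (· ∈ Icc (k + θ) (k + 1 - θ))] :
    ‖∑ n ∈ (Finset.range N).filter (fun n => x (n + 1) - x n ∈ Icc (k + θ) (k + 1 - θ)),
      unitExp (x n)‖ ≤ 2 / θ := by
  obtain ⟨m, m', hmm, hs⟩ := filter_diff_mem_eq_Ico hl.le hlo (Icc (k + θ) (k + 1 - θ))
  have hmem : ∀ n < m' - m, m + n < N ∧ x (m + n + 1) - x (m + n) ∈ Icc (k + θ) (k + 1 - θ) := by
    intro n hn
    have : m + n ∈ Finset.Ico m m' := by simp; omega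
    rwa [← hs, Finset.mem_filter, Finset.mem_range] at this
  rw [hs, Finset.sum_Ico_eq_sum_range]
  refine kusmin_landau (fun n => x (m + n)) (m' - m) k hθ ?_ ?_ ?_
  · intro n hn
    have h1 := hlo (m + n) (hmem n (by omega)).1
    unfold secondDiff at h1
    simp only [← add_assoc]
    linarith
  · exact fun n hn => (hmem n hn).2.1
  · exact fun n hn => (hmem n hn).2.2

/-- Van der Corput's second derivative test for sequences. -/
lemma norm_sum_unitExp_le (hl : 0 < l) (hlo : ∀ n < N, l ≤ secondDiff x n)
    (hhi : ∀ n < N, secondDiff x n ≤ 2 * l) :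
    ‖∑ n ∈ Finset.range N, unitExp (x n)‖ ≤ 10 * (N * √l + 1 / √l) := by
  classical
  have hs : 0 < √l := Real.sqrt_pos.2 hl
  have hsq : √l * √l = l := Real.mul_self_sqrt hl.le
  rcases Nat.eq_zero_or_pos N with rfl | hN
  · simp
  -- For large `l` the trivial bound `N` already suffices. Otherwise `1 / √l ≥ 4`, which later
  -- absorbs additive constants.
  by_cases hbig : 1 / 4 < √l
  · calc ‖∑ n ∈ Finset.range N, unitExp (x n)‖ ≤ ∑ n ∈ Finset.range N, ‖unitExp (x n)‖ :=
          norm_sum_le _ _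
      _ = N := by simp [norm_unitExp]
      _ ≤ _ := by
        have : 0 ≤ 1 / √l := by positivity
        have : (0 : ℝ) ≤ N := by positivity
        nlinarith
  push Not at hbig
  set D : ℕ → ℝ := fun n => x (n + 1) - x n with hD
  have hmono : ∀ a b, a ≤ b → b < N → D a ≤ D b := by
    intro a b hab hb
    have h1 := mul_le_diff_sub_diff hlo hab hb.le
    have : 0 ≤ l * ((b : ℝ) - a) := mul_nonneg hl.le (sub_nonneg.2 (by exact_mod_cast hab))
    simp only [hD]; linarith
  -- Split the steps with integer part `k`. Those within `√l` of an integer number at most `√l / l +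
  -- 1` on each side, because the steps grow by at least `l`. The rest are handled by Kusmin–Landau
  -- with `θ = √l`. The total is `4/√l + 2 ≤ 5/√l`.
  have hfib : ∀ k : ℤ, ‖∑ n ∈ (Finset.range N).filter (fun n => ⌊D n⌋ = k), unitExp (x n)‖
      ≤ 5 / √l := by
    intro k
    have hsub : (Finset.range N).filter (fun n => ⌊D n⌋ = k) ⊆
        ((Finset.range N).filter (fun n => D n ∈ Icc (k : ℝ) (k + √l)) ∪
          (Finset.range N).filter (fun n => D n ∈ Icc (k + 1 - √l) (k + 1 : ℝ))) ∪
        (Finset.range N).filter (fun n => D n ∈ Icc (k + √l) (k + 1 - √l)) := by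
      intro n hn
      simp only [Finset.mem_filter, Finset.mem_union, Int.floor_eq_iff, mem_Icc] at hn ⊢
      rcases le_total (D n) (k + √l) with h | h
      · left; left; exact ⟨hn.1, hn.2.1, h⟩
      rcases le_total (D n) (k + 1 - √l) with h' | h'
      · right; exact ⟨hn.1, h, h'⟩
      · left; right; exact ⟨hn.1, h', hn.2.2.le⟩
    set A := (Finset.range N).filter (fun n => ⌊D n⌋ = k) with hA
    set M := (Finset.range N).filter (fun n => D n ∈ Icc (k + √l) (k + 1 - √l)) with hM
    have hMA : M ⊆ A := by
      intro n hn
      simp only [hM, hA, Finset.mem_filter, Int.floor_eq_iff, mem_Icc] at hn ⊢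
      exact ⟨hn.1, by linarith, by linarith⟩
    rw [← Finset.sum_sdiff hMA]
    have h1 : ‖∑ n ∈ A \ M, unitExp (x n)‖ ≤ 2 * (√l / l + 1) := by
      calc ‖∑ n ∈ A \ M, unitExp (x n)‖ ≤ ∑ n ∈ A \ M, ‖unitExp (x n)‖ := norm_sum_le _ _
        _ = ((A \ M).card : ℝ) := by simp [norm_unitExp]
        _ ≤ (((Finset.range N).filter (fun n => D n ∈ Icc (k : ℝ) (k + √l)) ∪
          (Finset.range N).filter (fun n => D n ∈ Icc (k + 1 - √l) (k + 1 : ℝ))).card : ℝ) := by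
            refine Nat.cast_le.2 (Finset.card_le_card fun n hn => ?_)
            have hn' := Finset.mem_sdiff.1 hn
            exact (Finset.mem_union.1 (hsub hn'.1)).resolve_right hn'.2
        _ ≤ _ := by
            refine (Nat.cast_le.2 (Finset.card_union_le _ _)).trans ?_
            push_cast
            have e1 := card_filter_diff_mem_Icc_le hl hlo (show (k : ℝ) ≤ k + √l by linarith)
            have e2 := card_filter_diff_mem_Icc_le hl hlo (show (k : ℝ) + 1 - √l ≤ k + 1 by linarith)
            have e3 : (k + √l - k) / l = √l / l := by congr 1; ring
            have e4 : ((k : ℝ) + 1 - (k + 1 - √l)) / l = √l / l := by congr 1; ring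
            rw [e3] at e1
            rw [e4] at e2
            linarith
    have h2 : ‖∑ n ∈ M, unitExp (x n)‖ ≤ 2 / √l := norm_sum_filter_diff_mem_Icc_le hl hlo k hs
    refine (norm_add_le _ _).trans ?_
    have h3 : √l / l = 1 / √l := Real.sqrt_div_self'
    have h4 : 4 ≤ 1 / √l := by rw [le_div_iff₀ hs]; linarith
    rw [h3] at h1
    have h5 : 2 / √l = 2 * (1 / √l) := by ring
    have h6 : 5 / √l = 5 * (1 / √l) := by ring
    rw [h5] at h2
    rw [h6]
    linarith
  have hmaps : ∀ n ∈ Finset.range N, ⌊D n⌋ ∈ Finset.Icc ⌊D 0⌋ ⌊D (N - 1)⌋ := by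
    intro n hn
    rw [Finset.mem_range] at hn
    rw [Finset.mem_Icc]
    exact ⟨Int.floor_le_floor (hmono 0 n (by omega) hn),
      Int.floor_le_floor (hmono n (N - 1) (by omega) (by omega))⟩
  rw [← Finset.sum_fiberwise_of_maps_to hmaps]
  refine (norm_sum_le _ _).trans ((Finset.sum_le_sum fun k _ => hfib k).trans ?_)
  rw [Finset.sum_const, nsmul_eq_mul]
  -- The first differences vary by at most `2 l N` in total, which bounds the number of integer
  -- parts they take.
  have hcard : ((Finset.Icc ⌊D 0⌋ ⌊D (N - 1)⌋).card : ℝ) ≤ 2 * l * N + 2 := by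
    rw [Int.card_Icc]
    have h1 : ⌊D 0⌋ ≤ ⌊D (N - 1)⌋ :=
      Int.floor_le_floor (hmono 0 (N - 1) (by omega) (by omega))
    have h2 : (((⌊D (N - 1)⌋ + 1 - ⌊D 0⌋).toNat : ℤ) : ℝ) = ⌊D (N - 1)⌋ + 1 - ⌊D 0⌋ := by
      rw [Int.toNat_of_nonneg (by omega)]; push_cast; ring
    rw [← Int.cast_natCast, h2]
    have h3 := Int.floor_le (D (N - 1))
    have h4 := Int.lt_floor_add_one (D 0)
    have h5 := diff_sub_diff_le hhi (show 0 ≤ N - 1 by omega) (by omega)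
    have h6 : ((N - 1 : ℕ) : ℝ) ≤ N := by exact_mod_cast Nat.sub_le _ _
    have h7 : 2 * l * ((N - 1 : ℕ) : ℝ) ≤ 2 * l * N := by gcongr
    simp only [hD] at h3 h4 ⊢
    push_cast at h5
    simp only [zero_add, sub_zero] at h4 h5 ⊢
    linarith
  calc _ ≤ (2 * l * N + 2) * (5 / √l) := by gcongr
    _ = 10 * (N * (l / √l) + 1 / √l) := by ring
    _ = _ := by rw [Real.div_sqrt]

/-- The second derivative test without a sign condition. -/
lemma norm_sum_unitExp_le_of_sign {ε : ℝ} (hε : ε = 1 ∨ ε = -1) (hl : 0 < l)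
    (hlo : ∀ n < N, l ≤ ε * secondDiff x n) (hhi : ∀ n < N, ε * secondDiff x n ≤ 2 * l) :
    ‖∑ n ∈ Finset.range N, unitExp (x n)‖ ≤ 10 * (N * √l + 1 / √l) := by
  rcases hε with rfl | rfl
  · exact norm_sum_unitExp_le hl (by simpa using hlo) (by simpa using hhi)
  · have hsd : ∀ n, secondDiff (fun n => -x n) n = -1 * secondDiff x n := by
      intro n; unfold secondDiff; ring
    have h := norm_sum_unitExp_le (x := fun n => -x n) (N := N) hl
      (fun n hn => by rw [hsd]; exact hlo n hn) (fun n hn => by rw [hsd]; exact hhi n hn)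
    simp_rw [unitExp_neg] at h
    rw [← map_sum, RCLike.norm_conj] at h
    exact h

end SecondDerivativeTest

/-! ### From exponential sums to sawtooth sums -/

/-- The sawtooth function. -/
noncomputable def sawtooth (x : ℝ) : ℝ := Int.fract x - 1 / 2

lemma abs_sawtooth_le (x : ℝ) : |sawtooth x| ≤ 1 / 2 := by
  unfold sawtooth
  rw [abs_le]
  constructor <;> linarith [Int.fract_nonneg x, Int.fract_lt_one x]

/-- The periodic second Bernoulli function. -/
noncomputable def bernoulliTwo (x : ℝ) : ℝ := Int.fract x ^ 2 - Int.fract x + 1 / 6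

lemma hasSum_bernoulliTwo (x : ℝ) :
    HasSum (fun n : ℕ => 1 / (n : ℝ) ^ 2 * Real.cos (2 * Real.pi * n * x))
      (Real.pi ^ 2 * bernoulliTwo x) := by
  have h := hasSum_one_div_nat_pow_mul_cos one_ne_zero (x := Int.fract x)
    ⟨Int.fract_nonneg x, (Int.fract_lt_one x).le⟩
  have hpoly : (Polynomial.map (algebraMap ℚ ℝ) (Polynomial.bernoulli (2 * 1))).eval (Int.fract x)
      = bernoulliTwo x := by
    simp [Polynomial.bernoulli, Finset.sum_range_succ, bernoulliTwo, bernoulli_one, bernoulli_two]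
    ring
  rw [hpoly] at h
  convert! h using 1
  · funext n
    congr 1
    have : 2 * Real.pi * n * x = 2 * Real.pi * n * Int.fract x + ((n * ⌊x⌋ : ℤ) : ℝ) * (2 * Real.pi) := by
      have := Int.fract_add_floor x
      push_cast
      linear_combination (-2 * Real.pi * n) * this
    rw [this, Real.cos_add_int_mul_two_pi]
  · norm_num [Nat.factorial]
    left
    ring

/-- Away from the integers the derivative of `bernoulliTwo` is `2 * sawtooth`. Crossing an integer
only makes the sawtooth drop, so the inequality survives without any case excluded. With its mirror
image `le_bernoulliTwo_sub` it traps the sawtooth between difference quotients of a function with an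
absolutely convergent Fourier series. -/
lemma bernoulliTwo_add_sub_le (x : ℝ) {t : ℝ} (ht0 : 0 ≤ t) (ht1 : t < 1) :
    bernoulliTwo (x + t) - bernoulliTwo x ≤ 2 * t * sawtooth x + t ^ 2 := by
  have h0 := Int.fract_nonneg x
  have h1 := Int.fract_lt_one x
  have hx := Int.fract_add_floor x
  unfold bernoulliTwo sawtooth
  by_cases h : Int.fract x + t < 1
  · have : Int.fract (x + t) = Int.fract x + t := by
      rw [Int.fract_eq_iff]
      exact ⟨by linarith, h, ⌊x⌋, by linarith⟩
    rw [this]; nlinarith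
  · have : Int.fract (x + t) = Int.fract x + t - 1 := by
      rw [Int.fract_eq_iff]
      exact ⟨by linarith, by linarith, ⌊x⌋ + 1, by push_cast; linarith⟩
    rw [this]; nlinarith

lemma le_bernoulliTwo_sub (x : ℝ) {t : ℝ} (ht0 : 0 ≤ t) (ht1 : t < 1) :
    2 * t * sawtooth x - t ^ 2 ≤ bernoulliTwo x - bernoulliTwo (x - t) := by
  have h0 := Int.fract_nonneg x
  have h1 := Int.fract_lt_one x
  have hx := Int.fract_add_floor x
  unfold bernoulliTwo sawtooth
  by_cases h : t ≤ Int.fract x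
  · have : Int.fract (x - t) = Int.fract x - t := by
      rw [Int.fract_eq_iff]
      exact ⟨by linarith, by linarith, ⌊x⌋, by linarith⟩
    rw [this]; nlinarith
  · have : Int.fract (x - t) = Int.fract x - t + 1 := by
      rw [Int.fract_eq_iff]
      exact ⟨by linarith, by linarith, ⌊x⌋ - 1, by push_cast; linarith⟩
    rw [this]; nlinarith

lemma norm_unitExp_sub_one_le {t : ℝ} (ht : 0 ≤ t) :
    ‖unitExp t - 1‖ ≤ 2 * Real.pi * min 1 t := by
  rcases le_total 1 t with h | h
  · rw [min_eq_left h]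
    have := norm_sub_le (unitExp t) 1
    rw [norm_unitExp, norm_one] at this
    linarith [Real.pi_gt_three]
  · rw [min_eq_right h]
    have := Real.norm_exp_I_mul_ofReal_sub_one_le (x := 2 * Real.pi * t)
    rw [mul_comm Complex.I] at this
    refine this.trans ?_
    rw [Real.norm_eq_abs, abs_of_nonneg (by positivity)]

/-- The summand behaves like `t / √h` for `h ≤ 1/t` and like `h ^ (-3/2)` beyond. It is majorised by
consecutive differences of one explicit function, so the sum telescopes to order `√t`. -/
lemma sqrt_div_sq_mul_min_le {t : ℝ} (ht : 0 < t) (n : ℕ) :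
    √((n : ℝ) + 1) / ((n : ℝ) + 1) ^ 2 * min 1 (((n : ℝ) + 1) * t) ≤
      8 * (√t / (1 + √n * √t) - √t / (1 + √((n : ℝ) + 1) * √t)) := by
  set a := √((n : ℝ) + 1) with ha
  set b := √(n : ℝ) with hb
  set w := √t with hw
  have ha2 : a ^ 2 = n + 1 := Real.sq_sqrt (by positivity)
  have hb2 : b ^ 2 = n := Real.sq_sqrt (by positivity)
  have hw2 : w ^ 2 = t := Real.sq_sqrt ht.le
  have ha0 : 0 < a := Real.sqrt_pos.2 (by positivity)
  have hb0 : 0 ≤ b := Real.sqrt_nonneg _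
  have hw0 : 0 < w := Real.sqrt_pos.2 ht
  have hab : b ≤ a := Real.sqrt_le_sqrt (by linarith)
  rw [← ha2, ← hw2]
  have e1 : w / (1 + b * w) - w / (1 + a * w) = w ^ 2 * (a - b) / ((1 + b * w) * (1 + a * w)) := by
    field_simp; ring
  have e2 : w ^ 2 / (2 * a * (1 + a * w) ^ 2) ≤ w ^ 2 * (a - b) / ((1 + b * w) * (1 + a * w)) := by
    have h1 : 1 ≤ (a - b) * (2 * a) := by nlinarith
    rw [div_le_div_iff₀ (by positivity) (by positivity)]
    have h2 : (1 + b * w) * (1 + a * w) ≤ (1 + a * w) ^ 2 := by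
      rw [sq]; gcongr
    calc w ^ 2 * ((1 + b * w) * (1 + a * w)) ≤ w ^ 2 * (1 + a * w) ^ 2 * 1 := by
          rw [mul_one]; gcongr
      _ ≤ w ^ 2 * (1 + a * w) ^ 2 * ((a - b) * (2 * a)) := by gcongr
      _ = _ := by ring
  rw [e1]
  refine le_trans ?_ (mul_le_mul_of_nonneg_left e2 (by norm_num))
  have e3 : a / (a ^ 2) ^ 2 * min 1 (a ^ 2 * w ^ 2) = min 1 (a ^ 2 * w ^ 2) / a ^ 3 := by
    field_simp
  rw [e3, mul_div_assoc', div_le_div_iff₀ (by positivity) (by positivity)]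
  have hm : min 1 (a ^ 2 * w ^ 2) * (1 + a * w) ^ 2 ≤ 4 * (a ^ 2 * w ^ 2) := by
    have hz : 0 < a * w := by positivity
    rcases le_total 1 (a * w) with h | h
    · calc _ ≤ 1 * (1 + a * w) ^ 2 := by gcongr; exact min_le_left _ _
        _ ≤ _ := by nlinarith
    · calc _ ≤ (a ^ 2 * w ^ 2) * (1 + a * w) ^ 2 := by gcongr; exact min_le_right _ _
        _ ≤ (a ^ 2 * w ^ 2) * 4 := by gcongr; nlinarith
        _ = _ := by ring
  calc _ = 2 * a * (min 1 (a ^ 2 * w ^ 2) * (1 + a * w) ^ 2) := by ring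
    _ ≤ 2 * a * (4 * (a ^ 2 * w ^ 2)) := by gcongr
    _ = _ := by ring

lemma sum_sqrt_div_sq_mul_min_le {t : ℝ} (ht : 0 < t) (M : ℕ) :
    ∑ h ∈ Finset.range M, √(h : ℝ) / (h : ℝ) ^ 2 * min 1 ((h : ℝ) * t) ≤ 8 * √t := by
  have key : ∀ M : ℕ, ∑ h ∈ Finset.range (M + 1), √(h : ℝ) / (h : ℝ) ^ 2 * min 1 ((h : ℝ) * t) ≤
      8 * (√t - √t / (1 + √(M : ℝ) * √t)) := by
    intro M
    induction M with
    | zero => simp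
    | succ M ih =>
      rw [Finset.sum_range_succ]
      have := sqrt_div_sq_mul_min_le ht M
      push_cast
      linarith
  have hpos : ∀ M : ℕ, 0 ≤ √t / (1 + √(M : ℝ) * √t) := fun M => by positivity
  rcases M with _ | M
  · simp
  · linarith [key M, hpos M]

section Sawtooth

variable {x : ℕ → ℝ} {N : ℕ} {ε l t : ℝ}

/-- At frequency `h` the second differences are scaled by `h`, and the shift by `t` contributes the
factor `e(h t) - 1`, of size `min 1 (h t)`. The superfluous `min 1 (h * 1)` lets
`sum_sqrt_div_sq_mul_min_le` be applied to both terms, the second time with `t = 1`. -/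
lemma abs_sum_cos_sub_le (hε : ε = 1 ∨ ε = -1) (hl : 0 < l)
    (hlo : ∀ n < N, l ≤ ε * secondDiff x n) (hhi : ∀ n < N, ε * secondDiff x n ≤ 2 * l)
    (ht : 0 ≤ t) (h : ℕ) :
    |∑ n ∈ Finset.range N, (1 / (h : ℝ) ^ 2 * Real.cos (2 * Real.pi * h * (x n + t)) -
      1 / (h : ℝ) ^ 2 * Real.cos (2 * Real.pi * h * x n))| ≤
    20 * Real.pi * (N * √l * (√(h : ℝ) / (h : ℝ) ^ 2 * min 1 ((h : ℝ) * t)) +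
      t / √l * (√(h : ℝ) / (h : ℝ) ^ 2 * min 1 ((h : ℝ) * 1))) := by
  rcases Nat.eq_zero_or_pos h with rfl | hh
  · simp
  have hh' : (0 : ℝ) < h := by exact_mod_cast hh
  have hh1 : (1 : ℝ) ≤ h := by exact_mod_cast hh
  have e1 : ∑ n ∈ Finset.range N, (1 / (h : ℝ) ^ 2 * Real.cos (2 * Real.pi * h * (x n + t)) -
      1 / (h : ℝ) ^ 2 * Real.cos (2 * Real.pi * h * x n))
      = 1 / (h : ℝ) ^ 2 *
        ((unitExp (h * t) - 1) * ∑ n ∈ Finset.range N, unitExp (h * x n)).re := by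
    rw [Finset.mul_sum, Complex.re_sum, Finset.mul_sum]
    refine Finset.sum_congr rfl fun n _ => ?_
    rw [sub_mul, ← unitExp_add, one_mul, Complex.sub_re, unitExp_re, unitExp_re]
    rw [show 2 * Real.pi * (h * t + h * x n) = 2 * Real.pi * h * (x n + t) by ring,
      show 2 * Real.pi * (h * x n) = 2 * Real.pi * h * x n by ring]
    ring
  have hsd : ∀ n, secondDiff (fun n => h * x n) n = h * secondDiff x n := by
    intro n; unfold secondDiff; ring
  have h1 := norm_sum_unitExp_le_of_sign (x := fun n => h * x n) (N := N) hε
    (show 0 < h * l by positivity)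
    (fun n hn => by
      rw [hsd]; have := mul_le_mul_of_nonneg_left (hlo n hn) hh'.le; linarith)
    (fun n hn => by
      rw [hsd]; have := mul_le_mul_of_nonneg_left (hhi n hn) hh'.le; linarith)
  have h2 := norm_unitExp_sub_one_le (t := h * t) (by positivity)
  rw [e1, abs_mul, abs_of_pos (by positivity : (0 : ℝ) < 1 / (h : ℝ) ^ 2)]
  have hsq : √(h : ℝ) * √(h : ℝ) = h := Real.mul_self_sqrt hh'.le
  have hsp : 0 < √(h : ℝ) := Real.sqrt_pos.2 hh'
  have hlp : 0 < √l := Real.sqrt_pos.2 hl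
  have hmin0 : 0 ≤ min 1 ((h : ℝ) * t) := le_min zero_le_one (by positivity)
  have hfin : 1 / (h : ℝ) ^ 2 * (min 1 (h * t) * (1 / √(h * l)))
      ≤ t / √l * (√(h : ℝ) / (h : ℝ) ^ 2) := by
    rw [Real.sqrt_mul hh'.le]
    calc 1 / (h : ℝ) ^ 2 * (min 1 (h * t) * (1 / (√h * √l)))
        ≤ 1 / (h : ℝ) ^ 2 * ((h * t) * (1 / (√h * √l))) := by gcongr; exact min_le_right _ _
      _ = t / √l * ((h : ℝ) / √h / (h : ℝ) ^ 2) := by field_simp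
      _ = _ := by rw [Real.div_sqrt]
  calc 1 / (h : ℝ) ^ 2 * |((unitExp (h * t) - 1) * ∑ n ∈ Finset.range N, unitExp (h * x n)).re|
      ≤ 1 / (h : ℝ) ^ 2 * ((2 * Real.pi * min 1 (h * t)) *
          (10 * (N * √(h * l) + 1 / √(h * l)))) := by
        gcongr
        refine (Complex.abs_re_le_norm _).trans ?_
        rw [norm_mul]
        gcongr
    _ = 20 * Real.pi * (N * √l * (√(h : ℝ) / (h : ℝ) ^ 2 * min 1 ((h : ℝ) * t)) +
          1 / (h : ℝ) ^ 2 * (min 1 (h * t) * (1 / √(h * l)))) := by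
        rw [Real.sqrt_mul hh'.le]; ring
    _ ≤ _ := by
        rw [mul_one, min_eq_left hh1, mul_one]
        gcongr

/-- Sum the frequency-wise bounds over partial sums of the Fourier series and pass to the limit. -/
lemma abs_sum_bernoulliTwo_sub_le (hε : ε = 1 ∨ ε = -1) (hl : 0 < l)
    (hlo : ∀ n < N, l ≤ ε * secondDiff x n) (hhi : ∀ n < N, ε * secondDiff x n ≤ 2 * l)
    (ht : 0 < t) :
    |∑ n ∈ Finset.range N, (bernoulliTwo (x n + t) - bernoulliTwo (x n))| ≤
      160 * (N * √l * √t + t / √l) := by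
  have hsum : HasSum (fun h : ℕ => ∑ n ∈ Finset.range N,
      (1 / (h : ℝ) ^ 2 * Real.cos (2 * Real.pi * h * (x n + t)) -
        1 / (h : ℝ) ^ 2 * Real.cos (2 * Real.pi * h * x n)))
      (∑ n ∈ Finset.range N, (Real.pi ^ 2 * bernoulliTwo (x n + t) -
        Real.pi ^ 2 * bernoulliTwo (x n))) :=
    hasSum_sum fun n _ => (hasSum_bernoulliTwo _).sub (hasSum_bernoulliTwo _)
  have hbound : |∑ n ∈ Finset.range N, (Real.pi ^ 2 * bernoulliTwo (x n + t) -
        Real.pi ^ 2 * bernoulliTwo (x n))| ≤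
      20 * Real.pi * (N * √l * (8 * √t) + t / √l * (8 * √1)) := by
    refine le_of_tendsto' (hsum.tendsto_sum_nat.abs) fun M => ?_
    refine (Finset.abs_sum_le_sum_abs _ _).trans ?_
    refine (Finset.sum_le_sum fun h _ => abs_sum_cos_sub_le hε hl hlo hhi ht.le h).trans ?_
    rw [← Finset.mul_sum, Finset.sum_add_distrib, ← Finset.mul_sum, ← Finset.mul_sum]
    have h1 := sum_sqrt_div_sq_mul_min_le ht M
    have h2 := sum_sqrt_div_sq_mul_min_le one_pos M
    gcongr
  simp_rw [← mul_sub] at hbound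
  rw [← Finset.mul_sum, abs_mul, abs_of_pos (by positivity : 0 < Real.pi ^ 2), Real.sqrt_one] at hbound
  set S := |∑ n ∈ Finset.range N, (bernoulliTwo (x n + t) - bernoulliTwo (x n))|
  have hS : 0 ≤ S := abs_nonneg _
  have hR : 0 ≤ N * √l * √t + t / √l := by positivity
  have hpi := Real.pi_gt_three
  have h3 : Real.pi * (Real.pi * S) ≤ Real.pi * (160 * (N * √l * √t + t / √l)) := by
    nlinarith
  have h4 := le_of_mul_le_mul_left h3 Real.pi_pos
  nlinarith

/-- Sawtooth sums along a sequence whose second differences are comparable with `w ^ 6`. -/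
lemma abs_sum_sawtooth_le {w : ℝ} (hε : ε = 1 ∨ ε = -1) (hw : 0 < w)
    (hlo : ∀ n < N, w ^ 6 ≤ ε * secondDiff x n)
    (hhi : ∀ n < N, ε * secondDiff x n ≤ 2 * w ^ 6) :
    |∑ n ∈ Finset.range N, sawtooth (x n)| ≤ 81 * (N * w ^ 2 + 1 / w ^ 3) := by
  by_cases hw1 : 1 ≤ w
  · calc |∑ n ∈ Finset.range N, sawtooth (x n)| ≤ ∑ n ∈ Finset.range N, |sawtooth (x n)| :=
          Finset.abs_sum_le_sum_abs _ _
      _ ≤ ∑ n ∈ Finset.range N, (1 / 2 : ℝ) := Finset.sum_le_sum fun n _ => abs_sawtooth_le _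
      _ = N * (1 / 2) := by simp
      _ ≤ _ := by
        have : (0 : ℝ) ≤ 1 / w ^ 3 := by positivity
        have h2 : 1 ≤ w ^ 2 := one_le_pow₀ hw1
        have hN : (0 : ℝ) ≤ N := by positivity
        nlinarith
  push Not at hw1
  have ht1 : w ^ 2 < 1 := by nlinarith
  have hs6 : √(w ^ 6) = w ^ 3 := by
    rw [show w ^ 6 = (w ^ 3) ^ 2 by ring, Real.sqrt_sq (by positivity)]
  have hs2 : √(w ^ 2) = w := Real.sqrt_sq hw.le
  -- The shift is `t = w ^ 2`, the cube root of the size `w ^ 6` of the second differences. After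
  -- division by `t` the error `√l / √t` then balances the error `t` of the difference quotient.
  -- Shifting forward bounds the sawtooth sum from below, shifting backward from above.
  have hsd : ∀ n, secondDiff (fun n => x n - w ^ 2) n = secondDiff x n := by
    intro n; unfold secondDiff; ring
  have h1 := abs_sum_bernoulliTwo_sub_le (t := w ^ 2) hε (by positivity) hlo hhi (by positivity)
  have h2 := abs_sum_bernoulliTwo_sub_le (x := fun n => x n - w ^ 2) (N := N) (l := w ^ 6) (t := w ^ 2) hε
    (by positivity) (fun n hn => by rw [hsd]; exact hlo n hn)
    (fun n hn => by rw [hsd]; exact hhi n hn) (by positivity)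
  simp only [sub_add_cancel] at h2
  rw [hs6, hs2] at h1 h2
  have h3 := Finset.sum_le_sum fun n (_ : n ∈ Finset.range N) =>
    bernoulliTwo_add_sub_le (x n) (sq_nonneg w) ht1
  have h4 := Finset.sum_le_sum fun n (_ : n ∈ Finset.range N) =>
    le_bernoulliTwo_sub (x n) (sq_nonneg w) ht1
  rw [Finset.sum_add_distrib, ← Finset.mul_sum] at h3
  rw [Finset.sum_sub_distrib, ← Finset.mul_sum] at h4
  simp only [Finset.sum_const, Finset.card_range, nsmul_eq_mul] at h3 h4
  have h5 := (abs_le.1 h1).1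
  have h6 := (abs_le.1 h2).2
  have e1 : 160 * (N * w ^ 3 * w + w ^ 2 / w ^ 3) = w ^ 2 * (160 * (N * w ^ 2 + 1 / w ^ 3)) := by
    ring
  rw [e1] at h5 h6
  have hw2 : 0 < w ^ 2 := by positivity
  have hN : 0 ≤ N * w ^ 2 := by positivity
  set T := ∑ n ∈ Finset.range N, sawtooth (x n)
  have h7 : 0 ≤ 1 / w ^ 3 := by positivity
  rw [abs_le]
  constructor
  · have : w ^ 2 * (-(160 * (N * w ^ 2 + 1 / w ^ 3))) ≤ w ^ 2 * (2 * T + N * w ^ 2) := by linarith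
    have := le_of_mul_le_mul_left this hw2
    linarith
  · have : w ^ 2 * (2 * T - N * w ^ 2) ≤ w ^ 2 * (160 * (N * w ^ 2 + 1 / w ^ 3)) := by linarith
    have := le_of_mul_le_mul_left this hw2
    linarith

end Sawtooth

lemma abs_sum_sawtooth_le_card (s : Finset ℕ) (x : ℕ → ℝ) :
    |∑ n ∈ s, sawtooth (x n)| ≤ s.card / 2 := by
  refine (Finset.abs_sum_le_sum_abs _ _).trans
    ((Finset.sum_le_sum fun n _ => abs_sawtooth_le (x n)).trans ?_)
  rw [Finset.sum_const, nsmul_eq_mul]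
  linarith

/-- Sawtooth sums along a sequence whose second differences are nondecreasing in absolute value. -/
lemma abs_sum_sawtooth_le_of_monotone {ε : ℝ} (hε : ε = 1 ∨ ε = -1) (N : ℕ) :
    ∀ (x : ℕ → ℝ) (l : ℝ), 0 < l → (∀ n < N, l ≤ ε * secondDiff x n) →
    (∀ m n, m ≤ n → n < N → ε * secondDiff x m ≤ ε * secondDiff x n) →
    |∑ n ∈ Finset.range N, sawtooth (x n)| ≤
      81 * ∑ n ∈ Finset.range N, (ε * secondDiff x n) ^ (1 / 3 : ℝ) + 300 / √l := by
  induction N using Nat.strong_induction_on with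
  | _ N ih =>
  intro x l hl hlo hmono
  rcases Nat.eq_zero_or_pos N with rfl | hN
  · simp; positivity
  set d : ℕ → ℝ := fun n => ε * secondDiff x n with hd
  have hd0 : 0 < d 0 := hl.trans_le (hlo 0 hN)
  have hex : ∃ n, N ≤ n ∨ 2 * d 0 ≤ d n := ⟨N, Or.inl le_rfl⟩
  -- The block before the first index at which the second difference has doubled. There the
  -- fixed-size estimate applies; the remainder starts with at least twice the second difference and
  -- is treated by induction.
  set M := Nat.find hex with hM
  have hMN : M ≤ N := Nat.find_min' hex (Or.inl le_rfl)
  have hMspec := Nat.find_spec hex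
  have hlt : ∀ n < M, n < N ∧ d n < 2 * d 0 := fun n hn => by
    have := Nat.find_min hex hn
    push Not at this
    exact this
  have hM0 : 0 < M := by
    rw [Nat.pos_iff_ne_zero]
    intro h0
    rw [← hM, h0] at hMspec
    rcases hMspec with h | h
    · omega
    · linarith
  set w := (d 0) ^ (1 / 6 : ℝ) with hw
  have hw0 : 0 < w := Real.rpow_pos_of_pos hd0 _
  have hw6 : w ^ 6 = d 0 := by
    rw [hw, ← Real.rpow_natCast, ← Real.rpow_mul hd0.le]; norm_num
  have hw2 : w ^ 2 = (d 0) ^ (1 / 3 : ℝ) := by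
    rw [hw, ← Real.rpow_natCast, ← Real.rpow_mul hd0.le]; norm_num
  have hw3 : w ^ 3 = √(d 0) := by
    rw [hw, ← Real.rpow_natCast, ← Real.rpow_mul hd0.le, Real.sqrt_eq_rpow]; norm_num
  have hfirst := abs_sum_sawtooth_le (x := x) (N := M) hε hw0
    (fun n hn => by rw [hw6]; exact hmono 0 n (Nat.zero_le _) (hlt n hn).1)
    (fun n hn => by rw [hw6]; exact (hlt n hn).2.le)
  have hcube : (M : ℝ) * w ^ 2 ≤ ∑ n ∈ Finset.range M, (d n) ^ (1 / 3 : ℝ) := by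
    rw [hw2]
    have := Finset.sum_le_sum fun n (hn : n ∈ Finset.range M) =>
      Real.rpow_le_rpow hd0.le (hmono 0 n (Nat.zero_le _) (hlt n (Finset.mem_range.1 hn)).1)
        (by norm_num : (0 : ℝ) ≤ 1 / 3)
    simpa using this
  have hs0 : 0 < √(d 0) := Real.sqrt_pos.2 hd0
  have hls : 1 / √(d 0) ≤ 1 / √l :=
    one_div_le_one_div_of_le (Real.sqrt_pos.2 hl) (Real.sqrt_le_sqrt (hlo 0 hN))
  have e300 : ∀ y : ℝ, 300 / y = 300 * (1 / y) := fun y => by ring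
  have hp0 : 0 < 1 / √(d 0) := by positivity
  rw [hw3] at hfirst
  rcases hMN.eq_or_lt with hEq | hLt
  · rw [← hEq, e300]
    linarith
  have hdM : 2 * d 0 ≤ d M := hMspec.resolve_left (by omega)
  have hsd : ∀ n, secondDiff (fun n => x (M + n)) n = secondDiff x (M + n) := by
    intro n; unfold secondDiff; simp only [add_assoc]
  have hrest := ih (N - M) (by omega) (fun n => x (M + n)) (d M) (by linarith)
    (fun n hn => by rw [hsd]; exact hmono M (M + n) (by omega) (by omega))
    (fun m n hmn hn => by rw [hsd, hsd]; exact hmono (M + m) (M + n) (by omega) (by omega))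
  simp_rw [hsd] at hrest
  have hsplit : ∀ F : ℕ → ℝ, ∑ n ∈ Finset.range N, F n =
      ∑ n ∈ Finset.range M, F n + ∑ n ∈ Finset.range (N - M), F (M + n) := by
    intro F
    rw [← Finset.sum_range_add, Nat.add_sub_cancel' hMN]
  rw [hsplit, hsplit (fun n => (d n) ^ (1 / 3 : ℝ))]
  -- Doubling shrinks `1/√d` by at least `√2 > 1.4`, so the terms form a geometric series. The
  -- constant `300` closes the induction because `81 + 300 / 1.4 < 300`.
  have hs2 : 300 / √(d M) ≤ 219 * (1 / √(d 0)) := by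
    have h2 : (1.4 : ℝ) ≤ √2 := Real.le_sqrt_of_sq_le (by norm_num)
    have h3 : 1.4 * √(d 0) ≤ √(d M) := by
      calc 1.4 * √(d 0) ≤ √2 * √(d 0) := by gcongr
        _ = √(2 * d 0) := (Real.sqrt_mul (by norm_num) _).symm
        _ ≤ _ := Real.sqrt_le_sqrt hdM
    calc 300 / √(d M) ≤ 300 / (1.4 * √(d 0)) := by gcongr
      _ = (300 / 1.4) * (1 / √(d 0)) := by field_simp
      _ ≤ _ := by gcongr; norm_num
  refine (abs_add_le _ _).trans ?_
  rw [e300 (√l)]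
  linarith

/-- Reverse the sequence. Second differences are symmetric under reversal, and only four boundary
values of the sawtooth change, which costs at most `2`. -/
lemma abs_sum_sawtooth_le_of_antitone {ε : ℝ} (hε : ε = 1 ∨ ε = -1) (N : ℕ)
    (x : ℕ → ℝ) {l : ℝ} (hl : 0 < l) (hlo : ∀ n < N, l ≤ ε * secondDiff x n)
    (hanti : ∀ m n, m ≤ n → n < N → ε * secondDiff x n ≤ ε * secondDiff x m) :
    |∑ n ∈ Finset.range N, sawtooth (x n)| ≤
      81 * ∑ n ∈ Finset.range N, (ε * secondDiff x n) ^ (1 / 3 : ℝ) + 300 / √l + 2 := by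
  set y : ℕ → ℝ := fun n => x (N + 1 - n) with hy
  have hsd : ∀ n < N, secondDiff y n = secondDiff x (N - 1 - n) := by
    intro n hn
    simp only [hy, secondDiff]
    rw [show N + 1 - (n + 2) = N - 1 - n by omega, show N + 1 - (n + 1) = N - 1 - n + 1 by omega,
      show N + 1 - n = N - 1 - n + 2 by omega]
    ring
  have h := abs_sum_sawtooth_le_of_monotone hε N y l hl
    (fun n hn => by rw [hsd n hn]; exact hlo _ (by omega))
    (fun m n hmn hn => by
      rw [hsd n hn, hsd m (by omega)]; exact hanti _ _ (by omega) (by omega))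
  have e1 : ∑ n ∈ Finset.range N, (ε * secondDiff y n) ^ (1 / 3 : ℝ) =
      ∑ n ∈ Finset.range N, (ε * secondDiff x n) ^ (1 / 3 : ℝ) := by
    rw [← Finset.sum_range_reflect]
    refine Finset.sum_congr rfl fun n hn => ?_
    rw [Finset.mem_range] at hn
    rw [hsd _ (by omega), show N - 1 - (N - 1 - n) = n by omega]
  have e2 : ∑ n ∈ Finset.range N, sawtooth (y n) + (sawtooth (x 0) + sawtooth (x 1)) =
      ∑ n ∈ Finset.range N, sawtooth (x n) + (sawtooth (x N) + sawtooth (x (N + 1))) := by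
    have h1 : ∑ n ∈ Finset.range (N + 2), sawtooth (x n) =
        ∑ n ∈ Finset.range (N + 2), sawtooth (y n) := by
      rw [← Finset.sum_range_reflect]
      refine Finset.sum_congr rfl fun n hn => ?_
      simp only [hy]
      congr 2
    rw [Finset.sum_range_succ, Finset.sum_range_succ, Finset.sum_range_succ,
      Finset.sum_range_succ] at h1
    have h2 : y N = x 1 := by simp [hy]
    have h3 : y (N + 1) = x 0 := by simp [hy]
    rw [h2, h3] at h1
    linarith
  rw [e1] at h
  have b0 := abs_le.1 (abs_sawtooth_le (x 0))
  have b1 := abs_le.1 (abs_sawtooth_le (x 1))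
  have b2 := abs_le.1 (abs_sawtooth_le (x N))
  have b3 := abs_le.1 (abs_sawtooth_le (x (N + 1)))
  rw [abs_le] at h ⊢
  constructor <;> linarith [h.1, h.2, b0.1, b0.2, b1.1, b1.2, b2.1, b2.2, b3.1, b3.2]

/-- Young's inequality with a free parameter `z`. It replaces the sum of cube roots of second
differences by a telescoping sum plus `N z`, so no integral of a power of the second derivative is
needed. -/
lemma rpow_third_le {d z : ℝ} (hd : 0 ≤ d) (hz : 0 < z) :
    d ^ (1 / 3 : ℝ) ≤ d / (3 * z ^ 2) + 2 * z / 3 := by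
  set y := d ^ (1 / 3 : ℝ) with hy
  have hy0 : 0 ≤ y := Real.rpow_nonneg hd _
  have hy3 : y ^ 3 = d := by
    rw [hy, ← Real.rpow_natCast, ← Real.rpow_mul hd]; norm_num
  rw [← hy3, div_add_div _ _ (by positivity) (by positivity), le_div_iff₀ (by positivity)]
  have : 0 ≤ z * 3 * ((y - z) ^ 2 * (y + 2 * z)) := by positivity
  nlinarith

/-- Sawtooth sums along a sequence with monotone second differences of constant sign. -/
lemma abs_sum_sawtooth_le_of_monovary {ε : ℝ} (hε : ε = 1 ∨ ε = -1) (N : ℕ)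
    (x : ℕ → ℝ) {l z D : ℝ} (hl : 0 < l) (hz : 0 < z) (hlo : ∀ n < N, l ≤ ε * secondDiff x n)
    (hmono : (∀ m n, m ≤ n → n < N → ε * secondDiff x m ≤ ε * secondDiff x n) ∨
      (∀ m n, m ≤ n → n < N → ε * secondDiff x n ≤ ε * secondDiff x m))
    (hD : ∀ n ≤ N, |x (n + 1) - x n| ≤ D) :
    |∑ n ∈ Finset.range N, sawtooth (x n)| ≤
      54 * (D / z ^ 2 + N * z) + 300 / √l + 2 := by
  have h1 : |∑ n ∈ Finset.range N, sawtooth (x n)| ≤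
      81 * ∑ n ∈ Finset.range N, (ε * secondDiff x n) ^ (1 / 3 : ℝ) + 300 / √l + 2 := by
    rcases hmono with h | h
    · have := abs_sum_sawtooth_le_of_monotone hε N x l hl hlo h
      linarith
    · exact abs_sum_sawtooth_le_of_antitone hε N x hl hlo h
  have h2 := Finset.sum_le_sum fun n (hn : n ∈ Finset.range N) =>
    rpow_third_le (hl.le.trans (hlo n (Finset.mem_range.1 hn))) hz
  rw [Finset.sum_add_distrib, ← Finset.sum_div, ← Finset.mul_sum] at h2
  -- Second differences telescope to a difference of two steps, each at most `D` in size.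
  have h3 : ∑ n ∈ Finset.range N, secondDiff x n = (x (N + 1) - x N) - (x 1 - x 0) := by
    rw [← Finset.sum_range_sub (fun n => x (n + 1) - x n)]
    refine Finset.sum_congr rfl fun n _ => ?_
    unfold secondDiff
    ring
  have h4 : ε * ((x (N + 1) - x N) - (x 1 - x 0)) ≤ 2 * D := by
    have a1 := abs_le.1 (hD N le_rfl)
    have a2 := abs_le.1 (hD 0 (Nat.zero_le _))
    simp only [zero_add] at a2
    rcases hε with rfl | rfl <;> linarith [a1.1, a1.2, a2.1, a2.2]
  rw [h3] at h2
  have h5 : ε * ((x (N + 1) - x N) - (x 1 - x 0)) / (3 * z ^ 2) ≤ 2 * D / (3 * z ^ 2) := by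
    gcongr
  have h6 : 2 * D / (3 * z ^ 2) = (2 / 3) * (D / z ^ 2) := by field_simp
  simp only [Finset.sum_const, Finset.card_range, nsmul_eq_mul] at h2
  linarith

/-! ### Second differences of twice differentiable functions -/

section SecondDifference

variable {f f₁ φ : ℝ → ℝ} {p q : ℝ}

/-- Subtracting `c/2 * x ^ 2` leaves a convex function; apply midpoint convexity to it. -/
lemma mul_sq_le_second_diff (h1 : ∀ x ∈ Ioo p q, HasDerivAt f (f₁ x) x)
    (h2 : ∀ x ∈ Ioo p q, HasDerivAt f₁ (φ x) x) {c : ℝ} (hc : ∀ x ∈ Ioo p q, c ≤ φ x)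
    {t h : ℝ} (hh : 0 ≤ h) (ht : p < t) (ht' : t + 2 * h < q) :
    c * h ^ 2 ≤ f (t + 2 * h) - 2 * f (t + h) + f t := by
  have hconv : ConvexOn ℝ (Ioo p q) (fun x => f x - c / 2 * x ^ 2) := by
    apply convexOn_of_hasDerivWithinAt2_nonneg (f' := fun x => f₁ x - c * x)
      (f'' := fun x => φ x - c) (convex_Ioo p q)
    · intro x hx
      exact ((h1 x hx).continuousAt.sub (by fun_prop)).continuousWithinAt
    · intro x hx
      rw [interior_Ioo] at hx ⊢
      have := (h1 x hx).sub (((hasDerivAt_id x).pow 2).const_mul (c / 2))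
      refine (this.congr_deriv ?_).hasDerivWithinAt
      simp
      ring
    · intro x hx
      rw [interior_Ioo] at hx ⊢
      have := (h2 x hx).sub ((hasDerivAt_id x).const_mul c)
      refine (this.congr_deriv ?_).hasDerivWithinAt
      simp
    · intro x hx
      rw [interior_Ioo] at hx
      exact sub_nonneg.2 (hc x hx)
  have := hconv.2 (show t ∈ Ioo p q from ⟨ht, by linarith⟩)
    (show t + 2 * h ∈ Ioo p q from ⟨by linarith, ht'⟩) (show (0 : ℝ) ≤ 1 / 2 by norm_num)
    (show (0 : ℝ) ≤ 1 / 2 by norm_num) (by norm_num)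
  simp only [smul_eq_mul] at this
  rw [show (1 / 2 : ℝ) * t + 1 / 2 * (t + 2 * h) = t + h by ring] at this
  linarith

/-- A monotone second derivative makes `f₁` convex. The derivative in `t` of the second difference
is a second difference of `f₁`, hence nonnegative. -/
lemma second_diff_le_of_monotoneOn (h1 : ∀ x ∈ Ioo p q, HasDerivAt f (f₁ x) x)
    (h2 : ∀ x ∈ Ioo p q, HasDerivAt f₁ (φ x) x) (hm : MonotoneOn φ (Ioo p q))
    {t t' h : ℝ} (hh : 0 ≤ h) (ht : p < t) (htt : t ≤ t') (ht' : t' + 2 * h < q) :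
    f (t + 2 * h) - 2 * f (t + h) + f t ≤ f (t' + 2 * h) - 2 * f (t' + h) + f t' := by
  have hconv : ConvexOn ℝ (Ioo p q) f₁ := by
    refine MonotoneOn.convexOn_of_deriv (convex_Ioo p q)
      (fun x hx => (h2 x hx).continuousAt.continuousWithinAt) ?_ ?_
    · rw [interior_Ioo]
      exact fun x hx => (h2 x hx).differentiableAt.differentiableWithinAt
    · rw [interior_Ioo]
      exact hm.congr fun x hx => ((h2 x hx).deriv).symm
  have hder : ∀ x ∈ Ioo p (q - 2 * h), HasDerivAt (fun x => f (x + 2 * h) - 2 * f (x + h) + f x)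
      (f₁ (x + 2 * h) - 2 * f₁ (x + h) + f₁ x) x := by
    intro x hx
    have e1 := (h1 (x + 2 * h) ⟨by linarith [hx.1], by linarith [hx.2]⟩).comp_add_const x (2 * h)
    have e2 := (h1 (x + h) ⟨by linarith [hx.1], by linarith [hx.2]⟩).comp_add_const x h
    have e3 := h1 x ⟨hx.1, by linarith [hx.2]⟩
    exact (e1.sub (e2.const_mul 2)).add e3
  have hmono : MonotoneOn (fun x => f (x + 2 * h) - 2 * f (x + h) + f x) (Ioo p (q - 2 * h)) := by
    refine monotoneOn_of_deriv_nonneg (convex_Ioo _ _)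
      (fun x hx => (hder x hx).continuousAt.continuousWithinAt) ?_ ?_
    · rw [interior_Ioo]
      exact fun x hx => (hder x hx).differentiableAt.differentiableWithinAt
    · rw [interior_Ioo]
      intro x hx
      rw [(hder x hx).deriv]
      have := hconv.2 (show x ∈ Ioo p q from ⟨hx.1, by linarith [hx.2]⟩)
        (show x + 2 * h ∈ Ioo p q from ⟨by linarith [hx.1], by linarith [hx.2]⟩)
        (show (0 : ℝ) ≤ 1 / 2 by norm_num) (show (0 : ℝ) ≤ 1 / 2 by norm_num) (by norm_num)
      simp only [smul_eq_mul] at this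
      rw [show (1 / 2 : ℝ) * x + 1 / 2 * (x + 2 * h) = x + h by ring] at this
      linarith
  exact hmono ⟨ht, by linarith⟩ ⟨by linarith, by linarith⟩ htt

lemma second_diff_le_of_antitoneOn (h1 : ∀ x ∈ Ioo p q, HasDerivAt f (f₁ x) x)
    (h2 : ∀ x ∈ Ioo p q, HasDerivAt f₁ (φ x) x) (hm : AntitoneOn φ (Ioo p q))
    {t t' h : ℝ} (hh : 0 ≤ h) (ht : p < t) (htt : t ≤ t') (ht' : t' + 2 * h < q) :
    f (t' + 2 * h) - 2 * f (t' + h) + f t' ≤ f (t + 2 * h) - 2 * f (t + h) + f t := by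
  have := second_diff_le_of_monotoneOn (f := fun x => -f x) (f₁ := fun x => -f₁ x)
    (φ := fun x => -φ x) (fun x hx => (h1 x hx).neg) (fun x hx => (h2 x hx).neg) hm.neg hh ht htt ht'
  linarith

end SecondDifference

/-! ### Sawtooth sums over columns -/

lemma sum_Ioc_add_sum_Ioc {M : Type*} [AddCommMonoid M] (F : ℤ → M) {a b c : ℤ} (hab : a ≤ b)
    (hbc : b ≤ c) :
    ∑ j ∈ Finset.Ioc a b, F j + ∑ j ∈ Finset.Ioc b c, F j = ∑ j ∈ Finset.Ioc a c, F j := by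
  rw [← Finset.Ioc_union_Ioc_eq_Ioc hab hbc, Finset.sum_union]
  rw [Finset.disjoint_left]
  intro x hx hx'
  rw [Finset.mem_Ioc] at hx hx'
  omega

lemma sum_Ioc_eq_sum_range {M : Type*} [AddCommMonoid M] (F : ℤ → M) (a b : ℤ) :
    ∑ j ∈ Finset.Ioc a b, F j = ∑ n ∈ Finset.range (b - a).toNat, F (a + 1 + n) := by
  symm
  refine Finset.sum_bij (fun (n : ℕ) _ => a + 1 + n) ?_ ?_ ?_ (fun _ _ => rfl)
  · intro n hn
    rw [Finset.mem_range] at hn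
    rw [Finset.mem_Ioc]
    omega
  · intro m _ n _ h
    omega
  · intro j hj
    rw [Finset.mem_Ioc] at hj
    exact ⟨(j - a - 1).toNat, by rw [Finset.mem_range]; omega, by omega⟩

/-- The sum of the sawtooth function over the columns with abscissa in `(u, v]`. -/
noncomputable def sawtoothSum (f : ℝ → ℝ) (σ τ r s u v : ℝ) : ℝ :=
  ∑ j ∈ Finset.Ioc ⌊u * r / s - σ⌋ ⌊v * r / s - σ⌋, sawtooth (r * s * f (((j : ℝ) + σ) * s / r) - τ)

section SawtoothSum

variable {f f₁ φ : ℝ → ℝ} {σ τ r s : ℝ}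

lemma floor_scaled_mono (hr : 0 < r) (hs : 0 < s) {u v : ℝ} (huv : u ≤ v) :
    ⌊u * r / s - σ⌋ ≤ ⌊v * r / s - σ⌋ := by
  apply Int.floor_le_floor
  gcongr

lemma mem_Ioc_floor_scaled (hr : 0 < r) (hs : 0 < s) {u v : ℝ} {j : ℤ} :
    j ∈ Finset.Ioc ⌊u * r / s - σ⌋ ⌊v * r / s - σ⌋ ↔
      u < ((j : ℝ) + σ) * s / r ∧ ((j : ℝ) + σ) * s / r ≤ v := by
  rw [Finset.mem_Ioc, Int.floor_lt, Int.le_floor, sub_lt_iff_lt_add, le_sub_iff_add_le,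
    lt_div_iff₀ hr, div_le_iff₀ hr, div_lt_iff₀ hs, le_div_iff₀ hs]

lemma sawtoothSum_add (hr : 0 < r) (hs : 0 < s) {u v w : ℝ} (huv : u ≤ v) (hvw : v ≤ w) :
    sawtoothSum f σ τ r s u v + sawtoothSum f σ τ r s v w = sawtoothSum f σ τ r s u w :=
  sum_Ioc_add_sum_Ioc _ (floor_scaled_mono hr hs huv) (floor_scaled_mono hr hs hvw)

lemma card_Ioc_floor_scaled_le (hr : 0 < r) (hs : 0 < s) {u v : ℝ} (huv : u ≤ v) :
    ((⌊v * r / s - σ⌋ - ⌊u * r / s - σ⌋).toNat : ℝ) ≤ (v - u) * r / s + 1 := by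
  have h := floor_scaled_mono (σ := σ) hr hs huv
  have h2 : (((⌊v * r / s - σ⌋ - ⌊u * r / s - σ⌋).toNat : ℤ) : ℝ)
      = ⌊v * r / s - σ⌋ - ⌊u * r / s - σ⌋ := by
    rw [Int.toNat_of_nonneg (by omega)]; push_cast; ring
  rw [← Int.cast_natCast, h2]
  have h3 := Int.floor_le (v * r / s - σ)
  have h4 := Int.lt_floor_add_one (u * r / s - σ)
  have h5 : (v - u) * r / s = v * r / s - u * r / s := by ring
  linarith

lemma abs_sawtoothSum_le_length (hr : 0 < r) (hs : 0 < s) {u v : ℝ} (huv : u ≤ v) :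
    |sawtoothSum f σ τ r s u v| ≤ (v - u) * r / s + 1 := by
  unfold sawtoothSum
  rw [sum_Ioc_eq_sum_range]
  refine (abs_sum_sawtooth_le_card _ _).trans ?_
  rw [Finset.card_range]
  have := card_Ioc_floor_scaled_le (σ := σ) hr hs huv
  have h0 : (0 : ℝ) ≤ ((⌊v * r / s - σ⌋ - ⌊u * r / s - σ⌋).toNat : ℝ) := by positivity
  linarith

/-- The sawtooth sum over an interval on which the second derivative is monotone. -/
lemma abs_sawtoothSum_le_of_monotonic (hr : 0 < r) (hs : 0 < s) {ε p q c D z : ℝ}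
    (hε : ε = 1 ∨ ε = -1) (hpq : p ≤ q) (h1 : ∀ x ∈ Ioo p q, HasDerivAt f (f₁ x) x)
    (h2 : ∀ x ∈ Ioo p q, HasDerivAt f₁ (φ x) x)
    (hm : MonotoneOn φ (Ioo p q) ∨ AntitoneOn φ (Ioo p q)) (hc0 : 0 < c)
    (hc : ∀ x ∈ Ioo p q, c ≤ ε * φ x) (hz : 0 < z) (hD0 : 0 ≤ D)
    (hD : ∀ x ∈ Ioo p q, ∀ y ∈ Ioo p q, |f x - f y| ≤ D * |x - y|) :
    |sawtoothSum f σ τ r s p q| ≤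
      54 * (s ^ 2 * D / z ^ 2 + ((q - p) * r / s + 1) * z) + 300 / √(s ^ 3 * c / r) + 5 := by
  set A := ⌊p * r / s - σ⌋ with hA
  set B := ⌊q * r / s - σ⌋ with hB
  have hAB : A ≤ B := floor_scaled_mono hr hs hpq
  set n := (B - A).toNat with hn
  have hcard : (n : ℝ) ≤ (q - p) * r / s + 1 := card_Ioc_floor_scaled_le hr hs hpq
  set x : ℕ → ℝ := fun m => r * s * f ((((A + 1 + m : ℤ) : ℝ) + σ) * s / r) - τ with hx
  have hsum : sawtoothSum f σ τ r s p q = ∑ m ∈ Finset.range n, sawtooth (x m) := by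
    unfold sawtoothSum
    rw [sum_Ioc_eq_sum_range]
  -- The last three columns are discarded so that every abscissa entering a second difference or a
  -- step lies in the open interval. Only the last abscissa can equal `q`, and `x` is sampled two
  -- places beyond the summation index.
  set N := n - 3 with hN
  have hNn : N ≤ n := Nat.sub_le _ _
  have hNcard : (N : ℝ) ≤ (q - p) * r / s + 1 := le_trans (by exact_mod_cast hNn) hcard
  set h := s / r with hh
  have hh0 : 0 < h := by positivity
  set t : ℕ → ℝ := fun m => (((A + 1 + m : ℤ) : ℝ) + σ) * s / r with ht
  have htadd : ∀ m i : ℕ, t (m + i) = t m + i * h := by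
    intro m i
    simp only [ht, hh]
    push_cast
    ring
  have hmem : ∀ m, m + 2 ≤ n → t m ∈ Ioo p q := by
    intro m hm'
    have e1 : A + 1 + (m + 1 : ℕ) ∈ Finset.Ioc A B := by rw [Finset.mem_Ioc]; omega
    have e2 : A + 1 + (m : ℕ) ∈ Finset.Ioc A B := by rw [Finset.mem_Ioc]; omega
    rw [hA, hB, mem_Ioc_floor_scaled hr hs] at e1 e2
    refine ⟨e2.1, ?_⟩
    have e3 : t (m + 1) ≤ q := e1.2
    rw [htadd m 1] at e3
    push_cast at e3
    linarith
  have hxt : ∀ m, x m = r * s * f (t m) - τ := fun m => rfl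
  have hsd : ∀ m, secondDiff x m = r * s * (f (t m + 2 * h) - 2 * f (t m + h) + f (t m)) := by
    intro m
    unfold secondDiff
    rw [hxt, hxt, hxt, htadd m 2, htadd m 1]
    push_cast
    rw [one_mul]
    ring
  have hrs : 0 < r * s := by positivity
  have hlo : ∀ m < N, s ^ 3 * c / r ≤ ε * secondDiff x m := by
    intro m hmN
    have i1 := hmem m (by omega)
    have i2 := hmem (m + 2) (by omega)
    rw [htadd m 2] at i2
    push_cast at i2
    have := mul_sq_le_second_diff (f := fun x => ε * f x) (f₁ := fun x => ε * f₁ x)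
      (φ := fun x => ε * φ x) (fun x hx => (h1 x hx).const_mul ε)
      (fun x hx => (h2 x hx).const_mul ε) hc hh0.le i1.1 i2.2
    rw [hsd]
    -- The mesh is `s / r` and the vertical scale is `r s`, so second differences have size `s ^ 3 /
    -- r` times the second derivative.
    have e1 : s ^ 3 * c / r = r * s * (c * h ^ 2) := by rw [hh]; field_simp
    rw [e1]
    calc r * s * (c * h ^ 2) ≤ r * s * (ε * f (t m + 2 * h) - 2 * (ε * f (t m + h)) + ε * f (t m)) := by
          gcongr
      _ = _ := by ring
  have htmono : ∀ m i, m ≤ i → t m ≤ t i := by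
    intro m i hmi
    obtain ⟨k, rfl⟩ := Nat.exists_eq_add_of_le hmi
    rw [htadd]
    have : 0 ≤ (k : ℝ) * h := by positivity
    linarith
  have hmono : (∀ m i, m ≤ i → i < N → ε * secondDiff x m ≤ ε * secondDiff x i) ∨
      (∀ m i, m ≤ i → i < N → ε * secondDiff x i ≤ ε * secondDiff x m) := by
    have base : (∀ m i, m ≤ i → i < N → secondDiff x m ≤ secondDiff x i) ∨
        (∀ m i, m ≤ i → i < N → secondDiff x i ≤ secondDiff x m) := by
      rcases hm with hm | hm
      · left
        intro m i hmi hi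
        have i2 := hmem (i + 2) (by omega)
        rw [htadd i 2] at i2
        push_cast at i2
        rw [hsd, hsd]
        exact mul_le_mul_of_nonneg_left (second_diff_le_of_monotoneOn h1 h2 hm hh0.le
          (hmem m (by omega)).1 (htmono m i hmi) i2.2) hrs.le
      · right
        intro m i hmi hi
        have i2 := hmem (i + 2) (by omega)
        rw [htadd i 2] at i2
        push_cast at i2
        rw [hsd, hsd]
        exact mul_le_mul_of_nonneg_left (second_diff_le_of_antitoneOn h1 h2 hm hh0.le
          (hmem m (by omega)).1 (htmono m i hmi) i2.2) hrs.le
    rcases hε with rfl | rfl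
    · simpa using base
    · rcases base with b | b
      · right; intro m i hmi hi; linarith [b m i hmi hi]
      · left; intro m i hmi hi; linarith [b m i hmi hi]
  rw [hsum]
  have h3 : |∑ m ∈ Finset.range n, sawtooth (x m) - ∑ m ∈ Finset.range N, sawtooth (x m)| ≤ 3 := by
    rw [← Finset.sum_sdiff (Finset.range_mono hNn), add_sub_cancel_right]
    refine (abs_sum_sawtooth_le_card _ _).trans ?_
    rw [Finset.card_sdiff_of_subset (Finset.range_mono hNn), Finset.card_range, Finset.card_range]
    have : ((n - N : ℕ) : ℝ) ≤ 3 := by exact_mod_cast (by omega : n - N ≤ 3)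
    linarith
  have hmain : |∑ m ∈ Finset.range N, sawtooth (x m)| ≤
      54 * (s ^ 2 * D / z ^ 2 + N * z) + 300 / √(s ^ 3 * c / r) + 2 := by
    rcases Nat.eq_zero_or_pos N with h0 | hNpos
    · rw [h0]
      simp
      positivity
    refine abs_sum_sawtooth_le_of_monovary hε N x (by positivity) hz hlo hmono ?_
    intro m hmN
    have i1 := hmem m (by omega)
    have i2 := hmem (m + 1) (by omega)
    rw [hxt, hxt, htadd m 1] at *
    push_cast at i2 ⊢
    rw [show r * s * f (t m + 1 * h) - τ - (r * s * f (t m) - τ)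
      = r * s * (f (t m + 1 * h) - f (t m)) by ring, abs_mul, abs_of_pos hrs]
    calc r * s * |f (t m + 1 * h) - f (t m)| ≤ r * s * (D * |t m + 1 * h - t m|) := by
          gcongr; exact hD _ i2 _ i1
      _ = s ^ 2 * D := by
          rw [show t m + 1 * h - t m = h by ring, abs_of_pos hh0, hh]
          field_simp
  have h4 : 54 * (s ^ 2 * D / z ^ 2 + N * z) ≤ 54 * (s ^ 2 * D / z ^ 2 + ((q - p) * r / s + 1) * z) := by
    gcongr
  have h5 := abs_le.1 h3
  have h6 := abs_le.1 hmain
  rw [abs_le]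
  constructor <;> linarith [h5.1, h5.2, h6.1, h6.2]

/-- The partition of `[a, b]` is clamped to `[u, v]`, giving at most `l` monotone pieces, some
possibly degenerate. The lower bound `c` is required only on `(u, v)`, which is what allows a
degenerate endpoint to be cut off. -/
lemma abs_sawtoothSum_le_of_piecewise (hr : 0 < r) (hs : 0 < s) {ε a b u v c D z : ℝ}
    (hε : ε = 1 ∨ ε = -1) (h1 : ∀ x ∈ Ioo a b, HasDerivAt f (f₁ x) x)
    (h2 : ∀ x ∈ Ioo a b, HasDerivAt f₁ (φ x) x) {l : ℕ} {P : Fin (l + 1) → ℝ}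
    (hP : StrictMono P) (hPa : P 0 = a) (hPb : P (Fin.last l) = b)
    (hm : ∀ i : Fin l, MonotoneOn φ (Ioo (P i.castSucc) (P i.succ)) ∨
      AntitoneOn φ (Ioo (P i.castSucc) (P i.succ)))
    (hau : a ≤ u) (huv : u ≤ v) (hvb : v ≤ b) (hc0 : 0 < c)
    (hc : ∀ x ∈ Ioo u v, c ≤ ε * φ x) (hz : 0 < z) (hD0 : 0 ≤ D)
    (hD : ∀ x ∈ Icc a b, ∀ y ∈ Icc a b, |f x - f y| ≤ D * |x - y|) :
    |sawtoothSum f σ τ r s u v| ≤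
      l * (54 * (s ^ 2 * D / z ^ 2 + ((b - a) * r / s + 1) * z) + 300 / √(s ^ 3 * c / r) + 5) := by
  set B := 54 * (s ^ 2 * D / z ^ 2 + ((b - a) * r / s + 1) * z) + 300 / √(s ^ 3 * c / r) + 5 with hB
  have hba : 0 ≤ b - a := by linarith
  set Q : Fin (l + 1) → ℝ := fun i => max u (min v (P i)) with hQ
  have hQu : ∀ i, u ≤ Q i := fun i => le_max_left _ _
  have hQv : ∀ i, Q i ≤ v := fun i => max_le huv (min_le_left _ _)
  have hQmono : ∀ i j, i ≤ j → Q i ≤ Q j := fun i j hij =>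
    max_le_max le_rfl (min_le_min le_rfl (hP.monotone hij))
  have key : ∀ k (hk : k < l + 1), |sawtoothSum f σ τ r s u (Q ⟨k, hk⟩)| ≤ k * B := by
    intro k
    induction k with
    | zero =>
      intro hk
      have : Q ⟨0, hk⟩ = u := by
        simp only [hQ]
        have : P ⟨0, hk⟩ = a := hPa
        rw [this]
        exact max_eq_left ((min_le_right _ _).trans hau)
      rw [this]
      simp [sawtoothSum]
    | succ k ih =>
      intro hk
      have ih' := ih (by omega)
      set i : Fin l := ⟨k, by omega⟩ with hi
      have ei : (⟨k, by omega⟩ : Fin (l + 1)) = i.castSucc := rfl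
      have ei' : (⟨k + 1, hk⟩ : Fin (l + 1)) = i.succ := rfl
      rw [ei] at ih'
      rw [ei']
      have hle : Q i.castSucc ≤ Q i.succ := hQmono _ _ (Fin.castSucc_lt_succ).le
      rw [← sawtoothSum_add hr hs (hQu i.castSucc) hle]
      refine (abs_add_le _ _).trans ?_
      have hsub : Ioo (Q i.castSucc) (Q i.succ) ⊆ Ioo (P i.castSucc) (P i.succ) := by
        intro y hy
        have y1 := hQu i.castSucc
        have y2 := hQv i.succ
        constructor
        · by_contra hcon
          push Not at hcon
          have : y ≤ min v (P i.castSucc) := le_min (by linarith [hy.2]) hcon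
          have : min v (P i.castSucc) ≤ Q i.castSucc := le_max_right _ _
          linarith [hy.1]
        · by_contra hcon
          push Not at hcon
          have : Q i.succ ≤ y := max_le (by linarith [hy.1]) ((min_le_right _ _).trans hcon)
          linarith [hy.2]
      have hsubuv : Ioo (Q i.castSucc) (Q i.succ) ⊆ Ioo u v :=
        Ioo_subset_Ioo (hQu _) (hQv _)
      have hsubab : Ioo (Q i.castSucc) (Q i.succ) ⊆ Ioo a b :=
        hsubuv.trans (Ioo_subset_Ioo hau hvb)
      have hstep := abs_sawtoothSum_le_of_monotonic (f := f) (f₁ := f₁) (φ := φ) (σ := σ) (τ := τ)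
        (D := D) hr hs hε hle
        (fun x hx => h1 x (hsubab hx)) (fun x hx => h2 x (hsubab hx))
        ((hm i).imp (fun h => h.mono hsub) (fun h => h.mono hsub)) hc0
        (fun x hx => hc x (hsubuv hx)) hz hD0
        (fun x hx y hy => hD x (Ioo_subset_Icc_self (hsubab hx)) y (Ioo_subset_Icc_self (hsubab hy)))
      have hlen : Q i.succ - Q i.castSucc ≤ b - a := by
        linarith [hQu i.castSucc, hQv i.succ]
      have hstep' : 54 * (s ^ 2 * D / z ^ 2 + ((Q i.succ - Q i.castSucc) * r / s + 1) * z)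
          + 300 / √(s ^ 3 * c / r) + 5 ≤ B := by
        rw [hB]; gcongr
      push_cast
      linarith
  have hlast : Q ⟨l, by omega⟩ = v := by
    have : P ⟨l, by omega⟩ = b := hPb
    simp only [hQ, this, min_eq_left hvb, max_eq_right huv]
  have := key l (by omega)
  rwa [hlast] at this

end SawtoothSum

/-! ### Sawtooth bounds along a branch of the curve -/

/-- On all subintervals of `[a, b]` the sawtooth sums of `f` are `O(r ^ (1 - 2 E))`, locally uniformly in
the stretch factor. -/
def BranchBound (f : ℝ → ℝ) (σ τ E a b : ℝ) : Prop :=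
  ∀ K : ℝ, 1 ≤ K → ∃ C : ℝ, ∀ᶠ r : ℝ in atTop, ∀ s, K⁻¹ ≤ s → s ≤ K →
    ∀ u v, a ≤ u → u ≤ v → v ≤ b → |sawtoothSum f σ τ r s u v| ≤ C * r ^ (1 - 2 * E)

/-- Columns outside `[a', b']` are estimated by their number, the rest by `B`. -/
lemma abs_sawtoothSum_le_clamp {f : ℝ → ℝ} {σ τ r s : ℝ} (hr : 0 < r) (hs : 0 < s)
    {a b a' b' u v B : ℝ} (hau : a ≤ u) (huv : u ≤ v) (hvb : v ≤ b) (haa : a ≤ a') (hbb : b' ≤ b)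
    (hab : a' ≤ b') (hB : ∀ u' v', a' ≤ u' → u' ≤ v' → v' ≤ b' → |sawtoothSum f σ τ r s u' v'| ≤ B)
    :
    |sawtoothSum f σ τ r s u v| ≤ ((a' - a) + (b - b')) * r / s + 2 + B := by
  have hB0 : 0 ≤ B := (abs_nonneg _).trans (hB a' b' le_rfl hab le_rfl)
  set m := max u (min a' v) with hm
  set m' := min v (max b' u) with hm'
  have h1 : u ≤ m := le_max_left _ _
  have h2 : m ≤ v := max_le huv (min_le_right _ _)
  have h1' : u ≤ m' := le_min huv (le_max_right _ _)
  have h2' : m' ≤ v := min_le_left _ _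
  have hlen : m - u ≤ a' - a := by
    rcases max_choice u (min a' v) with h | h
    · rw [hm, h]; linarith
    · rw [hm, h]; have := min_le_left a' v; linarith
  have hlen' : v - m' ≤ b - b' := by
    rcases min_choice v (max b' u) with h | h
    · rw [hm', h]; linarith
    · rw [hm', h]; have := le_max_left b' u; linarith
  have hscale : ∀ x y : ℝ, x ≤ y → x * r / s ≤ y * r / s := fun x y h => by gcongr
  have hsplit : ((a' - a) + (b - b')) * r / s = (a' - a) * r / s + (b - b') * r / s := by ring
  have hn1 : 0 ≤ (a' - a) * r / s := by have : 0 ≤ a' - a := by linarith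
                                        positivity
  have hn2 : 0 ≤ (b - b') * r / s := by have : 0 ≤ b - b' := by linarith
                                        positivity
  rcases le_total m m' with hmm | hmm
  · rw [← sawtoothSum_add hr hs h1 h2, ← sawtoothSum_add hr hs hmm h2']
    have e1 := abs_sawtoothSum_le_length (f := f) (σ := σ) (τ := τ) hr hs h1
    have e2 := abs_sawtoothSum_le_length (f := f) (σ := σ) (τ := τ) hr hs h2'
    have e3 : |sawtoothSum f σ τ r s m m'| ≤ B := by
      by_cases hva : v ≤ a'
      · have : m = v := by rw [hm, min_eq_right hva, max_eq_right huv]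
        have h3 : m = m' := le_antisymm hmm (this ▸ h2')
        rw [← h3]
        simpa [sawtoothSum] using hB0
      · by_cases hub : b' ≤ u
        · have : m' = u := by rw [hm', max_eq_right hub, min_eq_right huv]
          have h3 : m = m' := le_antisymm hmm (this ▸ h1)
          rw [← h3]
          simpa [sawtoothSum] using hB0
        · push Not at hva hub
          apply hB _ _ _ hmm
          · rw [hm', max_eq_left hub.le]; exact min_le_right _ _
          · rw [hm, min_eq_left hva.le]; exact le_max_right _ _
    have e4 := hscale _ _ hlen
    have e5 := hscale _ _ hlen'
    have e6 := abs_add_le (sawtoothSum f σ τ r s m m') (sawtoothSum f σ τ r s m' v)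
    refine (abs_add_le _ _).trans ?_
    linarith
  · have e1 := abs_sawtoothSum_le_length (f := f) (σ := σ) (τ := τ) hr hs huv
    have e4 := hscale _ _ (show v - u ≤ (a' - a) + (b - b') by linarith)
    linarith

/-- Three errors arise. Discarding a length `O(r ^ (-2E))` costs `O(r ^ (1-2E) + 1)` columns. The
term `√(r / c)` with `1/c = O(r ^ (1-4E))` is again `O(r ^ (1-2E))`. The generic term is `r ^
(2/3)`, which is where `E ≤ 1/6` comes from. -/
lemma branchBound_of_pieces {f f₁ φ : ℝ → ℝ} {σ τ E a b ε D : ℝ} (hε : ε = 1 ∨ ε = -1)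
    (h1 : ∀ x ∈ Ioo a b, HasDerivAt f (f₁ x) x) (h2 : ∀ x ∈ Ioo a b, HasDerivAt f₁ (φ x) x)
    (hm : PiecewiseMonotonic φ a b) (hD0 : 0 ≤ D)
    (hD : ∀ x ∈ Icc a b, ∀ y ∈ Icc a b, |f x - f y| ≤ D * |x - y|) (hE : E ≤ 1 / 6)
    (hgrowth : ∃ C : ℝ, ∀ᶠ r : ℝ in atTop, ∃ a' b' c : ℝ, a ≤ a' ∧ a' ≤ b' ∧ b' ≤ b ∧
      (a' - a) + (b - b') ≤ C * r ^ (-2 * E) ∧ 0 < c ∧ c⁻¹ ≤ C * r ^ (1 - 4 * E) ∧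
      ∀ x ∈ Ioo a' b', c ≤ ε * φ x) :
    BranchBound f σ τ E a b := by
  intro K hK
  obtain ⟨l, P, hP, hPa, hPb, hPm⟩ := hm
  obtain ⟨C, hC⟩ := hgrowth
  have hK0 : 0 < K := by linarith
  set C₂ := |C| with hC2
  set W := l * (54 * (K ^ 2 * D + ((b - a) * K + 1)) + 300 * √(K ^ 3 * C₂) + 5) with hW
  refine ⟨C₂ * K + 2 + W, ?_⟩
  filter_upwards [hC, eventually_ge_atTop 1] with r hr hr1 s hsK hsK' u v hau huv hvb
  obtain ⟨a', b', c, haa, hab, hbb, hlen, hc0, hcinv, hc⟩ := hr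
  have hr0 : 0 < r := by linarith
  have hs : 0 < s := lt_of_lt_of_le (by positivity) hsK
  have hsinv : s⁻¹ ≤ K := inv_le_of_inv_le₀ hK0 hsK
  have hCC : C ≤ C₂ := le_abs_self C
  have hba : 0 ≤ b - a := by linarith
  -- This balances `D / z ^ 2` against `r z`, the terms coming from Young's inequality.
  set z := r ^ (-1 / 3 : ℝ) with hz
  have hz0 : 0 < z := Real.rpow_pos_of_pos hr0 _
  have hz2 : 1 / z ^ 2 = r ^ (2 / 3 : ℝ) := by
    rw [hz, ← Real.rpow_natCast, ← Real.rpow_mul hr0.le, one_div, ← Real.rpow_neg hr0.le]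
    norm_num
  have hrz : r * z = r ^ (2 / 3 : ℝ) := by
    rw [hz]; nth_rewrite 1 [← Real.rpow_one r]; rw [← Real.rpow_add hr0]; norm_num
  set R := r ^ (1 - 2 * E) with hR
  have hR0 : 0 < R := Real.rpow_pos_of_pos hr0 _
  have h23 : r ^ (2 / 3 : ℝ) ≤ R := Real.rpow_le_rpow_of_exponent_le hr1 (by linarith)
  have hR1 : 1 ≤ R := Real.one_le_rpow hr1 (by linarith)
  have hz1 : z ≤ R := by
    have : z ≤ 1 := Real.rpow_le_one_of_one_le_of_nonpos hr1 (by norm_num)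
    linarith
  have hrR : r * r ^ (-2 * E) = R := by
    rw [hR]; nth_rewrite 1 [← Real.rpow_one r]; rw [← Real.rpow_add hr0]; congr 1; ring
  have hsqrt : √(r * r ^ (1 - 4 * E)) = R := by
    have : r * r ^ (1 - 4 * E) = R ^ 2 := by
      rw [hR, sq, ← Real.rpow_add hr0]; nth_rewrite 1 [← Real.rpow_one r]
      rw [← Real.rpow_add hr0]; congr 1; ring
    rw [this, Real.sqrt_sq hR0.le]
  have hpiece : ∀ u' v', a' ≤ u' → u' ≤ v' → v' ≤ b' → |sawtoothSum f σ τ r s u' v'| ≤ W * R := by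
    intro u' v' hu' huv' hv'
    refine (abs_sawtoothSum_le_of_piecewise hr0 hs hε h1 h2 hP hPa hPb hPm (haa.trans hu') huv'
      (hv'.trans hbb) hc0 (fun x hx => hc x (Ioo_subset_Ioo hu' hv' hx)) hz0 hD0 hD).trans ?_
    have t1 : s ^ 2 * D / z ^ 2 ≤ K ^ 2 * D * R := by
      rw [div_eq_mul_one_div, hz2]; gcongr
    have t2 : ((b - a) * r / s + 1) * z ≤ ((b - a) * K + 1) * R := by
      have : ((b - a) * r / s + 1) * z = (b - a) * s⁻¹ * (r * z) + z := by ring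
      rw [this, hrz, add_mul, one_mul]
      gcongr
    have t3 : 300 / √(s ^ 3 * c / r) ≤ 300 * √(K ^ 3 * C₂) * R := by
      rw [div_eq_mul_inv, ← Real.sqrt_inv, mul_assoc]
      gcongr
      rw [← hsqrt, ← Real.sqrt_mul (by positivity)]
      apply Real.sqrt_le_sqrt
      have e1 : (s ^ 3 * c / r)⁻¹ = s⁻¹ ^ 3 * c⁻¹ * r := by field_simp
      rw [e1]
      calc s⁻¹ ^ 3 * c⁻¹ * r ≤ K ^ 3 * (C₂ * r ^ (1 - 4 * E)) * r := by
            have : c⁻¹ ≤ C₂ * r ^ (1 - 4 * E) := hcinv.trans (by gcongr)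
            gcongr
        _ = _ := by ring
    rw [hW, mul_assoc]
    gcongr
    linarith
  refine (abs_sawtoothSum_le_clamp hr0 hs hau huv hvb haa hbb hab hpiece).trans ?_
  have h5 : ((a' - a) + (b - b')) * r / s ≤ C₂ * K * R := by
    calc ((a' - a) + (b - b')) * r / s = ((a' - a) + (b - b')) * (r * s⁻¹) := by ring
      _ ≤ (C₂ * r ^ (-2 * E)) * (r * s⁻¹) := by
          have : (a' - a) + (b - b') ≤ C₂ * r ^ (-2 * E) := hlen.trans (by gcongr)
          gcongr
      _ = C₂ * s⁻¹ * (r * r ^ (-2 * E)) := by ring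
      _ ≤ _ := by rw [hrR]; gcongr
  linarith

lemma hasDerivAt_derivWithin_of_contDiffOn {h : ℝ → ℝ} {S : Set ℝ} (hS : UniqueDiffOn ℝ S)
    (hh : ContDiffOn ℝ 2 h S) {x : ℝ} (hx : S ∈ 𝓝 x) :
    HasDerivAt h (derivWithin h S x) x ∧
      HasDerivAt (derivWithin h S) (iteratedDerivWithin 2 h S x) x := by
  have hxS : x ∈ S := mem_of_mem_nhds hx
  constructor
  · exact ((hh.differentiableOn (by norm_num)) x hxS).hasDerivWithinAt.hasDerivAt hx
  · have h1 : ContDiffOn ℝ 1 (derivWithin h S) S := hh.derivWithin hS (by norm_num)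
    have h2 := ((h1.differentiableOn (by norm_num)) x hxS).hasDerivWithinAt.hasDerivAt hx
    rw [iteratedDerivWithin_succ]
    have : iteratedDerivWithin 1 h S = derivWithin h S := by
      funext y; simp [iteratedDerivWithin_one]
    rwa [this]

/-- A continuous positive function that is monotone near the left endpoint `0` is bounded below, away
from `0`, in terms of its value near `0`. -/
lemma exists_min_le_of_monotonic {ψ : ℝ → ℝ} {α η : ℝ} (hη : 0 < η) (hηα : η ≤ α)
    (hcont : ContinuousOn ψ (Ioc 0 α)) (hpos : ∀ x ∈ Ioc 0 α, 0 < ψ x)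
    (hm : MonotoneOn ψ (Ioo 0 η) ∨ AntitoneOn ψ (Ioo 0 η)) :
    ∃ c₀ : ℝ, 0 < c₀ ∧ ∀ δ, 0 < δ → δ < η / 2 → ∀ x, δ ≤ x → x ≤ α → min c₀ (ψ δ) ≤ ψ x := by
  have hsub : Icc (η / 2) α ⊆ Ioc 0 α := fun x hx => ⟨by linarith [hx.1], hx.2⟩
  obtain ⟨x₀, hx₀, hmin⟩ := isCompact_Icc.exists_isMinOn (nonempty_Icc.2 (by linarith))
    (hcont.mono hsub)
  refine ⟨ψ x₀, hpos _ (hsub hx₀), fun δ hδ hδη x hδx hxα => ?_⟩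
  rcases le_total (η / 2) x with hx | hx
  · exact (min_le_left _ _).trans (hmin ⟨hx, hxα⟩)
  · have m1 : δ ∈ Ioo 0 η := ⟨hδ, by linarith⟩
    have m2 : x ∈ Ioo 0 η := ⟨by linarith, by linarith⟩
    have m3 : η / 2 ∈ Ioo 0 η := ⟨by linarith, by linarith⟩
    rcases hm with hm | hm
    · exact (min_le_right _ _).trans (hm m1 m2 hδx)
    · exact (min_le_left _ _).trans ((hmin ⟨le_rfl, by linarith⟩).trans (hm m2 m3 hx))

/-- Weakens the individual exponents to the common `E` and absorbs the constant lower bound `c₀`,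
which holds away from the degenerate endpoint, into the growth bound at `δ r`. -/
lemma eventually_growth_bounds {ψ δ : ℝ → ℝ} {α η a₁ a₂ E c₀ : ℝ} (hη : 0 < η)
    (ha₁ : 0 < a₁) (hE₁ : E ≤ a₁) (hE₂ : E ≤ a₂) (hE : E ≤ 1 / 6) (hηα : η ≤ α)
    (hpos : ∀ x ∈ Ioc 0 α, 0 < ψ x) (hc₀ : 0 < c₀)
    (hδpos : ∀ r, 0 < r → 0 < δ r) (hδ : δ =O[atTop] (fun r : ℝ => r ^ (-2 * a₁)))
    (hψ : (fun r => (ψ (δ r))⁻¹) =O[atTop] (fun r : ℝ => r ^ (1 - 4 * a₂))) :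
    ∃ C : ℝ, ∀ᶠ r : ℝ in atTop, 0 < δ r ∧ δ r < η / 2 ∧ δ r ≤ C * r ^ (-2 * E) ∧
      0 < min c₀ (ψ (δ r)) ∧ (min c₀ (ψ (δ r)))⁻¹ ≤ C * r ^ (1 - 4 * E) := by
  obtain ⟨C₁, hC₁, h1⟩ := hδ.exists_pos
  obtain ⟨C₂, hC₂, h2⟩ := hψ.exists_pos
  have hlim : Tendsto δ atTop (𝓝 0) := by
    refine hδ.trans_tendsto ?_
    have := tendsto_rpow_neg_atTop (show 0 < 2 * a₁ by linarith)
    refine this.congr fun r => ?_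
    congr 1; ring
  refine ⟨C₁ + C₂ + c₀⁻¹, ?_⟩
  filter_upwards [h1.bound, h2.bound, hlim.eventually (gt_mem_nhds (show (0 : ℝ) < η / 2 by linarith)),
    eventually_ge_atTop 1] with r hr1 hr2 hr3 hr
  have hr0 : 0 < r := by linarith
  have hδr := hδpos r hr0
  have hψr : 0 < ψ (δ r) := hpos _ ⟨hδr, by linarith⟩
  have hp1 : 0 < r ^ (-2 * E) := Real.rpow_pos_of_pos hr0 _
  have hp2 : 1 ≤ r ^ (1 - 4 * E) := Real.one_le_rpow hr (by linarith)
  have hcinv : 0 < c₀⁻¹ := inv_pos.2 hc₀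
  refine ⟨hδr, hr3, ?_, lt_min hc₀ hψr, ?_⟩
  · rw [Real.norm_eq_abs, Real.norm_eq_abs, abs_of_pos hδr,
      abs_of_pos (Real.rpow_pos_of_pos hr0 _)] at hr1
    calc δ r ≤ C₁ * r ^ (-2 * a₁) := hr1
      _ ≤ C₁ * r ^ (-2 * E) := by
          gcongr 1; exact Real.rpow_le_rpow_of_exponent_le hr (by linarith)
      _ ≤ _ := by gcongr; linarith
  · rw [Real.norm_eq_abs, Real.norm_eq_abs, abs_of_pos (inv_pos.2 hψr),
      abs_of_pos (Real.rpow_pos_of_pos hr0 _)] at hr2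
    have hle : (ψ (δ r))⁻¹ ≤ C₂ * r ^ (1 - 4 * E) := hr2.trans (by
      gcongr 1; exact Real.rpow_le_rpow_of_exponent_le hr (by linarith))
    rcases min_choice c₀ (ψ (δ r)) with h | h
    · rw [h]; nlinarith
    · rw [h]; nlinarith

/-- Only the endpoint `0` is critical. The sign `ε = -1` makes the second derivative positive, and
monotonicity on the first piece of the partition bounds it below on `[δ r, α]` by its value at `δ r`
or a constant. -/
lemma ConcaveBranch.branchBound {h : ℝ → ℝ} {α a₁ a₂ E D : ℝ} (hb : ConcaveBranch h α a₁ a₂)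
    (hα : 0 < α) (ha₁ : 0 < a₁) (hE₁ : E ≤ a₁) (hE₂ : E ≤ a₂) (hE : E ≤ 1 / 6) (hD0 : 0 ≤ D)
    (hD : ∀ x ∈ Icc 0 α, ∀ y ∈ Icc 0 α, |h x - h y| ≤ D * |x - y|) (σ τ : ℝ) :
    BranchBound h σ τ E 0 α := by
  have huniq : UniqueDiffOn ℝ (Ioc 0 α) := uniqueDiffOn_Ioc 0 α
  set φ := iteratedDerivWithin 2 h (Ioc 0 α) with hφ
  have hder : ∀ x ∈ Ioo 0 α, _ := fun x hx =>
    hasDerivAt_derivWithin_of_contDiffOn huniq hb.contDiffOn (Ioc_mem_nhds hx.1 hx.2)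
  refine branchBound_of_pieces (f₁ := derivWithin h (Ioc 0 α)) (φ := φ) (ε := -1) (Or.inr rfl)
    (fun x hx => (hder x hx).1) (fun x hx => (hder x hx).2) hb.piecewise hD0 hD hE ?_
  have hpos : ∀ x ∈ Ioc 0 α, 0 < -1 * φ x := fun x hx => by linarith [hb.deriv2_neg x hx]
  have hcont : ContinuousOn (fun x => -1 * φ x) (Ioc 0 α) :=
    continuousOn_const.mul (hb.contDiffOn.continuousOn_iteratedDerivWithin le_rfl huniq)
  obtain ⟨l, P, hP, hP0, hPl, hPm⟩ := hb.piecewise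
  rcases l with _ | l
  · exact absurd (hP0.symm.trans hPl) hα.ne
  set η := P 1 with hη
  have hη0 : 0 < η := by rw [← hP0]; exact hP (by simp)
  have hηα : η ≤ α := by rw [← hPl]; exact hP.monotone (Fin.le_last _)
  have hmono : MonotoneOn (fun x => -1 * φ x) (Ioo 0 η) ∨ AntitoneOn (fun x => -1 * φ x) (Ioo 0 η) := by
    have := hPm 0
    rw [Fin.castSucc_zero, hP0] at this
    rcases this with h | h
    · right; intro x hx y hy hxy; have := h hx hy hxy; simp only; linarith
    · left; intro x hx y hy hxy; have := h hx hy hxy; simp only; linarith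
  obtain ⟨c₀, hc₀, hmin⟩ := exists_min_le_of_monotonic hη0 hηα hcont hpos hmono
  obtain ⟨δ, hδpos, hδ, hδφ⟩ := hb.growth
  have hδφ' : (fun r => (-1 * φ (δ r))⁻¹) =O[atTop] (fun r : ℝ => r ^ (1 - 4 * a₂)) := by
    refine hδφ.neg_left.congr_left fun r => ?_
    rw [neg_one_mul, inv_neg]
  obtain ⟨C, hC⟩ := eventually_growth_bounds hη0 ha₁ hE₁ hE₂ hE hηα hpos hc₀ hδpos hδ hδφ'
  refine ⟨C, hC.mono fun r hr => ⟨δ r, α, _, hr.1.le, by linarith [hr.2.1], le_rfl,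
    by linarith [hr.2.2.1], hr.2.2.2.1, hr.2.2.2.2, fun x hx =>
      hmin (δ r) hr.1 hr.2.1 x hx.1.le hx.2.le⟩⟩

/-- Here the critical endpoint is `L`. The reflection `x ↦ L - x` carries it to `0`, so the last
piece of the partition plays the role of the first. -/
lemma ConvexBranch.branchBound {h : ℝ → ℝ} {L α a₁ a₂ a₃ E D : ℝ}
    (hb : ConvexBranch L h α a₁ a₂ a₃)
    (hα : α < L) (ha₁ : 0 < a₁) (hE₁ : E ≤ a₁) (hE₂ : E ≤ a₂) (hE : E ≤ 1 / 6) (hD0 : 0 ≤ D)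
    (hD : ∀ x ∈ Icc α L, ∀ y ∈ Icc α L, |h x - h y| ≤ D * |x - y|) (σ τ : ℝ) :
    BranchBound h σ τ E α L := by
  have huniq : UniqueDiffOn ℝ (Ico α L) := uniqueDiffOn_Ico α L
  set φ := iteratedDerivWithin 2 h (Ico α L) with hφ
  have hder : ∀ x ∈ Ioo α L, _ := fun x hx =>
    hasDerivAt_derivWithin_of_contDiffOn huniq hb.contDiffOn (Ico_mem_nhds hx.1 hx.2)
  refine branchBound_of_pieces (f₁ := derivWithin h (Ico α L)) (φ := φ) (ε := 1) (Or.inl rfl)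
    (fun x hx => (hder x hx).1) (fun x hx => (hder x hx).2) hb.piecewise hD0 hD hE ?_
  have hrefl : MapsTo (fun x => L - x) (Ioc 0 (L - α)) (Ico α L) := fun x hx =>
    ⟨by linarith [hx.2], by linarith [hx.1]⟩
  have hpos : ∀ x ∈ Ioc 0 (L - α), 0 < φ (L - x) := fun x hx => hb.deriv2_pos _ (hrefl hx)
  have hcont : ContinuousOn (fun x => φ (L - x)) (Ioc 0 (L - α)) :=
    (hb.contDiffOn.continuousOn_iteratedDerivWithin le_rfl huniq).comp
      (continuousOn_const.sub continuousOn_id) hrefl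
  obtain ⟨l, P, hP, hP0, hPl, hPm⟩ := hb.piecewise
  rcases l with _ | l
  · exact absurd (hP0.symm.trans hPl) hα.ne
  set η := L - P (Fin.last l).castSucc with hη
  have hη0 : 0 < η := by
    rw [hη, ← hPl, sub_pos]; exact hP (Fin.castSucc_lt_last _)
  have hηα : η ≤ L - α := by
    rw [hη, ← hP0]; linarith [hP.monotone (Fin.zero_le (Fin.last l).castSucc)]
  have hmono : MonotoneOn (fun x => φ (L - x)) (Ioo 0 η) ∨ AntitoneOn (fun x => φ (L - x)) (Ioo 0 η) := by
    have := hPm (Fin.last l)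
    rw [Fin.succ_last, hPl] at this
    have hmaps : ∀ x ∈ Ioo 0 η, L - x ∈ Ioo (P (Fin.last l).castSucc) L := fun x hx =>
      ⟨by linarith [hx.2], by linarith [hx.1]⟩
    rcases this with h | h
    · right; intro x hx y hy hxy; exact h (hmaps y hy) (hmaps x hx) (by linarith)
    · left; intro x hx y hy hxy; exact h (hmaps y hy) (hmaps x hx) (by linarith)
  obtain ⟨c₀, hc₀, hmin⟩ := exists_min_le_of_monotonic hη0 hηα hcont hpos hmono
  obtain ⟨δ, hδpos, hδ, hδφ⟩ := hb.growth
  obtain ⟨C, hC⟩ := eventually_growth_bounds (ψ := fun x => φ (L - x))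
    hη0 ha₁ hE₁ hE₂ hE hηα hpos hc₀ hδpos hδ hδφ
  refine ⟨C, hC.mono fun r hr => ⟨α, L - δ r, _, le_rfl, by linarith [hr.2.1], by linarith [hr.1],
    by linarith [hr.2.2.1], hr.2.2.2.1, hr.2.2.2.2, fun x hx => ?_⟩⟩
  have := hmin (δ r) hr.1 hr.2.1 (L - x) (by linarith [hx.2]) (by linarith [hx.1])
  simpa using this

/-! ### Chords of convex functions and the Euler–Maclaurin formula -/

lemma le_integral_of_linear_le {F : ℝ → ℝ} {a b A B : ℝ} (hab : a ≤ b)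
    (hF : ContinuousOn F (Icc a b)) (h : ∀ x ∈ Icc a b, A + B * (x - a) ≤ F x) :
    A * (b - a) + B * (b - a) ^ 2 / 2 ≤ ∫ x in a..b, F x := by
  have h1 : ∫ x in a..b, (A + B * (x - a)) = A * (b - a) + B * (b - a) ^ 2 / 2 := by
    have hd : ∀ x ∈ uIcc a b, HasDerivAt (fun x => A * (x - a) + B * (x - a) ^ 2 / 2)
        (A + B * (x - a)) x := by
      intro x _
      have e := (hasDerivAt_id x).sub_const a
      have := (e.const_mul A).add (((e.pow 2).const_mul B).div_const 2)
      refine this.congr_deriv ?_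
      simp
      ring
    rw [intervalIntegral.integral_eq_sub_of_hasDerivAt hd
      ((by fun_prop : Continuous fun x => A + B * (x - a)).intervalIntegrable _ _)]
    ring
  rw [← h1]
  refine intervalIntegral.integral_mono_on hab
    ((by fun_prop : Continuous fun x => A + B * (x - a)).intervalIntegrable _ _) ?_ h
  exact ContinuousOn.intervalIntegrable (by rwa [uIcc_of_le hab])

lemma integral_le_of_le_linear {F : ℝ → ℝ} {a b A B : ℝ} (hab : a ≤ b)
    (hF : ContinuousOn F (Icc a b)) (h : ∀ x ∈ Icc a b, F x ≤ A + B * (x - a)) :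
    ∫ x in a..b, F x ≤ A * (b - a) + B * (b - a) ^ 2 / 2 := by
  have := le_integral_of_linear_le (F := fun x => -F x) (A := -A) (B := -B) hab hF.neg
    (fun x hx => by linarith [h x hx])
  rw [intervalIntegral.integral_neg] at this
  linarith

lemma ConvexOn.le_chord {F : ℝ → ℝ} {S : Set ℝ} (hF : ConvexOn ℝ S F) {a b x : ℝ} (ha : a ∈ S)
    (hb : b ∈ S) (hab : a < b) (hx : x ∈ Icc a b) :
    F x ≤ F a + (F b - F a) / (b - a) * (x - a) := by
  have hba : 0 < b - a := by linarith
  have := hF.2 ha hb (show 0 ≤ (b - x) / (b - a) by apply div_nonneg <;> linarith [hx.2])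
    (show 0 ≤ (x - a) / (b - a) by apply div_nonneg <;> linarith [hx.1])
    (by field_simp; ring)
  simp only [smul_eq_mul] at this
  rw [show (b - x) / (b - a) * a + (x - a) / (b - a) * b = x by field_simp; ring] at this
  refine this.trans (le_of_eq ?_)
  field_simp
  ring

/-- A convex function lies above the extension to the right of a chord. -/
lemma ConvexOn.chord_le_right {F : ℝ → ℝ} {S : Set ℝ} (hF : ConvexOn ℝ S F) {a b x : ℝ} (ha : a ∈ S)
    (hxS : x ∈ S) (hab : a < b) (hx : b ≤ x) :
    F b + (F b - F a) / (b - a) * (x - b) ≤ F x := by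
  rcases hx.eq_or_lt with rfl | hlt
  · simp
  have := hF.slope_mono_adjacent ha hxS hab hlt
  rw [le_div_iff₀ (by linarith)] at this
  linarith

/-- A convex function lies above the extension to the left of a chord. -/
lemma ConvexOn.chord_le_left {F : ℝ → ℝ} {S : Set ℝ} (hF : ConvexOn ℝ S F) {a b x : ℝ} (hb : b ∈ S)
    (hxS : x ∈ S) (hab : a < b) (hx : x ≤ a) :
    F a + (F b - F a) / (b - a) * (x - a) ≤ F x := by
  rcases hx.eq_or_lt with rfl | hlt
  · simp
  have := hF.slope_mono_adjacent hxS hb hlt hab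
  rw [div_le_iff₀ (by linarith)] at this
  linarith

section EulerMaclaurin

variable {F : ℝ → ℝ} {u v D : ℝ}

lemma continuousOn_of_abs_sub_le (hD : ∀ x ∈ Icc u v, ∀ y ∈ Icc u v, |F x - F y| ≤ D * |x - y|) :
    ContinuousOn F (Icc u v) := by
  have : LipschitzOnWith (Real.toNNReal D) F (Icc u v) := by
    apply LipschitzOnWith.of_dist_le_mul
    intro x hx y hy
    rw [Real.dist_eq, Real.dist_eq]
    refine (hD x hx y hy).trans ?_
    gcongr
    exact Real.le_coe_toNNReal D
  exact this.continuousOn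

/-- Chords lie above a convex function, so the trapezoid error is nonnegative. On each unit interval
the extension of the preceding chord bounds the integral below, making the new error at most half
the difference of consecutive increments. These telescope; on the first interval, which has no
predecessor, the Lipschitz constant is used. -/
lemma trapezoid_bounds (hconv : ConvexOn ℝ (Icc u v) F)
    (hD : ∀ x ∈ Icc u v, ∀ y ∈ Icc u v, |F x - F y| ≤ D * |x - y|) {m : ℝ} (hum : u ≤ m) (k : ℕ)
    (hk : m + (k + 1) ≤ v) :
    0 ≤ ∑ i ∈ Finset.range (k + 2), F (m + i) - F m / 2 - F (m + (k + 1)) / 2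
        - ∫ x in m..(m + (k + 1)), F x ∧
    ∑ i ∈ Finset.range (k + 2), F (m + i) - F m / 2 - F (m + (k + 1)) / 2
        - ∫ x in m..(m + (k + 1)), F x ≤ (F (m + (k + 1)) - F (m + k) + D) / 2 := by
  have hcont := continuousOn_of_abs_sub_le hD
  have hupper : ∀ n, u ≤ n → n + 1 ≤ v → ∫ x in n..(n + 1), F x ≤ (F n + F (n + 1)) / 2 := by
    intro n hn hn'
    have hsub : Icc n (n + 1) ⊆ Icc u v := Icc_subset_Icc hn hn'
    have := integral_le_of_le_linear (A := F n) (B := F (n + 1) - F n) (by linarith)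
      (hcont.mono hsub) (fun x hx => by
        have := hconv.le_chord (hsub ⟨le_rfl, by linarith⟩) (hsub ⟨by linarith, le_rfl⟩)
          (by linarith) hx
        simpa using this)
    have e : n + 1 - n = 1 := by ring
    rw [e] at this
    linarith
  induction k with
  | zero =>
    have h1 := hupper m hum (by simpa using hk)
    simp only [Finset.sum_range_succ, Finset.sum_range_zero, zero_add, Nat.cast_zero, add_zero,
      Nat.cast_one] at hk ⊢
    refine ⟨by linarith, ?_⟩
    have hsub : Icc m (m + 1) ⊆ Icc u v := Icc_subset_Icc hum hk
    have h2 := le_integral_of_linear_le (A := F m) (B := -D) (show m ≤ m + 1 by linarith)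
      (hcont.mono hsub) (fun x hx => by
        have := abs_le.1 (hD x (hsub hx) m (hsub ⟨le_rfl, by linarith⟩))
        rw [abs_of_nonneg (show 0 ≤ x - m by linarith [hx.1])] at this
        linarith [this.1])
    have e : m + 1 - m = 1 := by ring
    rw [e] at h2
    linarith
  | succ k ih =>
    push_cast at hk ⊢
    obtain ⟨ih1, ih2⟩ := ih (by linarith)
    set n : ℝ := m + (k + 1) with hn
    have hkn : (0 : ℝ) ≤ k := by positivity
    have en : m + (k + 1 + 1) = n + 1 := by rw [hn]; ring
    rw [en] at hk ⊢
    have hun : u ≤ n := by rw [hn]; linarith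
    have hsub : Icc n (n + 1) ⊆ Icc u v := Icc_subset_Icc hun hk
    have h1 := hupper n hun hk
    have hmem : m + k ∈ Icc u v := ⟨by linarith, by rw [hn] at hk; linarith⟩
    have h2 := le_integral_of_linear_le (A := F n) (B := F n - F (m + k))
      (show n ≤ n + 1 by linarith) (hcont.mono hsub) (fun x hx => by
        have := hconv.chord_le_right hmem (hsub hx) (show m + k < n by rw [hn]; linarith) hx.1
        rwa [show n - (m + k) = 1 by rw [hn]; ring, div_one] at this)
    have e : n + 1 - n = 1 := by ring
    rw [e] at h2
    have hadd : ∫ x in m..(n + 1), F x = (∫ x in m..n, F x) + ∫ x in n..(n + 1), F x := by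
      symm
      apply intervalIntegral.integral_add_adjacent_intervals
      · apply ContinuousOn.intervalIntegrable
        rw [uIcc_of_le (by rw [hn]; linarith)]
        exact hcont.mono (Icc_subset_Icc hum (by linarith))
      · apply ContinuousOn.intervalIntegrable
        rw [uIcc_of_le (by linarith)]
        exact hcont.mono hsub
    rw [Finset.sum_range_succ, hadd]
    push_cast
    rw [show m + ((k : ℝ) + 2) = n + 1 by rw [hn]; ring]
    constructor <;> linarith

lemma abs_integral_sub_le (hD : ∀ x ∈ Icc u v, ∀ y ∈ Icc u v, |F x - F y| ≤ D * |x - y|)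
    (hD0 : 0 ≤ D) (huv : u ≤ v) (h1 : v - u ≤ 1) {y : ℝ} (hy : y ∈ Icc u v) :
    |(∫ x in u..v, F x) - (v - u) * F y| ≤ D := by
  have hcont := continuousOn_of_abs_sub_le hD
  have key : ∀ x ∈ Icc u v, |F x - F y| ≤ D := fun x hx => by
    refine (hD x hx y hy).trans ?_
    have : |x - y| ≤ 1 := abs_le.2 ⟨by linarith [hx.1, hy.2], by linarith [hx.2, hy.1]⟩
    nlinarith
  have h2 := le_integral_of_linear_le (A := F y - D) (B := 0) huv hcont
    (fun x hx => by linarith [(abs_le.1 (key x hx)).1])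
  have h3 := integral_le_of_le_linear (A := F y + D) (B := 0) huv hcont
    (fun x hx => by linarith [(abs_le.1 (key x hx)).2])
  have h4 : D * (v - u) ≤ D := by nlinarith
  rw [abs_le]
  constructor <;> nlinarith

/-- First-order Euler–Maclaurin formula for a convex Lipschitz function. -/
lemma euler_maclaurin_of_convexOn (hconv : ConvexOn ℝ (Icc u v) F)
    (hD : ∀ x ∈ Icc u v, ∀ y ∈ Icc u v, |F x - F y| ≤ D * |x - y|) (hD0 : 0 ≤ D) (huv : u ≤ v) :
    |∑ j ∈ Finset.Ioc ⌊u⌋ ⌊v⌋, F j - ((∫ x in u..v, F x) + sawtooth u * F u - sawtooth v * F v)|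
      ≤ 4 * D := by
  have hcont := continuousOn_of_abs_sub_le hD
  have fu := Int.floor_le u
  have fu' := Int.lt_floor_add_one u
  have fv := Int.floor_le v
  have fv' := Int.lt_floor_add_one v
  have su : sawtooth u = u - ⌊u⌋ - 1 / 2 := by
    unfold sawtooth; linarith [Int.fract_add_floor u]
  have sv : sawtooth v = v - ⌊v⌋ - 1 / 2 := by
    unfold sawtooth; linarith [Int.fract_add_floor v]
  rw [su, sv]
  -- If no integer lies in `(u, v]` the interval has length less than `1` and everything is `O(D)`.
  -- Otherwise the trapezoidal rule runs between the first and last integers, and the two end pieces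
  -- supply the sawtooth terms.
  rcases (Int.floor_le_floor huv).eq_or_lt with heq | hlt
  · rw [heq] at fu fu' ⊢
    rw [Finset.Ioc_self, Finset.sum_empty]
    have h1 := abs_le.1 (abs_integral_sub_le hD hD0 huv (by linarith)
      (show u ∈ Icc u v from ⟨le_rfl, huv⟩))
    have h2 : |F v - F u| ≤ D := by
      refine (hD v ⟨huv, le_rfl⟩ u ⟨le_rfl, huv⟩).trans ?_
      have : |v - u| ≤ 1 := abs_le.2 ⟨by linarith, by linarith⟩
      nlinarith
    have h3 : |(v - ⌊v⌋ - 1 / 2) * (F v - F u)| ≤ D := by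
      rw [abs_mul]
      have : |v - ⌊v⌋ - 1 / 2| ≤ 1 := abs_le.2 ⟨by linarith, by linarith⟩
      nlinarith [abs_nonneg (F v - F u)]
    have h3' := abs_le.1 h3
    rw [abs_le]
    constructor <;> nlinarith [h1.1, h1.2, h3'.1, h3'.2]
  · set m : ℝ := (⌊u⌋ : ℝ) + 1 with hm
    set k := (⌊v⌋ - ⌊u⌋ - 1).toNat with hk
    have hkv : m + k = ⌊v⌋ := by
      have : ((k : ℤ) : ℝ) = ⌊v⌋ - ⌊u⌋ - 1 := by
        rw [hk, Int.toNat_of_nonneg (by omega)]; push_cast; ring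
      rw [Int.cast_natCast] at this
      rw [hm, this]; ring
    have hsum : ∑ j ∈ Finset.Ioc ⌊u⌋ ⌊v⌋, F j = ∑ i ∈ Finset.range (k + 1), F (m + i) := by
      rw [sum_Ioc_eq_sum_range, show (⌊v⌋ - ⌊u⌋).toNat = k + 1 by omega]
      refine Finset.sum_congr rfl fun i _ => ?_
      rw [hm]; push_cast; rfl
    rw [hsum]
    have hum : u ≤ m := fu'.le
    have hkn : (0 : ℝ) ≤ k := by positivity
    have hmv : m ≤ ⌊v⌋ := by rw [← hkv]; linarith
    have hmmem : m ∈ Icc u v := ⟨hum, by linarith⟩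
    have hvmem : (⌊v⌋ : ℝ) ∈ Icc u v := ⟨by linarith, fv⟩
    have umem : u ∈ Icc u v := ⟨le_rfl, huv⟩
    have vmem : v ∈ Icc u v := ⟨huv, le_rfl⟩
    have htrap : |∑ i ∈ Finset.range (k + 1), F (m + i) - F m / 2 - F ⌊v⌋ / 2
        - ∫ x in m..(⌊v⌋ : ℝ), F x| ≤ D := by
      rcases hk0 : k with _ | k'
      · rw [hk0] at hkv
        push_cast at hkv
        rw [← hkv]
        simp
        rw [show F m - F m / 2 - F m / 2 = 0 by ring, abs_zero]
        exact hD0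
      · rw [hk0] at hkv
        push_cast at hkv
        have hk' : m + ((k' : ℝ) + 1) ≤ v := by rw [hkv]; exact fv
        obtain ⟨t1, t2⟩ := trapezoid_bounds hconv hD hum k' hk'
        have t3 := hD (m + (k' + 1)) (by rw [hkv]; exact hvmem) (m + k')
          ⟨by have : (0 : ℝ) ≤ k' := by positivity
              linarith, by linarith⟩
        rw [show m + ((k' : ℝ) + 1) - (m + k') = 1 by ring, abs_one, mul_one] at t3
        rw [hkv] at t1 t2 t3
        rw [abs_of_nonneg t1]
        linarith [(abs_le.1 t3).2]
    have hsubl : Icc u m ⊆ Icc u v := Icc_subset_Icc le_rfl hmmem.2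
    have hsubr : Icc (⌊v⌋ : ℝ) v ⊆ Icc u v := Icc_subset_Icc hvmem.1 le_rfl
    have e1 := abs_integral_sub_le (fun x hx y hy => hD x (hsubl hx) y (hsubl hy)) hD0 hum
      (by linarith) (show u ∈ Icc u m from ⟨le_rfl, hum⟩)
    have e2 := abs_integral_sub_le (fun x hx y hy => hD x (hsubr hx) y (hsubr hy)) hD0 fv
      (by linarith) (show v ∈ Icc (⌊v⌋ : ℝ) v from ⟨fv, le_rfl⟩)
    have e3 : |F m - F u| ≤ D := by
      refine (hD m hmmem u umem).trans ?_
      have : |m - u| ≤ 1 := abs_le.2 ⟨by linarith, by linarith⟩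
      nlinarith
    have e4 : |F ⌊v⌋ - F v| ≤ D := by
      refine (hD _ hvmem v vmem).trans ?_
      have : |(⌊v⌋ : ℝ) - v| ≤ 1 := abs_le.2 ⟨by linarith, by linarith⟩
      nlinarith
    have hint : ∀ a b, u ≤ a → a ≤ b → b ≤ v → IntervalIntegrable F MeasureTheory.volume a b := by
      intro a b ha hab hb
      apply ContinuousOn.intervalIntegrable
      rw [uIcc_of_le hab]
      exact hcont.mono (Icc_subset_Icc ha hb)
    have hadd : ∫ x in u..v, F x = (∫ x in u..m, F x) + (∫ x in m..(⌊v⌋ : ℝ), F x) +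
        ∫ x in (⌊v⌋ : ℝ)..v, F x := by
      rw [intervalIntegral.integral_add_adjacent_intervals (hint u m le_rfl hum hmmem.2)
        (hint m _ hum hmv fv), intervalIntegral.integral_add_adjacent_intervals
        (hint u _ le_rfl hvmem.1 fv) (hint _ v hvmem.1 fv le_rfl)]
    rw [hadd]
    have ht := abs_le.1 htrap
    have e1' := abs_le.1 e1
    have e2' := abs_le.1 e2
    have e3' := abs_le.1 e3
    have e4' := abs_le.1 e4
    have ru : (u - ⌊u⌋ - 1 / 2) * F u = F u / 2 - (m - u) * F u := by rw [hm]; ring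
    have rv : (v - ⌊v⌋ - 1 / 2) * F v = (v - ⌊v⌋) * F v - F v / 2 := by ring
    rw [ru, rv, abs_le]
    constructor <;> linarith [ht.1, ht.2, e1'.1, e1'.2, e2'.1, e2'.2, e3'.1, e3'.2, e4'.1, e4'.2]

lemma euler_maclaurin (hconv : ConvexOn ℝ (Icc u v) F ∨ ConcaveOn ℝ (Icc u v) F)
    (hD : ∀ x ∈ Icc u v, ∀ y ∈ Icc u v, |F x - F y| ≤ D * |x - y|) (hD0 : 0 ≤ D) (huv : u ≤ v) :
    |∑ j ∈ Finset.Ioc ⌊u⌋ ⌊v⌋, F j - ((∫ x in u..v, F x) + sawtooth u * F u - sawtooth v * F v)|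
      ≤ 4 * D := by
  rcases hconv with h | h
  · exact euler_maclaurin_of_convexOn h hD hD0 huv
  · have := euler_maclaurin_of_convexOn (F := fun x => -F x) h.neg (D := D)
      (fun x hx y hy => by
        rw [show -F x - -F y = -(F x - F y) by ring, abs_neg]; exact hD x hx y hy) hD0 huv
    rw [Finset.sum_neg_distrib, intervalIntegral.integral_neg, ← abs_neg] at this
    refine le_trans (le_of_eq ?_) this
    congr 1
    ring

end EulerMaclaurin

/-! ### Column sums of integer parts -/

/-- The sum over the columns with abscissa in `(u, v]` of the integer parts of the heights. -/
noncomputable def columnSum (f : ℝ → ℝ) (σ τ r s u v : ℝ) : ℝ :=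
  ∑ j ∈ Finset.Ioc ⌊u * r / s - σ⌋ ⌊v * r / s - σ⌋, (⌊r * s * f (((j : ℝ) + σ) * s / r) - τ⌋ : ℝ)

/-- The integer part of `y - τ` is `y - (τ + 1/2) - sawtooth (y - τ)`. Euler–Maclaurin evaluates the
first term, the number of columns the second up to one column, and the sawtooth sum stays in the
error. Rescaling turns the Lipschitz constant `D` into `s ^ 2 * D`. -/
lemma columnSum_estimate {f : ℝ → ℝ} {σ τ r s u v D : ℝ} (hr : 0 < r) (hs : 0 < s) (huv : u ≤ v)
    (hconv : ConvexOn ℝ (Icc u v) f ∨ ConcaveOn ℝ (Icc u v) f)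
    (hD : ∀ x ∈ Icc u v, ∀ y ∈ Icc u v, |f x - f y| ≤ D * |x - y|) (hD0 : 0 ≤ D) :
    |columnSum f σ τ r s u v - (r ^ 2 * (∫ x in u..v, f x) + sawtooth (u * r / s - σ) * (r * s * f u)
      - sawtooth (v * r / s - σ) * (r * s * f v) - (τ + 1 / 2) * ((v - u) * r / s))| ≤
      4 * (s ^ 2 * D) + |τ + 1 / 2| + |sawtoothSum f σ τ r s u v| := by
  set U := u * r / s - σ with hU
  set V := v * r / s - σ with hV
  have hUV : U ≤ V := by rw [hU, hV]; gcongr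
  have hrs : 0 < r * s := by positivity
  set F : ℝ → ℝ := fun x => r * s * f ((x + σ) * s / r) with hF
  have hmapU : (U + σ) * s / r = u := by rw [hU]; field_simp; ring
  have hmapV : (V + σ) * s / r = v := by rw [hV]; field_simp; ring
  have hmaps : ∀ x ∈ Icc U V, (x + σ) * s / r ∈ Icc u v := by
    intro x hx
    rw [← hmapU, ← hmapV]
    constructor
    · have := hx.1; gcongr
    · have := hx.2; gcongr
  have hFconv : ConvexOn ℝ (Icc U V) F ∨ ConcaveOn ℝ (Icc U V) F := by
    have haff : ∀ x y a b : ℝ, a + b = 1 → (a * x + b * y + σ) * s / r =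
        a * ((x + σ) * s / r) + b * ((y + σ) * s / r) := by
      intro x y a b hab
      field_simp
      linear_combination (-σ) * hab
    refine hconv.imp (fun h => ⟨convex_Icc _ _, ?_⟩) (fun h => ⟨convex_Icc _ _, ?_⟩)
    · intro x hx y hy a b ha hb hab
      have := h.2 (hmaps x hx) (hmaps y hy) ha hb hab
      simp only [smul_eq_mul, hF] at this ⊢
      rw [haff x y a b hab]
      nlinarith
    · intro x hx y hy a b ha hb hab
      have := h.2 (hmaps x hx) (hmaps y hy) ha hb hab
      simp only [smul_eq_mul, hF] at this ⊢
      rw [haff x y a b hab]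
      nlinarith
  have hFD : ∀ x ∈ Icc U V, ∀ y ∈ Icc U V, |F x - F y| ≤ s ^ 2 * D * |x - y| := by
    intro x hx y hy
    have := hD _ (hmaps x hx) _ (hmaps y hy)
    rw [show (x + σ) * s / r - (y + σ) * s / r = s / r * (x - y) by ring, abs_mul,
      abs_of_pos (by positivity : 0 < s / r)] at this
    simp only [hF]
    rw [← mul_sub, abs_mul, abs_of_pos hrs]
    calc r * s * |f ((x + σ) * s / r) - f ((y + σ) * s / r)|
        ≤ r * s * (D * (s / r * |x - y|)) := by gcongr
      _ = _ := by field_simp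
  have hem := euler_maclaurin hFconv hFD (by positivity) hUV
  have hint : ∫ x in U..V, F x = r ^ 2 * ∫ x in u..v, f x := by
    have h1 : ∀ x, F x = r * s * f (s / r * x + σ * s / r) := by
      intro x; simp only [hF]; congr 2; ring
    simp_rw [h1]
    rw [intervalIntegral.integral_const_mul, intervalIntegral.integral_comp_mul_add _
      (by positivity : s / r ≠ 0), smul_eq_mul,
      show s / r * U + σ * s / r = u by rw [← hmapU]; ring,
      show s / r * V + σ * s / r = v by rw [← hmapV]; ring]
    field_simp
  have hFU : F U = r * s * f u := by simp only [hF]; rw [hmapU]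
  have hFV : F V = r * s * f v := by simp only [hF]; rw [hmapV]
  rw [hint, hFU, hFV] at hem
  have hcol : columnSum f σ τ r s u v = ∑ j ∈ Finset.Ioc ⌊U⌋ ⌊V⌋, F j -
      (τ + 1 / 2) * ((⌊V⌋ : ℝ) - ⌊U⌋) - sawtoothSum f σ τ r s u v := by
    have hcard : ((Finset.Ioc ⌊U⌋ ⌊V⌋).card : ℝ) = (⌊V⌋ : ℝ) - ⌊U⌋ := by
      rw [Int.card_Ioc, ← Int.cast_natCast,
        Int.toNat_of_nonneg (sub_nonneg.2 (Int.floor_le_floor hUV))]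
      push_cast; rfl
    rw [← hcard, mul_comm (τ + 1 / 2), ← nsmul_eq_mul, ← Finset.sum_const]
    unfold columnSum sawtoothSum
    rw [← Finset.sum_sub_distrib, ← Finset.sum_sub_distrib]
    refine Finset.sum_congr rfl fun j _ => ?_
    have := Int.fract_add_floor (r * s * f (((j : ℝ) + σ) * s / r) - τ)
    unfold sawtooth
    simp only [hF]
    linarith
  have hlen : |(⌊V⌋ : ℝ) - ⌊U⌋ - (v - u) * r / s| ≤ 1 := by
    have : (v - u) * r / s = V - U := by rw [hU, hV]; ring
    rw [this, abs_le]
    have a1 := Int.floor_le U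
    have a2 := Int.lt_floor_add_one U
    have a3 := Int.floor_le V
    have a4 := Int.lt_floor_add_one V
    constructor <;> linarith
  have hlen' : |(τ + 1 / 2) * ((⌊V⌋ : ℝ) - ⌊U⌋ - (v - u) * r / s)| ≤ |τ + 1 / 2| := by
    rw [abs_mul]
    exact mul_le_of_le_one_right (abs_nonneg _) hlen
  rw [hcol]
  have b1 := abs_le.1 hem
  have b2 := abs_le.1 hlen'
  have b3 := neg_abs_le (sawtoothSum f σ τ r s u v)
  have b4 := le_abs_self (sawtoothSum f σ τ r s u v)
  rw [abs_le]
  constructor <;> linarith [b1.1, b1.2, b2.1, b2.2]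

/-! ### Geometry of the curve and its inverse -/

namespace IsDecreasingCurve

variable {L : ℝ} {f g : ℝ → ℝ}

lemma mapsTo (hΓ : IsDecreasingCurve L f g) : MapsTo f (Icc 0 L) (Icc 0 L) := by
  intro x hx
  have h0 : (0 : ℝ) ∈ Icc 0 L := ⟨le_rfl, hΓ.pos.le⟩
  have hL : L ∈ Icc 0 L := ⟨hΓ.pos.le, le_rfl⟩
  constructor
  · have := hΓ.strictAntiOn.antitoneOn hx hL hx.2
    rwa [hΓ.map_intercept] at this
  · have := hΓ.strictAntiOn.antitoneOn h0 hx hx.1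
    rwa [hΓ.map_zero] at this

lemma g_f (hΓ : IsDecreasingCurve L f g) {x : ℝ} (hx : x ∈ Icc 0 L) : g (f x) = x :=
  hΓ.invOn.1 hx

lemma f_g (hΓ : IsDecreasingCurve L f g) {y : ℝ} (hy : y ∈ Icc 0 L) : f (g y) = y :=
  hΓ.invOn.2 hy

lemma le_iff (hΓ : IsDecreasingCurve L f g) {x y : ℝ} (hx : x ∈ Icc 0 L) (hy : y ∈ Icc 0 L) :
    y ≤ f x ↔ x ≤ g y := by
  rw [← hΓ.strictAntiOn.le_iff_ge (hΓ.mapsTo_inverse hy) hx, hΓ.f_g hy]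

lemma under_iff (hΓ : IsDecreasingCurve L f g) {x y : ℝ} (hx : 0 ≤ x) (hy : 0 ≤ y) :
    (x ≤ L ∧ y ≤ f x) ↔ (y ≤ L ∧ x ≤ g y) := by
  constructor
  · rintro ⟨h1, h2⟩
    have hyL : y ≤ L := h2.trans (hΓ.mapsTo ⟨hx, h1⟩).2
    exact ⟨hyL, (hΓ.le_iff ⟨hx, h1⟩ ⟨hy, hyL⟩).1 h2⟩
  · rintro ⟨h1, h2⟩
    have hxL : x ≤ L := h2.trans (hΓ.mapsTo_inverse ⟨hy, h1⟩).2
    exact ⟨hxL, (hΓ.le_iff ⟨hx, hxL⟩ ⟨hy, h1⟩).2 h2⟩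

/-- Every statement about columns thereby gives one about rows. Continuity of the inverse comes from
compactness: a continuous bijection from a compact space to a Hausdorff space is a homeomorphism. -/
lemma symm (hΓ : IsDecreasingCurve L f g) : IsDecreasingCurve L g f := by
  have h0 : (0 : ℝ) ∈ Icc 0 L := ⟨le_rfl, hΓ.pos.le⟩
  have hL : L ∈ Icc 0 L := ⟨hΓ.pos.le, le_rfl⟩
  refine ⟨hΓ.pos, ?_, ?_, ?_, ?_, hΓ.mapsTo, hΓ.invOn.symm⟩
  · let e : Icc (0 : ℝ) L ≃ Icc (0 : ℝ) L :=
      { toFun := hΓ.mapsTo.restrict f _ _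
        invFun := hΓ.mapsTo_inverse.restrict g _ _
        left_inv := fun x => Subtype.ext (hΓ.g_f x.2)
        right_inv := fun y => Subtype.ext (hΓ.f_g y.2) }
    have hc : Continuous e :=
      continuous_induced_rng.2 (continuousOn_iff_continuous_domRestrict.1 hΓ.continuousOn)
    have hc' : Continuous e.symm := (hc.homeoOfEquivCompactToT2 (f := e)).symm.continuous
    exact continuousOn_iff_continuous_domRestrict.2 (continuous_subtype_val.comp hc')
  · intro y hy y' hy' hlt
    rw [← hΓ.strictAntiOn.lt_iff_gt (hΓ.mapsTo_inverse hy) (hΓ.mapsTo_inverse hy'), hΓ.f_g hy,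
      hΓ.f_g hy']
    exact hlt
  · have := hΓ.g_f hL
    rwa [hΓ.map_intercept] at this
  · have := hΓ.g_f h0
    rwa [hΓ.map_zero] at this

lemma concaveOn_inverse (hΓ : IsDecreasingCurve L f g) (hf : ConcaveOn ℝ (Icc 0 L) f) :
    ConcaveOn ℝ (Icc 0 L) g := by
  refine ⟨convex_Icc _ _, fun y hy y' hy' a b ha hb hab => ?_⟩
  have hx := hΓ.mapsTo_inverse hy
  have hx' := hΓ.mapsTo_inverse hy'
  rw [← hΓ.le_iff (convex_Icc _ _ hx hx' ha hb hab) (convex_Icc _ _ hy hy' ha hb hab)]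
  have := hf.2 hx hx' ha hb hab
  rwa [hΓ.f_g hy, hΓ.f_g hy'] at this

lemma convexOn_inverse (hΓ : IsDecreasingCurve L f g) (hf : ConvexOn ℝ (Icc 0 L) f) :
    ConvexOn ℝ (Icc 0 L) g := by
  refine ⟨convex_Icc _ _, fun y hy y' hy' a b ha hb hab => ?_⟩
  have hx := hΓ.mapsTo_inverse hy
  have hx' := hΓ.mapsTo_inverse hy'
  have hz := convex_Icc _ _ hy hy' ha hb hab
  have hw := convex_Icc _ _ hx hx' ha hb hab
  have := hf.2 hx hx' ha hb hab
  rw [hΓ.f_g hy, hΓ.f_g hy'] at this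
  have h2 := hΓ.symm.strictAntiOn.antitoneOn (hΓ.mapsTo hw) hz this
  rwa [hΓ.g_f hw] at h2

lemma intervalIntegrable (hΓ : IsDecreasingCurve L f g) {a b : ℝ} (ha : 0 ≤ a) (hab : a ≤ b)
    (hb : b ≤ L) : IntervalIntegrable f MeasureTheory.volume a b := by
  apply ContinuousOn.intervalIntegrable
  rw [uIcc_of_le hab]
  exact hΓ.continuousOn.mono (Icc_subset_Icc ha hb)

/-- Layer-cake formula: within `(0, α]` the superlevel set of `f` at height `t + f α` is `(0, g (t +
f α)]`. -/
lemma integral_eq (hΓ : IsDecreasingCurve L f g) {α : ℝ} (hα : α ∈ Icc 0 L) :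
    ∫ x in (0 : ℝ)..α, f x = α * f α + ∫ y in (f α)..L, g y := by
  have hfα := hΓ.mapsTo hα
  have hint := hΓ.intervalIntegrable le_rfl hα.1 hα.2
  have hint' : IntervalIntegrable (fun x => f x - f α) MeasureTheory.volume 0 α :=
    hint.sub (by simp)
  have hanti : ∀ x ∈ Ioc 0 α, f α ≤ f x := fun x hx =>
    hΓ.strictAntiOn.antitoneOn ⟨hx.1.le, hx.2.trans hα.2⟩ hα hx.2
  have hlc : ∫ x in (0 : ℝ)..α, (f x - f α) = ∫ y in (f α)..L, g y := by
    rw [intervalIntegral.integral_of_le hα.1]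
    rw [MeasureTheory.Integrable.integral_eq_integral_Ioc_meas_le (M := L - f α)]
    · have hM : 0 ≤ L - f α := by linarith [hfα.2]
      have e1 : ∫ y in (f α)..L, g y = ∫ t in (0 : ℝ)..(L - f α), g (t + f α) := by
        rw [intervalIntegral.integral_comp_add_right, zero_add, sub_add_cancel]
      rw [e1, intervalIntegral.integral_of_le hM]
      refine MeasureTheory.setIntegral_congr_fun measurableSet_Ioc fun t ht => ?_
      have hy : t + f α ∈ Icc 0 L := ⟨by linarith [ht.1, hfα.1], by linarith [ht.2]⟩
      have hg := hΓ.mapsTo_inverse hy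
      have hgα : g (t + f α) ≤ α := by
        have := hΓ.symm.strictAntiOn.antitoneOn hfα hy (by linarith [ht.1])
        rwa [hΓ.g_f hα] at this
      simp only [MeasureTheory.Measure.real]
      rw [MeasureTheory.Measure.restrict_apply']
      · have hset : {a : ℝ | t ≤ f a - f α} ∩ Ioc 0 α = Ioc 0 (g (t + f α)) := by
          ext x
          simp only [mem_inter_iff, mem_ofPred_eq, mem_Ioc]
          constructor
          · rintro ⟨h1, h2, h3⟩
            exact ⟨h2, (hΓ.le_iff ⟨h2.le, h3.trans hα.2⟩ hy).1 (by linarith)⟩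
          · rintro ⟨h1, h2⟩
            have h3 := h2.trans hgα
            have := (hΓ.le_iff ⟨h1.le, h3.trans hα.2⟩ hy).2 h2
            exact ⟨by linarith, h1, h3⟩
        rw [hset, Real.volume_Ioc, sub_zero, ENNReal.toReal_ofReal hg.1]
      · exact measurableSet_Ioc
    · exact hint'.1
    · filter_upwards [MeasureTheory.ae_restrict_mem measurableSet_Ioc] with x hx
      have := hanti x hx
      simp only [Pi.zero_apply]
      linarith
    · filter_upwards [MeasureTheory.ae_restrict_mem measurableSet_Ioc] with x hx
      have := (hΓ.mapsTo ⟨hx.1.le, hx.2.trans hα.2⟩).2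
      linarith
  rw [← hlc, intervalIntegral.integral_sub hint (by simp)]
  simp

lemma area_symm (hΓ : IsDecreasingCurve L f g) : area L f = area L g := by
  have := hΓ.integral_eq ⟨hΓ.pos.le, le_rfl⟩
  rw [hΓ.map_intercept] at this
  simpa [area] using this

lemma integral_add_integral (hΓ : IsDecreasingCurve L f g) {a b c : ℝ} (ha : 0 ≤ a) (hab : a ≤ b)
    (hbc : b ≤ c) (hc : c ≤ L) :
    (∫ x in a..b, f x) + ∫ x in b..c, f x = ∫ x in a..c, f x :=
  intervalIntegral.integral_add_adjacent_intervals (hΓ.intervalIntegrable ha hab (hbc.trans hc))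
    (hΓ.intervalIntegrable (ha.trans hab) hbc hc)

lemma area_pos (hΓ : IsDecreasingCurve L f g) : 0 < area L f := by
  unfold area
  apply intervalIntegral.intervalIntegral_pos_of_pos_on (hΓ.intervalIntegrable le_rfl hΓ.pos.le le_rfl) _
    hΓ.pos
  intro x hx
  have := hΓ.strictAntiOn ⟨hx.1.le, hx.2.le⟩ ⟨hΓ.pos.le, le_rfl⟩ hx.2
  rwa [hΓ.map_intercept] at this

/-- Slopes of a concave function decrease, so those to the left of `α` are no steeper than a chord
ending at `(L, 0)`. In the convex case the chord from `(0, L)` does the same to the right of `α`. -/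
lemma abs_sub_le_of_concaveOn (hΓ : IsDecreasingCurve L f g) (hf : ConcaveOn ℝ (Icc 0 L) f) {α : ℝ}
    (hα : α < L) : ∀ x ∈ Icc 0 α, ∀ y ∈ Icc 0 α, |f x - f y| ≤ L / (L - α) * |x - y| := by
  have key : ∀ x ∈ Icc 0 α, ∀ y ∈ Icc 0 α, x < y → |f x - f y| ≤ L / (L - α) * |x - y| := by
    intro x hx y hy hxy
    have hxL : x ∈ Icc 0 L := ⟨hx.1, hx.2.trans hα.le⟩
    have hyL : y ∈ Icc 0 L := ⟨hy.1, hy.2.trans hα.le⟩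
    have hL : L ∈ Icc 0 L := ⟨hΓ.pos.le, le_rfl⟩
    have h1 := hf.slope_anti_adjacent hxL hL hxy (hy.2.trans_lt hα)
    rw [hΓ.map_intercept] at h1
    have h2 := hΓ.strictAntiOn hxL hyL hxy
    rw [abs_of_pos (by linarith), abs_sub_comm, abs_of_pos (by linarith)]
    have h3 : f y / (L - y) ≤ L / (L - α) := by
      have := (hΓ.mapsTo hyL).2
      have := hΓ.pos
      have := hy.2
      gcongr
    have h4 : -(L / (L - α)) ≤ (f y - f x) / (y - x) := by
      refine le_trans ?_ h1
      rw [zero_sub, neg_div]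
      linarith
    rw [le_div_iff₀ (by linarith)] at h4
    linarith
  intro x hx y hy
  rcases lt_trichotomy x y with h | h | h
  · exact key x hx y hy h
  · simp [h]
  · rw [abs_sub_comm, abs_sub_comm x y]
    exact key y hy x hx h

lemma abs_sub_le_of_convexOn (hΓ : IsDecreasingCurve L f g) (hf : ConvexOn ℝ (Icc 0 L) f) {α : ℝ}
    (hα : 0 < α) : ∀ x ∈ Icc α L, ∀ y ∈ Icc α L, |f x - f y| ≤ L / α * |x - y| := by
  have key : ∀ x ∈ Icc α L, ∀ y ∈ Icc α L, x < y → |f x - f y| ≤ L / α * |x - y| := by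
    intro x hx y hy hxy
    have hxL : x ∈ Icc 0 L := ⟨hα.le.trans hx.1, hx.2⟩
    have hyL : y ∈ Icc 0 L := ⟨hα.le.trans hy.1, hy.2⟩
    have h0 : (0 : ℝ) ∈ Icc 0 L := ⟨le_rfl, hΓ.pos.le⟩
    have h1 := hf.slope_mono_adjacent h0 hyL (hα.trans_le hx.1) hxy
    rw [hΓ.map_zero] at h1
    have h2 := hΓ.strictAntiOn hxL hyL hxy
    rw [abs_of_pos (by linarith), abs_sub_comm, abs_of_pos (by linarith)]
    have h3 : (L - f x) / (x - 0) ≤ L / α := by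
      have := (hΓ.mapsTo hxL).1
      have := hΓ.pos
      have := hx.1
      gcongr <;> linarith
    have h4 : -(L / α) ≤ (f y - f x) / (y - x) := by
      refine le_trans ?_ h1
      rw [← neg_sub L (f x), neg_div]
      linarith
    rw [le_div_iff₀ (by linarith)] at h4
    linarith
  intro x hx y hy
  rcases lt_trichotomy x y with h | h | h
  · exact key x hx y hy h
  · simp [h]
  · rw [abs_sub_comm, abs_sub_comm x y]
    exact key y hy x hx h

end IsDecreasingCurve

/-! ### Lattice points in columns and reflection in the diagonal -/

/-- The set counted by `count`. -/
def latticeSet (L : ℝ) (f : ℝ → ℝ) (σ τ r s : ℝ) : Set (ℕ × ℕ) :=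
  {p : ℕ × ℕ | 1 ≤ p.1 ∧ 1 ≤ p.2 ∧ ((p.1 : ℝ) + σ) * s / r ≤ L ∧
    (p.2 : ℝ) + τ ≤ r * s * f (((p.1 : ℝ) + σ) * s / r)}

lemma le_mul_mul_iff {r s y z : ℝ} (hr : 0 < r) (hs : 0 < s) :
    y ≤ r * s * z ↔ y * s⁻¹ / r ≤ z := by
  rw [div_le_iff₀ hr, ← div_eq_mul_inv, div_le_iff₀ hs]
  ring_nf

lemma IsDecreasingCurve.mem_latticeSet_swap {L : ℝ} {f g : ℝ → ℝ} (hΓ : IsDecreasingCurve L f g)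
    {σ τ r s : ℝ} (hσ : -1 / 2 < σ) (hτ : -1 / 2 < τ) (hr : 0 < r) (hs : 0 < s) (j k : ℕ) :
    (j, k) ∈ latticeSet L f σ τ r s ↔ (k, j) ∈ latticeSet L g τ σ r s⁻¹ := by
  simp only [latticeSet, mem_ofPred_eq]
  rw [le_mul_mul_iff hr hs, le_mul_mul_iff hr (inv_pos.2 hs), inv_inv]
  by_cases hj : 1 ≤ j
  · by_cases hk : 1 ≤ k
    · have hj' : (1 : ℝ) ≤ j := by exact_mod_cast hj
      have hk' : (1 : ℝ) ≤ k := by exact_mod_cast hk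
      have hx : 0 ≤ ((j : ℝ) + σ) * s / r := by
        have : 0 ≤ (j : ℝ) + σ := by linarith
        positivity
      have hy : 0 ≤ ((k : ℝ) + τ) * s⁻¹ / r := by
        have : 0 ≤ (k : ℝ) + τ := by linarith
        positivity
      have := hΓ.under_iff hx hy
      tauto
    · tauto
  · tauto

lemma IsDecreasingCurve.count_symm {L : ℝ} {f g : ℝ → ℝ} (hΓ : IsDecreasingCurve L f g)
    {σ τ r s : ℝ} (hσ : -1 / 2 < σ) (hτ : -1 / 2 < τ) (hr : 0 < r) (hs : 0 < s) :
    count L f σ τ r s = count L g τ σ r s⁻¹ := by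
  change (latticeSet L f σ τ r s).ncard = (latticeSet L g τ σ r s⁻¹).ncard
  rw [← Set.ncard_image_of_injective _ Prod.swap_injective]
  congr 1
  ext ⟨k, j⟩
  rw [Set.mem_image]
  constructor
  · rintro ⟨⟨a, b⟩, hab, h⟩
    simp only [Prod.swap_prod_mk, Prod.mk.injEq] at h
    obtain ⟨rfl, rfl⟩ := h
    exact (hΓ.mem_latticeSet_swap hσ hτ hr hs _ _).1 hab
  · intro h
    exact ⟨(j, k), (hΓ.mem_latticeSet_swap hσ hτ hr hs _ _).2 h, rfl⟩

/-- The lattice points in the columns with abscissa in `(u, v]`. -/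
def columnSet (f : ℝ → ℝ) (σ τ r s u v : ℝ) : Set (ℕ × ℕ) :=
  {p : ℕ × ℕ | 1 ≤ p.1 ∧ 1 ≤ p.2 ∧ u < ((p.1 : ℝ) + σ) * s / r ∧ ((p.1 : ℝ) + σ) * s / r ≤ v ∧
    (p.2 : ℝ) + τ ≤ r * s * f (((p.1 : ℝ) + σ) * s / r)}

/-- The bound on `u` excludes all `j ≤ 0`, so natural and integer indices agree. A column whose top
lies below the first lattice point has a negative integer part, hence the truncation at `0`. -/
lemma columnSet_finite_and_ncard {f : ℝ → ℝ} {σ τ r s u v : ℝ} (hr : 0 < r) (hs : 0 < s)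
    (hu : (σ + 1 / 2) * s / r ≤ u) :
    (columnSet f σ τ r s u v).Finite ∧ ((columnSet f σ τ r s u v).ncard : ℝ) =
      ∑ j ∈ Finset.Ioc ⌊u * r / s - σ⌋ ⌊v * r / s - σ⌋,
        max (⌊r * s * f (((j : ℝ) + σ) * s / r) - τ⌋ : ℝ) 0 := by
  set F : ℤ → ℤ := fun j => ⌊r * s * f (((j : ℝ) + σ) * s / r) - τ⌋ with hF
  set T : Finset (Σ _ : ℤ, ℤ) :=
    (Finset.Ioc ⌊u * r / s - σ⌋ ⌊v * r / s - σ⌋).sigma (fun j => Finset.Icc 1 (F j)) with hT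
  let e : ℕ × ℕ → (Σ _ : ℤ, ℤ) := fun p => ⟨p.1, p.2⟩
  have he : Function.Injective e := by
    rintro ⟨a, b⟩ ⟨c, d⟩ h
    simp only [e, Sigma.mk.injEq, Nat.cast_inj, heq_eq_eq] at h
    exact Prod.ext h.1 h.2
  have hu0 : 0 ≤ ⌊u * r / s - σ⌋ := by
    rw [Int.floor_nonneg]
    have : (σ + 1 / 2) ≤ u * r / s := by
      rw [div_le_iff₀ hr] at hu
      rwa [le_div_iff₀ hs]
    linarith
  have himg : e '' columnSet f σ τ r s u v = ↑T := by
    ext ⟨j, k⟩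
    rw [Set.mem_image, Finset.mem_coe, hT, Finset.mem_sigma, mem_Ioc_floor_scaled hr hs,
      Finset.mem_Icc, hF, Int.le_floor, le_sub_iff_add_le]
    constructor
    · rintro ⟨⟨a, b⟩, ⟨h1, h2, h3, h4, h5⟩, h⟩
      simp only [e, Sigma.mk.injEq, heq_eq_eq] at h
      obtain ⟨rfl, rfl⟩ := h
      refine ⟨⟨?_, ?_⟩, ?_, ?_⟩
      · simpa using h3
      · simpa using h4
      · simp only; omega
      · simpa using h5
    · rintro ⟨⟨h3, h4⟩, h2, h5⟩
      simp only at h2 h3 h4 h5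
      have hj : j ∈ Finset.Ioc ⌊u * r / s - σ⌋ ⌊v * r / s - σ⌋ :=
        (mem_Ioc_floor_scaled hr hs).2 ⟨h3, h4⟩
      rw [Finset.mem_Ioc] at hj
      lift j to ℕ using by omega
      lift k to ℕ using by omega
      refine ⟨(j, k), ⟨by simp only; omega, by simp only; omega, by simpa using h3, by simpa using h4,
        by simpa using h5⟩, rfl⟩
  have hfin : (columnSet f σ τ r s u v).Finite :=
    Set.Finite.of_finite_image (by rw [himg]; exact T.finite_toSet) he.injOn
  refine ⟨hfin, ?_⟩
  rw [← Set.ncard_image_of_injective _ he, himg, Set.ncard_coe_finset, hT, Finset.card_sigma]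
  push_cast
  refine Finset.sum_congr rfl fun j _ => ?_
  rw [Int.card_Icc, ← Int.cast_natCast, Int.toNat_eq_max]
  push_cast
  simp [hF]

lemma sawtooth_half : sawtooth (1 / 2) = 0 := by
  have : Int.fract (1 / 2 : ℝ) = 1 / 2 := Int.fract_eq_self.2 ⟨by norm_num, by norm_num⟩
  unfold sawtooth
  rw [this, sub_self]

/-- A rectangle holds a product of two integer parts. Its sawtooth terms have precisely the form of
the boundary terms that Euler–Maclaurin produces at the cut, and will cancel them. -/
lemma columnSum_const_sub_le {σ τ r s α β : ℝ} (hr : 0 < r) (hs : 0 < s)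
    (hu : (σ + 1 / 2) * s / r ≤ α) (hβ : τ ≤ r * s * β) :
    |((columnSet (fun _ => β) σ τ r s ((σ + 1 / 2) * s / r) α).ncard : ℝ) -
      ((α * r / s) * (r * s * β) - (σ + 1 / 2 + sawtooth (α * r / s - σ)) * (r * s * β)
        - (τ + 1 / 2 + sawtooth (r * s * β - τ)) * (α * r / s))| ≤ (|σ| + 1) * (|τ| + 1) := by
  rw [(columnSet_finite_and_ncard hr hs le_rfl).2, Finset.sum_const, Int.card_Ioc, nsmul_eq_mul]
  have e1 : (σ + 1 / 2) * s / r * r / s - σ = 1 / 2 := by field_simp; ring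
  have e2 : ⌊(1 / 2 : ℝ)⌋ = 0 := by rw [Int.floor_eq_zero_iff]; constructor <;> norm_num
  rw [e1, e2, sub_zero]
  have h0 : 0 ≤ ⌊α * r / s - σ⌋ := by
    rw [Int.floor_nonneg]
    have : σ + 1 / 2 ≤ α * r / s := by
      rw [div_le_iff₀ hr] at hu
      rwa [le_div_iff₀ hs]
    linarith
  have h1 : (0 : ℝ) ≤ ⌊r * s * β - τ⌋ := by
    exact_mod_cast Int.floor_nonneg.2 (sub_nonneg.2 hβ)
  rw [max_eq_left h1, ← Int.cast_natCast, Int.toNat_of_nonneg h0]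
  have f1 := Int.fract_add_floor (α * r / s - σ)
  have f2 := Int.fract_add_floor (r * s * β - τ)
  have g1 : (⌊α * r / s - σ⌋ : ℝ) = α * r / s - (σ + 1 / 2 + sawtooth (α * r / s - σ)) := by
    unfold sawtooth; linarith
  have g2 : (⌊r * s * β - τ⌋ : ℝ) = r * s * β - (τ + 1 / 2 + sawtooth (r * s * β - τ)) := by
    unfold sawtooth; linarith
  rw [g1, g2]
  have b1 : ∀ y z : ℝ, |y + 1 / 2 + sawtooth z| ≤ |y| + 1 := by
    intro y z
    have := abs_add_le (y + 1 / 2) (sawtooth z)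
    have := abs_add_le y (1 / 2)
    have := abs_sawtooth_le z
    rw [abs_of_pos (by norm_num : (0 : ℝ) < 1 / 2)] at *
    linarith
  calc _ = |(σ + 1 / 2 + sawtooth (α * r / s - σ)) * (τ + 1 / 2 + sawtooth (r * s * β - τ))| := by
        congr 1; ring
    _ ≤ _ := by
        rw [abs_mul]
        gcongr
        · exact b1 _ _
        · exact b1 _ _

/-! ### Asymptotics of column counts -/

section ColumnEstimates

variable {L : ℝ} {f g : ℝ → ℝ} {σ τ E α : ℝ}

-- The heights here are at least `r s f α`, which eventually exceeds `τ`, so no truncation occurs.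
-- The strip between `0` and the starting abscissa has area `L (σ + 1/2) s / r` up to `O(r ^ (-2))`,
-- which produces the term `(σ + 1/2) r s L`.
set_option maxHeartbeats 1000000 in
lemma IsDecreasingCurve.columnSet_estimate_of_concaveOn (hΓ : IsDecreasingCurve L f g)
    (hf : ConcaveOn ℝ (Icc 0 L) f) (hσ : -1 / 2 < σ) (hE : E ≤ 1 / 6)
    (hα : 0 < α) (hαL : α < L) (hB : BranchBound f σ τ E 0 α) {K : ℝ} (hK : 1 ≤ K) :
    ∃ C : ℝ, ∀ᶠ r : ℝ in atTop, ∀ s, K⁻¹ ≤ s → s ≤ K →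
      |((columnSet f σ τ r s ((σ + 1 / 2) * s / r) α).ncard : ℝ) -
        (r ^ 2 * (∫ x in (0 : ℝ)..α, f x) - (σ + 1 / 2) * (r * s * L)
          - sawtooth (α * r / s - σ) * (r * s * f α) - (τ + 1 / 2) * (α * r / s))| ≤
        C * r ^ (1 - 2 * E) := by
  obtain ⟨C, hC⟩ := hB K hK
  have hK0 : 0 < K := by linarith
  set D := L / (L - α) with hDdef
  have hD0 : 0 ≤ D := div_nonneg hΓ.pos.le (by linarith)
  have hD := hΓ.abs_sub_le_of_concaveOn hf hαL
  have hαmem : α ∈ Icc 0 L := ⟨hα.le, hαL.le⟩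
  have hβ : 0 < f α := by
    have := hΓ.strictAntiOn hαmem ⟨hΓ.pos.le, le_rfl⟩ hαL
    rwa [hΓ.map_intercept] at this
  have hσ' : 0 < σ + 1 / 2 := by linarith
  refine ⟨4 * (K ^ 2 * D) + |τ + 1 / 2| + C + D * (σ + 1 / 2) ^ 2 * K ^ 2
    + |τ + 1 / 2| * (σ + 1 / 2), ?_⟩
  filter_upwards [hC, eventually_ge_atTop 1, eventually_ge_atTop ((σ + 1 / 2) * K / α),
    eventually_ge_atTop (|τ| * K / f α)] with r hr hr1 hr2 hr3 s hsK hsK'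
  have hr0 : 0 < r := by linarith
  have hs : 0 < s := lt_of_lt_of_le (by positivity) hsK
  have hKs : 1 ≤ s * K := by
    have := mul_le_mul_of_nonneg_right hsK hK0.le
    rwa [inv_mul_cancel₀ hK0.ne'] at this
  have hs2 : s ^ 2 ≤ K ^ 2 := by gcongr
  set R := r ^ (1 - 2 * E) with hR
  have hR1 : 1 ≤ R := Real.one_le_rpow hr1 (by linarith)
  set u := (σ + 1 / 2) * s / r with hu
  have hu0 : 0 < u := by positivity
  have huα : u ≤ α := by
    rw [hu, div_le_iff₀ hr0]
    rw [div_le_iff₀ hα] at hr2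
    have h1 : (σ + 1 / 2) * s ≤ (σ + 1 / 2) * K := by gcongr
    linarith
  have hτ : τ ≤ r * s * f α := by
    rw [div_le_iff₀ hβ] at hr3
    have h1 : |τ| * 1 ≤ |τ| * (s * K) := by gcongr
    have h2 : s * (|τ| * K) ≤ s * (r * f α) := by gcongr
    linarith [le_abs_self τ]
  have hcol : ((columnSet f σ τ r s u α).ncard : ℝ) = columnSum f σ τ r s u α := by
    rw [(columnSet_finite_and_ncard hr0 hs le_rfl).2]
    refine Finset.sum_congr rfl fun j hj => max_eq_left ?_
    rw [mem_Ioc_floor_scaled hr0 hs] at hj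
    have h1 : f α ≤ f (((j : ℝ) + σ) * s / r) :=
      hΓ.strictAntiOn.antitoneOn ⟨by linarith [hj.1], hj.2.trans hαL.le⟩ hαmem hj.2
    have h2 : r * s * f α ≤ r * s * f (((j : ℝ) + σ) * s / r) := by gcongr
    exact_mod_cast Int.floor_nonneg.2 (by linarith)
  have hsub : Icc u α ⊆ Icc 0 α := Icc_subset_Icc hu0.le le_rfl
  have hest := columnSum_estimate (σ := σ) (τ := τ) hr0 hs huα
    (Or.inr (hf.subset (hsub.trans (Icc_subset_Icc le_rfl hαL.le)) (convex_Icc _ _)))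
    (fun x hx y hy => hD x (hsub hx) y (hsub hy)) hD0
  -- The starting abscissa corresponds to the index `1/2`, where the sawtooth vanishes, so the left
  -- boundary term disappears.
  have e1 : u * r / s - σ = 1 / 2 := by rw [hu]; field_simp; ring
  rw [e1, sawtooth_half, zero_mul, add_zero] at hest
  have hΨ := hr s hsK hsK' u α hu0.le huα le_rfl
  have hsplit := hΓ.integral_add_integral le_rfl hu0.le huα hαL.le
  have hsub0 : Icc 0 u ⊆ Icc 0 L := Icc_subset_Icc le_rfl (huα.trans hαL.le)
  have i1 := le_integral_of_linear_le (A := L) (B := -D) hu0.le (hΓ.continuousOn.mono hsub0)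
    (fun x hx => by
      have := abs_le.1 (hD x ⟨hx.1, hx.2.trans huα⟩ 0 ⟨le_rfl, hα.le⟩)
      rw [hΓ.map_zero, sub_zero, abs_of_nonneg hx.1] at this
      linarith [this.1])
  have i2 := integral_le_of_le_linear (A := L) (B := 0) hu0.le (hΓ.continuousOn.mono hsub0)
    (fun x hx => by linarith [(hΓ.mapsTo (hsub0 hx)).2])
  have j1 : r ^ 2 * (∫ x in (0 : ℝ)..u, f x) ≤ (σ + 1 / 2) * (r * s * L) := by
    calc r ^ 2 * (∫ x in (0 : ℝ)..u, f x) ≤ r ^ 2 * (L * (u - 0) + 0 * (u - 0) ^ 2 / 2) := by gcongr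
      _ = _ := by rw [hu]; field_simp; ring
  have j2 : (σ + 1 / 2) * (r * s * L) - D * (σ + 1 / 2) ^ 2 * s ^ 2 ≤
      r ^ 2 * (∫ x in (0 : ℝ)..u, f x) := by
    calc _ ≤ (σ + 1 / 2) * (r * s * L) - D * (σ + 1 / 2) ^ 2 * s ^ 2 / 2 := by
          have : 0 ≤ D * (σ + 1 / 2) ^ 2 * s ^ 2 := by positivity
          linarith
      _ = r ^ 2 * (L * (u - 0) + -D * (u - 0) ^ 2 / 2) := by rw [hu]; field_simp; ring
      _ ≤ _ := by gcongr
  have e2 : (τ + 1 / 2) * ((α - u) * r / s) = (τ + 1 / 2) * (α * r / s) - (τ + 1 / 2) * (σ + 1 / 2) := by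
    rw [hu]; field_simp
  have j3 : |(τ + 1 / 2) * (σ + 1 / 2)| = |τ + 1 / 2| * (σ + 1 / 2) := by
    rw [abs_mul, abs_of_pos hσ']
  have j4 := abs_le.1 j3.le
  have j5 : D * (σ + 1 / 2) ^ 2 * s ^ 2 ≤ D * (σ + 1 / 2) ^ 2 * K ^ 2 := by gcongr
  have j6 : 4 * (s ^ 2 * D) ≤ 4 * (K ^ 2 * D) := by gcongr
  rw [hcol]
  have hbound : |columnSum f σ τ r s u α -
        (r ^ 2 * (∫ x in (0 : ℝ)..α, f x) - (σ + 1 / 2) * (r * s * L)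
          - sawtooth (α * r / s - σ) * (r * s * f α) - (τ + 1 / 2) * (α * r / s))| ≤
      4 * (K ^ 2 * D) + |τ + 1 / 2| + C * R + D * (σ + 1 / 2) ^ 2 * K ^ 2
        + |τ + 1 / 2| * (σ + 1 / 2) := by
    rw [e2] at hest
    have hest' := abs_le.1 hest
    rw [← hsplit, mul_add, abs_le]
    constructor <;> linarith [hest'.1, hest'.2, j4.1, j4.2]
  refine hbound.trans ?_
  have q1 : 0 ≤ 4 * (K ^ 2 * D) + |τ + 1 / 2| + D * (σ + 1 / 2) ^ 2 * K ^ 2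
        + |τ + 1 / 2| * (σ + 1 / 2) := by positivity
  have q2 := le_mul_of_one_le_right q1 hR1
  linarith

-- Near `x = L` the heights tend to `0`, so columns lower than `τ` must be truncated. Each costs at
-- most `|τ| + 1`. The behaviour of `g` near `0` shows that they occupy a length `O(r ^ (-2 b₃))`,
-- hence number `O(r ^ (1-2E))`.
set_option maxHeartbeats 1000000 in
lemma IsDecreasingCurve.columnSet_estimate_of_convexOn {b₃ : ℝ} (hΓ : IsDecreasingCurve L f g)
    (hf : ConvexOn ℝ (Icc 0 L) f) (hE : E ≤ 1 / 6)
    (hα : 0 < α) (hαL : α < L) (hB : BranchBound f σ τ E α L) (hEb : E ≤ b₃)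
    (hg : (fun y => g y - L) =O[𝓝[>] 0] (fun y : ℝ => y ^ (2 * b₃))) {K : ℝ} (hK : 1 ≤ K) :
    ∃ C : ℝ, ∀ᶠ r : ℝ in atTop, ∀ s, K⁻¹ ≤ s → s ≤ K →
      |((columnSet f σ τ r s α L).ncard : ℝ) -
        (r ^ 2 * (∫ x in α..L, f x) + sawtooth (α * r / s - σ) * (r * s * f α)
          - (τ + 1 / 2) * ((L - α) * r / s))| ≤ C * r ^ (1 - 2 * E) := by
  obtain ⟨C, hC⟩ := hB K hK
  obtain ⟨C₁, hC₁, hg₁⟩ := hg.exists_pos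
  have hK0 : 0 < K := by linarith
  have hL := hΓ.pos
  set D := L / α with hDdef
  have hD0 : 0 ≤ D := by positivity
  have hD := hΓ.abs_sub_le_of_convexOn hf hα
  set T := |τ| + 1 with hT
  have hT0 : 0 < T := by positivity
  have hlim : Tendsto (fun r : ℝ => T * K / r) atTop (𝓝[>] 0) := by
    rw [tendsto_nhdsWithin_iff]
    refine ⟨tendsto_const_nhds.div_atTop tendsto_id, ?_⟩
    filter_upwards [eventually_gt_atTop 0] with r hr
    exact div_pos (by positivity) hr
  have hLmem : L ∈ Icc 0 L := ⟨hL.le, le_rfl⟩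
  refine ⟨4 * (K ^ 2 * D) + |τ + 1 / 2| + C + T * (C₁ * (T * K) ^ (2 * b₃) * K + 1), ?_⟩
  filter_upwards [hC, eventually_ge_atTop 1, hlim.eventually hg₁.bound,
    eventually_ge_atTop (T * K / L), eventually_ge_atTop ((|σ| + 1 / 2) * K / α)]
    with r hr hr1 hr2 hr3 hr4 s hsK hsK'
  have hr0 : 0 < r := by linarith
  have hs : 0 < s := lt_of_lt_of_le (by positivity) hsK
  have hKs : 1 ≤ s * K := by
    have := mul_le_mul_of_nonneg_right hsK hK0.le
    rwa [inv_mul_cancel₀ hK0.ne'] at this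
  have hsinv : s⁻¹ ≤ K := inv_le_of_inv_le₀ hK0 hsK
  set R := r ^ (1 - 2 * E) with hR
  have hR1 : 1 ≤ R := Real.one_le_rpow hr1 (by linarith)
  have hu : (σ + 1 / 2) * s / r ≤ α := by
    rw [div_le_iff₀ hr0]
    rw [div_le_iff₀ hα] at hr4
    calc (σ + 1 / 2) * s ≤ (|σ| + 1 / 2) * K := by
          have := le_abs_self σ
          calc (σ + 1 / 2) * s ≤ (|σ| + 1 / 2) * s := by gcongr
            _ ≤ _ := by gcongr
      _ ≤ r * α := hr4
      _ = α * r := mul_comm _ _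
  -- Where `f x ≥ y₀` the scaled height is at least `T s K ≥ T > τ`, so truncation can only happen
  -- to the right of `w = g y₀`.
  set y₀ := T * K / r with hy₀
  have hy₀pos : 0 < y₀ := by positivity
  have hy₀mem : y₀ ∈ Icc 0 L := by
    refine ⟨hy₀pos.le, ?_⟩
    rw [hy₀, div_le_iff₀ hr0]
    rw [div_le_iff₀ hL] at hr3
    linarith
  set w := g y₀ with hw
  have hwmem : w ∈ Icc 0 L := hΓ.mapsTo_inverse hy₀mem
  have hLw : L - w ≤ C₁ * (T * K) ^ (2 * b₃) * r ^ (-2 * E) := by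
    rw [Real.norm_eq_abs, Real.norm_eq_abs, abs_of_nonpos (by linarith [hwmem.2]),
      abs_of_pos (Real.rpow_pos_of_pos hy₀pos _)] at hr2
    have e1 : y₀ ^ (2 * b₃) = (T * K) ^ (2 * b₃) * r ^ (-2 * b₃) := by
      rw [hy₀, Real.div_rpow (by positivity) hr0.le, div_eq_mul_inv, ← Real.rpow_neg hr0.le]
      congr 2; ring
    have e2 : r ^ (-2 * b₃) ≤ r ^ (-2 * E) := Real.rpow_le_rpow_of_exponent_le hr1 (by linarith)
    rw [e1] at hr2
    have e3 : C₁ * ((T * K) ^ (2 * b₃) * r ^ (-2 * b₃)) ≤ C₁ * ((T * K) ^ (2 * b₃) * r ^ (-2 * E)) := by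
      gcongr
    linarith
  have hest := columnSum_estimate (σ := σ) (τ := τ) hr0 hs hαL.le
    (Or.inl (hf.subset (Icc_subset_Icc hα.le le_rfl) (convex_Icc _ _))) hD hD0
  rw [hΓ.map_intercept, mul_zero, mul_zero, sub_zero] at hest
  have hΨ := hr s hsK hsK' α L le_rfl hαL.le le_rfl
  have hclip : 0 ≤ ((columnSet f σ τ r s α L).ncard : ℝ) - columnSum f σ τ r s α L ∧
      ((columnSet f σ τ r s α L).ncard : ℝ) - columnSum f σ τ r s α L ≤
        T * ((L - w) * r / s + 1) := by
    rw [(columnSet_finite_and_ncard hr0 hs hu).2]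
    unfold columnSum
    rw [← Finset.sum_sub_distrib]
    constructor
    · exact Finset.sum_nonneg fun j _ => sub_nonneg.2 (le_max_left _ _)
    set W := Finset.Ioc ⌊w * r / s - σ⌋ ⌊L * r / s - σ⌋ with hW
    have hterm : ∀ j ∈ Finset.Ioc ⌊α * r / s - σ⌋ ⌊L * r / s - σ⌋,
        max (⌊r * s * f (((j : ℝ) + σ) * s / r) - τ⌋ : ℝ) 0 - ⌊r * s * f (((j : ℝ) + σ) * s / r) - τ⌋
          ≤ if j ∈ W then T else 0 := by
      intro j hj
      rw [mem_Ioc_floor_scaled hr0 hs] at hj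
      set x := ((j : ℝ) + σ) * s / r with hx
      have hxmem : x ∈ Icc 0 L := ⟨by linarith [hj.1], hj.2⟩
      have hfx := (hΓ.mapsTo hxmem).1
      have hfl := Int.lt_floor_add_one (r * s * f x - τ)
      have hrsf : 0 ≤ r * s * f x := by positivity
      rcases le_or_gt 0 ⌊r * s * f x - τ⌋ with h | h
      · have h' : (0 : ℝ) ≤ ⌊r * s * f x - τ⌋ := by exact_mod_cast h
        rw [max_eq_left h', sub_self]
        split_ifs
        · exact hT0.le
        · exact le_rfl
      · have h' : (⌊r * s * f x - τ⌋ : ℝ) < 0 := by exact_mod_cast h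
        have hneg : r * s * f x < τ := by
          by_contra hcon
          push Not at hcon
          exact absurd (Int.floor_nonneg.2 (sub_nonneg.2 hcon)) (not_le.2 h)
        have hjW : j ∈ W := by
          rw [hW, mem_Ioc_floor_scaled hr0 hs]
          refine ⟨?_, hj.2⟩
          by_contra hcon
          push Not at hcon
          have h1 := (hΓ.le_iff hxmem hy₀mem).2 hcon
          have h2 : r * s * y₀ ≤ r * s * f x := by gcongr
          have h3 : r * s * y₀ = T * (s * K) := by rw [hy₀]; field_simp
          rw [h3] at h2
          have h4 : T * 1 ≤ T * (s * K) := by gcongr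
          linarith [le_abs_self τ]
        rw [if_pos hjW, max_eq_right h'.le]
        linarith [le_abs_self τ]
    refine (Finset.sum_le_sum hterm).trans ?_
    rw [← Finset.sum_filter, Finset.sum_const, nsmul_eq_mul, mul_comm]
    have hcard : ((Finset.filter (fun j => j ∈ W)
        (Finset.Ioc ⌊α * r / s - σ⌋ ⌊L * r / s - σ⌋)).card : ℝ) ≤ (L - w) * r / s + 1 := by
      refine le_trans ?_ (card_Ioc_floor_scaled_le (σ := σ) hr0 hs hwmem.2)
      rw [← Int.card_Ioc]
      refine Nat.cast_le.2 (Finset.card_le_card fun j hj => ?_)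
      exact (Finset.mem_filter.1 hj).2
    gcongr
  have hrR : r * r ^ (-2 * E) = R := by
    rw [hR]; nth_rewrite 1 [← Real.rpow_one r]; rw [← Real.rpow_add hr0]; congr 1; ring
  have hlen : (L - w) * r / s ≤ C₁ * (T * K) ^ (2 * b₃) * K * R := by
    have hp : 0 ≤ C₁ * (T * K) ^ (2 * b₃) := by positivity
    calc (L - w) * r / s = (L - w) * (r * s⁻¹) := by ring
      _ ≤ (C₁ * (T * K) ^ (2 * b₃) * r ^ (-2 * E)) * (r * s⁻¹) := by gcongr
      _ = C₁ * (T * K) ^ (2 * b₃) * s⁻¹ * (r * r ^ (-2 * E)) := by ring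
      _ ≤ C₁ * (T * K) ^ (2 * b₃) * K * (r * r ^ (-2 * E)) := by gcongr
      _ = _ := by rw [hrR]
  have hlenT : T * ((L - w) * r / s + 1) ≤ T * (C₁ * (T * K) ^ (2 * b₃) * K + 1) * R := by
    rw [mul_assoc]
    gcongr
    linarith
  have j6 : 4 * (s ^ 2 * D) ≤ 4 * (K ^ 2 * D) := by gcongr
  have hest' := abs_le.1 hest
  have q1 : 4 * (K ^ 2 * D) + |τ + 1 / 2| ≤ (4 * (K ^ 2 * D) + |τ + 1 / 2|) * R :=
    le_mul_of_one_le_right (by positivity) hR1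
  rw [abs_le]
  constructor <;> linarith [hest'.1, hest'.2, hclip.1, hclip.2,
    (by positivity : 0 ≤ T * (C₁ * (T * K) ^ (2 * b₃) * K + 1) * R)]

end ColumnEstimates

/-! ### Assembling the two-term asymptotics -/

/-- The two-term asymptotic approximation to `count`. -/
noncomputable def mainTerm (L : ℝ) (f : ℝ → ℝ) (σ τ r s : ℝ) : ℝ :=
  r ^ 2 * area L f - r * L * ((σ + 1 / 2) * s + (τ + 1 / 2) / s)

/-- The two-term asymptotics for the lattice count, locally uniform in the stretch factor. -/
def CountEstimate (L : ℝ) (f : ℝ → ℝ) (σ τ E : ℝ) : Prop :=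
  ∀ K : ℝ, 1 ≤ K → ∃ C : ℝ, ∀ᶠ r : ℝ in atTop, ∀ s, K⁻¹ ≤ s → s ≤ K →
    |(count L f σ τ r s : ℝ) - mainTerm L f σ τ r s| ≤ C * r ^ (1 - 2 * E)

section Decomposition

variable {L : ℝ} {f g : ℝ → ℝ} {σ τ r s α : ℝ}

lemma mem_columnSet_iff_of_le {v : ℝ} (hr : 0 < r) (hs : 0 < s) (hv : v ≤ L) {j k : ℕ} :
    (j, k) ∈ columnSet f σ τ r s ((σ + 1 / 2) * s / r) v ↔
      (j, k) ∈ latticeSet L f σ τ r s ∧ ((j : ℝ) + σ) * s / r ≤ v := by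
  simp only [columnSet, latticeSet, mem_ofPred_eq]
  constructor
  · rintro ⟨h1, h2, h3, h4, h5⟩
    exact ⟨⟨h1, h2, h4.trans hv, h5⟩, h4⟩
  · rintro ⟨⟨h1, h2, h3, h5⟩, h4⟩
    refine ⟨h1, h2, ?_, h4, h5⟩
    have : (1 : ℝ) ≤ j := by exact_mod_cast h1
    exact div_lt_div_of_pos_right (mul_lt_mul_of_pos_right (by linarith) hs) hr

lemma mem_columnSet_iff_of_gt {j k : ℕ} :
    (j, k) ∈ columnSet f σ τ r s α L ↔
      (j, k) ∈ latticeSet L f σ τ r s ∧ α < ((j : ℝ) + σ) * s / r := by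
  simp only [columnSet, latticeSet, mem_ofPred_eq]
  tauto

lemma mem_columnSet_const_iff {β : ℝ} (hr : 0 < r) (hs : 0 < s) {j k : ℕ} :
    (j, k) ∈ columnSet (fun _ => β) σ τ r s ((σ + 1 / 2) * s / r) α ↔
      1 ≤ j ∧ 1 ≤ k ∧ ((j : ℝ) + σ) * s / r ≤ α ∧ ((k : ℝ) + τ) * s⁻¹ / r ≤ β := by
  simp only [columnSet, mem_ofPred_eq, le_mul_mul_iff hr hs]
  constructor
  · tauto
  · rintro ⟨h1, h2, h3, h4⟩
    refine ⟨h1, h2, ?_, h3, h4⟩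
    have : (1 : ℝ) ≤ j := by exact_mod_cast h1
    exact div_lt_div_of_pos_right (mul_lt_mul_of_pos_right (by linarith) hs) hr

lemma mem_image_swap {S : Set (ℕ × ℕ)} {j k : ℕ} : (j, k) ∈ Prod.swap '' S ↔ (k, j) ∈ S := by
  rw [Set.mem_image]
  constructor
  · rintro ⟨⟨a, b⟩, hab, h⟩
    simp only [Prod.swap_prod_mk, Prod.mk.injEq] at h
    obtain ⟨rfl, rfl⟩ := h
    exact hab
  · exact fun h => ⟨(k, j), h, rfl⟩

lemma mem_latticeSet_iff (hr : 0 < r) (hs : 0 < s) {j k : ℕ} :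
    (j, k) ∈ latticeSet L f σ τ r s ↔ 1 ≤ j ∧ 1 ≤ k ∧ ((j : ℝ) + σ) * s / r ≤ L ∧
      ((k : ℝ) + τ) * s⁻¹ / r ≤ f (((j : ℝ) + σ) * s / r) := by
  simp only [latticeSet, mem_ofPred_eq, le_mul_mul_iff hr hs]

lemma abscissa_nonneg (hσ : -1 / 2 < σ) (hr : 0 < r) (hs : 0 < s) {j : ℕ} (hj : 1 ≤ j) :
    0 ≤ ((j : ℝ) + σ) * s / r := by
  have : (1 : ℝ) ≤ j := by exact_mod_cast hj
  have : 0 ≤ (j : ℝ) + σ := by linarith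
  positivity

/-- Inclusion–exclusion: a point under the curve has abscissa at most `α` or ordinate at most `f α`,
and both hold exactly in the rectangle. -/
lemma IsDecreasingCurve.count_add_eq (hΓ : IsDecreasingCurve L f g) (hσ : -1 / 2 < σ)
    (hτ : -1 / 2 < τ) (hr : 0 < r) (hs : 0 < s) (hα : 0 < α) (hαL : α < L) :
    count L f σ τ r s + (columnSet (fun _ => f α) σ τ r s ((σ + 1 / 2) * s / r) α).ncard =
      (columnSet f σ τ r s ((σ + 1 / 2) * s / r) α).ncard +
      (columnSet g τ σ r s⁻¹ ((τ + 1 / 2) * s⁻¹ / r) (f α)).ncard := by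
  have hs' := inv_pos.2 hs
  have hαmem : α ∈ Icc 0 L := ⟨hα.le, hαL.le⟩
  have hβL : f α ≤ L := (hΓ.mapsTo hαmem).2
  have hP := (columnSet_finite_and_ncard (f := f) (σ := σ) (τ := τ) (v := α) hr hs le_rfl).1
  have hQ := (columnSet_finite_and_ncard (f := g) (σ := τ) (τ := σ) (v := f α) hr hs' le_rfl).1
  rw [← Set.ncard_image_of_injective (columnSet g τ σ r s⁻¹ ((τ + 1 / 2) * s⁻¹ / r) (f α))
    Prod.swap_injective, ← Set.ncard_union_add_ncard_inter _ _ hP (hQ.image _)]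
  congr 1
  · change (latticeSet L f σ τ r s).ncard = _
    congr 1
    ext ⟨j, k⟩
    rw [Set.mem_union, mem_image_swap, mem_columnSet_iff_of_le hr hs hαL.le,
      mem_columnSet_iff_of_le hr hs' hβL, ← hΓ.mem_latticeSet_swap hσ hτ hr hs, ← and_or_left]
    refine ⟨fun h => ⟨h, ?_⟩, fun h => h.1⟩
    rw [mem_latticeSet_iff hr hs] at h
    by_contra hcon
    push Not at hcon
    have := hΓ.strictAntiOn hαmem ⟨hα.le.trans hcon.1.le, h.2.2.1⟩ hcon.1
    linarith [h.2.2.2, hcon.2]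
  · congr 1
    ext ⟨j, k⟩
    rw [mem_columnSet_const_iff hr hs, Set.mem_inter_iff, mem_image_swap,
      mem_columnSet_iff_of_le hr hs hαL.le, mem_columnSet_iff_of_le hr hs' hβL,
      ← hΓ.mem_latticeSet_swap hσ hτ hr hs, mem_latticeSet_iff hr hs]
    constructor
    · rintro ⟨h1, h2, h3, h4⟩
      have hx : ((j : ℝ) + σ) * s / r ∈ Icc 0 L :=
        ⟨abscissa_nonneg hσ hr hs h1, h3.trans hαL.le⟩
      have := hΓ.strictAntiOn.antitoneOn hx hαmem h3
      exact ⟨⟨⟨h1, h2, hx.2, h4.trans this⟩, h3⟩, ⟨h1, h2, hx.2, h4.trans this⟩, h4⟩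
    · rintro ⟨⟨⟨h1, h2, h3, h4⟩, h5⟩, _, h6⟩
      exact ⟨h1, h2, h5, h6⟩

/-- A point under the curve cannot lie both to the right of `α` and above `f α`. The columns beyond
`α`, the rows above `f α` and the rectangle are therefore disjoint and exhaust the set. -/
lemma IsDecreasingCurve.count_eq_add (hΓ : IsDecreasingCurve L f g) (hσ : -1 / 2 < σ)
    (hτ : -1 / 2 < τ) (hr : 0 < r) (hs : 0 < s) (hα : 0 < α) (hαL : α < L)
    (hu : (σ + 1 / 2) * s / r ≤ α) (hv : (τ + 1 / 2) * s⁻¹ / r ≤ f α) :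
    count L f σ τ r s = (columnSet f σ τ r s α L).ncard +
      (columnSet g τ σ r s⁻¹ (f α) L).ncard +
      (columnSet (fun _ => f α) σ τ r s ((σ + 1 / 2) * s / r) α).ncard := by
  have hs' := inv_pos.2 hs
  have hαmem : α ∈ Icc 0 L := ⟨hα.le, hαL.le⟩
  have hP := (columnSet_finite_and_ncard (f := f) (σ := σ) (τ := τ) (v := L) hr hs hu).1
  have hQ := (columnSet_finite_and_ncard (f := g) (σ := τ) (τ := σ) (v := L) hr hs' hv).1
  have hR := (columnSet_finite_and_ncard (f := fun _ => f α) (σ := σ) (τ := τ) (v := α) hr hs le_rfl).1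
  have hbelow : ∀ {j k : ℕ}, (j, k) ∈ latticeSet L f σ τ r s → α < ((j : ℝ) + σ) * s / r →
      ((k : ℝ) + τ) * s⁻¹ / r < f α := by
    intro j k h hx
    rw [mem_latticeSet_iff hr hs] at h
    have := hΓ.strictAntiOn hαmem ⟨hα.le.trans hx.le, h.2.2.1⟩ hx
    linarith [h.2.2.2]
  rw [← Set.ncard_image_of_injective (columnSet g τ σ r s⁻¹ (f α) L) Prod.swap_injective,
    ← Set.ncard_union_eq _ hP (hQ.image _), ← Set.ncard_union_eq _ (hP.union (hQ.image _)) hR]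
  · change (latticeSet L f σ τ r s).ncard = _
    congr 1
    ext ⟨j, k⟩
    rw [Set.mem_union, Set.mem_union, mem_image_swap, mem_columnSet_iff_of_gt,
      mem_columnSet_iff_of_gt, ← hΓ.mem_latticeSet_swap hσ hτ hr hs, mem_columnSet_const_iff hr hs]
    constructor
    · intro h
      have h' := (mem_latticeSet_iff hr hs).1 h
      by_cases hx : α < ((j : ℝ) + σ) * s / r
      · exact Or.inl (Or.inl ⟨h, hx⟩)
      by_cases hy : f α < ((k : ℝ) + τ) * s⁻¹ / r
      · exact Or.inl (Or.inr ⟨h, hy⟩)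
      · exact Or.inr ⟨h'.1, h'.2.1, not_lt.1 hx, not_lt.1 hy⟩
    · rintro ((h | h) | ⟨h1, h2, h3, h4⟩)
      · exact h.1
      · exact h.1
      · rw [mem_latticeSet_iff hr hs]
        have hx : ((j : ℝ) + σ) * s / r ∈ Icc 0 L :=
          ⟨abscissa_nonneg hσ hr hs h1, h3.trans hαL.le⟩
        have := hΓ.strictAntiOn.antitoneOn hx hαmem h3
        exact ⟨h1, h2, hx.2, h4.trans this⟩
  · rw [Set.disjoint_left]
    rintro ⟨j, k⟩ h h'
    rw [Set.mem_union, mem_image_swap, mem_columnSet_iff_of_gt, mem_columnSet_iff_of_gt] at h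
    rw [mem_columnSet_const_iff hr hs] at h'
    rcases h with h | h
    · exact absurd h'.2.2.1 (not_le.2 h.2)
    · exact absurd h'.2.2.2 (not_le.2 h.2)
  · rw [Set.disjoint_left]
    rintro ⟨j, k⟩ h h'
    rw [mem_image_swap, mem_columnSet_iff_of_gt, ← hΓ.mem_latticeSet_swap hσ hτ hr hs] at h'
    rw [mem_columnSet_iff_of_gt] at h
    exact absurd (hbelow h.1 h.2) (not_lt.2 h'.2.le)

end Decomposition

section CountEstimate

variable {L : ℝ} {f g : ℝ → ℝ} {σ τ E α a₁ a₂ a₃ b₁ b₂ b₃ : ℝ}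

lemma eventually_rectangle_conditions {β : ℝ} (hα : 0 < α) (hβ : 0 < β) (σ τ : ℝ) {K : ℝ}
    (hK : 1 ≤ K) :
    ∀ᶠ r : ℝ in atTop, 1 ≤ r ∧ ∀ s, K⁻¹ ≤ s → s ≤ K →
      (σ + 1 / 2) * s / r ≤ α ∧ (τ + 1 / 2) * s⁻¹ / r ≤ β ∧ τ ≤ r * s * β := by
  have hK0 : 0 < K := by linarith
  filter_upwards [eventually_ge_atTop 1, eventually_ge_atTop ((|σ| + 1 / 2) * K / α),
    eventually_ge_atTop ((|τ| + 1 / 2) * K / β)] with r hr1 hr2 hr3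
  have hr0 : 0 < r := by linarith
  refine ⟨hr1, fun s hsK hsK' => ?_⟩
  have hs : 0 < s := lt_of_lt_of_le (by positivity) hsK
  have hsinv : s⁻¹ ≤ K := inv_le_of_inv_le₀ hK0 hsK
  have hs' := inv_pos.2 hs
  rw [div_le_iff₀ hα] at hr2
  rw [div_le_iff₀ hβ] at hr3
  refine ⟨?_, ?_, ?_⟩
  · rw [div_le_iff₀ hr0]
    calc (σ + 1 / 2) * s ≤ (|σ| + 1 / 2) * s := by gcongr; exact le_abs_self σ
      _ ≤ (|σ| + 1 / 2) * K := by gcongr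
      _ ≤ _ := by linarith
  · rw [div_le_iff₀ hr0]
    calc (τ + 1 / 2) * s⁻¹ ≤ (|τ| + 1 / 2) * s⁻¹ := by gcongr; exact le_abs_self τ
      _ ≤ (|τ| + 1 / 2) * K := by gcongr
      _ ≤ _ := by linarith
  · rw [mul_right_comm, ← div_le_iff₀ hs, div_eq_mul_inv]
    calc τ * s⁻¹ ≤ (|τ| + 1 / 2) * s⁻¹ := by gcongr; linarith [le_abs_self τ]
      _ ≤ (|τ| + 1 / 2) * K := by gcongr
      _ ≤ _ := hr3

/-- Columns plus rows minus the rectangle. The sawtooth terms at the cut cancel, the areas combine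
to the full area, and the linear terms in `α` and `f α` drop out. The convex case is the same with
the rectangle added. -/
lemma IsDecreasingCurve.countEstimate_of_concave (hΓ : IsDecreasingCurve L f g)
    (hf : ConcaveOn ℝ (Icc 0 L) f) (hσ : -1 / 2 < σ) (hτ : -1 / 2 < τ) (hE : E ≤ 1 / 6)
    (hα : 0 < α) (hαL : α < L) (hβ : 0 < f α) (hBf : BranchBound f σ τ E 0 α)
    (hBg : BranchBound g τ σ E 0 (f α)) : CountEstimate L f σ τ E := by
  intro K hK
  have hK0 : 0 < K := by linarith
  have hαmem : α ∈ Icc 0 L := ⟨hα.le, hαL.le⟩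
  have hβL : f α < L := by
    have := hΓ.strictAntiOn ⟨le_rfl, hΓ.pos.le⟩ hαmem hα
    rwa [hΓ.map_zero] at this
  obtain ⟨C₁, h1⟩ := hΓ.columnSet_estimate_of_concaveOn hf hσ hE hα hαL hBf hK
  obtain ⟨C₂, h2⟩ := hΓ.symm.columnSet_estimate_of_concaveOn (hΓ.concaveOn_inverse hf) hτ hE hβ hβL
    hBg hK
  refine ⟨C₁ + C₂ + (|σ| + 1) * (|τ| + 1), ?_⟩
  filter_upwards [h1, h2, eventually_rectangle_conditions hα hβ σ τ hK] with r e1 e2 e3 s hsK hsK'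
  obtain ⟨hr1, e3⟩ := e3
  obtain ⟨hu, hv, hy⟩ := e3 s hsK hsK'
  have hr0 : 0 < r := by linarith
  have hs : 0 < s := lt_of_lt_of_le (by positivity) hsK
  have hsinv : s⁻¹ ≤ K := inv_le_of_inv_le₀ hK0 hsK
  have hsinv' : K⁻¹ ≤ s⁻¹ := by gcongr
  have d1 := abs_le.1 (e1 s hsK hsK')
  have d2 := abs_le.1 (e2 s⁻¹ hsinv' hsinv)
  have d3 := abs_le.1 (columnSum_const_sub_le hr0 hs hu hy)
  have hcount := congrArg (Nat.cast : ℕ → ℝ) (hΓ.count_add_eq hσ hτ hr0 hs hα hαL)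
  push_cast at hcount
  have hR1 : 1 ≤ r ^ (1 - 2 * E) := Real.one_le_rpow hr1 (by linarith)
  have q := le_mul_of_one_le_right (by positivity : 0 ≤ (|σ| + 1) * (|τ| + 1)) hR1
  have ey : f α * r / s⁻¹ = r * s * f α := by rw [div_inv_eq_mul]; ring
  have ex : r * s⁻¹ * g (f α) = α * r / s := by rw [hΓ.g_f hαmem]; ring
  rw [ey, ex] at d2
  have harea : area L f = (∫ x in (0 : ℝ)..α, f x) + (∫ y in (0 : ℝ)..(f α), g y) - α * f α := by
    rw [hΓ.area_symm, area, hΓ.integral_eq hαmem,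
      ← hΓ.symm.integral_add_integral le_rfl hβ.le hβL.le le_rfl]
    ring
  have hmain : mainTerm L f σ τ r s = r ^ 2 * (∫ x in (0 : ℝ)..α, f x) +
      r ^ 2 * (∫ y in (0 : ℝ)..(f α), g y) - (α * r / s) * (r * s * f α)
      - (σ + 1 / 2) * (r * s * L) - (τ + 1 / 2) * (r * s⁻¹ * L) := by
    unfold mainTerm
    rw [harea]
    field_simp
    ring
  rw [hmain, abs_le]
  constructor <;> linarith [d1.1, d1.2, d2.1, d2.2, d3.1, d3.2]

lemma IsDecreasingCurve.countEstimate_of_convex (hΓ : IsDecreasingCurve L f g)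
    (hf : ConvexOn ℝ (Icc 0 L) f) (hσ : -1 / 2 < σ) (hτ : -1 / 2 < τ) (hE : E ≤ 1 / 6)
    (hα : 0 < α) (hαL : α < L) (hβ : 0 < f α) (hBf : BranchBound f σ τ E α L)
    (hBg : BranchBound g τ σ E (f α) L) (hEa : E ≤ a₃) (hEb : E ≤ b₃)
    (hf₀ : (fun x => f x - L) =O[𝓝[>] 0] (fun x : ℝ => x ^ (2 * a₃)))
    (hg₀ : (fun y => g y - L) =O[𝓝[>] 0] (fun y : ℝ => y ^ (2 * b₃))) :
    CountEstimate L f σ τ E := by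
  intro K hK
  have hK0 : 0 < K := by linarith
  have hαmem : α ∈ Icc 0 L := ⟨hα.le, hαL.le⟩
  have hβL : f α < L := by
    have := hΓ.strictAntiOn ⟨le_rfl, hΓ.pos.le⟩ hαmem hα
    rwa [hΓ.map_zero] at this
  obtain ⟨C₁, h1⟩ := hΓ.columnSet_estimate_of_convexOn hf hE hα hαL hBf hEb hg₀ hK
  obtain ⟨C₂, h2⟩ := hΓ.symm.columnSet_estimate_of_convexOn (hΓ.convexOn_inverse hf) hE hβ hβL
    hBg hEa hf₀ hK
  refine ⟨C₁ + C₂ + (|σ| + 1) * (|τ| + 1), ?_⟩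
  filter_upwards [h1, h2, eventually_rectangle_conditions hα hβ σ τ hK] with r e1 e2 e3 s hsK hsK'
  obtain ⟨hr1, e3⟩ := e3
  obtain ⟨hu, hv, hy⟩ := e3 s hsK hsK'
  have hr0 : 0 < r := by linarith
  have hs : 0 < s := lt_of_lt_of_le (by positivity) hsK
  have hsinv : s⁻¹ ≤ K := inv_le_of_inv_le₀ hK0 hsK
  have hsinv' : K⁻¹ ≤ s⁻¹ := by gcongr
  have d1 := abs_le.1 (e1 s hsK hsK')
  have d2 := abs_le.1 (e2 s⁻¹ hsinv' hsinv)
  have d3 := abs_le.1 (columnSum_const_sub_le hr0 hs hu hy)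
  have hcount := congrArg (Nat.cast : ℕ → ℝ) (hΓ.count_eq_add hσ hτ hr0 hs hα hαL hu hv)
  push_cast at hcount
  have hR1 : 1 ≤ r ^ (1 - 2 * E) := Real.one_le_rpow hr1 (by linarith)
  have q := le_mul_of_one_le_right (by positivity : 0 ≤ (|σ| + 1) * (|τ| + 1)) hR1
  have ey : f α * r / s⁻¹ = r * s * f α := by rw [div_inv_eq_mul]; ring
  have ex : r * s⁻¹ * g (f α) = α * r / s := by rw [hΓ.g_f hαmem]; ring
  rw [ey, ex] at d2
  have harea : area L f = (∫ x in α..L, f x) + (∫ y in (f α)..L, g y) + α * f α := by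
    rw [area, ← hΓ.integral_add_integral le_rfl hα.le hαL.le le_rfl, hΓ.integral_eq hαmem]
    ring
  have hmain : mainTerm L f σ τ r s = r ^ 2 * (∫ x in α..L, f x) +
      r ^ 2 * (∫ y in (f α)..L, g y) + (α * r / s) * (r * s * f α)
      - (σ + 1 / 2) * (r * s * L) - (τ + 1 / 2) * (r * s⁻¹ * L) := by
    unfold mainTerm
    rw [harea]
    field_simp
    ring
  have k1 : (τ + 1 / 2) * ((L - α) * r / s) =
      (τ + 1 / 2) * (r * s⁻¹ * L) - (τ + 1 / 2) * (α * r / s) := by ring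
  have k2 : (σ + 1 / 2) * ((L - f α) * r / s⁻¹) =
      (σ + 1 / 2) * (r * s * L) - (σ + 1 / 2) * (r * s * f α) := by rw [div_inv_eq_mul]; ring
  rw [k1] at d1
  rw [k2] at d2
  rw [hmain, hcount, abs_le]
  constructor <;> linarith [d1.1, d1.2, d2.1, d2.2, d3.1, d3.2]

lemma rateExponent_bounds (a₁ a₂ a₃ b₁ b₂ b₃ : ℝ) :
    rateExponent a₁ a₂ a₃ b₁ b₂ b₃ ≤ 1 / 6 ∧ rateExponent a₁ a₂ a₃ b₁ b₂ b₃ ≤ a₁ ∧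
    rateExponent a₁ a₂ a₃ b₁ b₂ b₃ ≤ a₂ ∧ rateExponent a₁ a₂ a₃ b₁ b₂ b₃ ≤ a₃ ∧
    rateExponent a₁ a₂ a₃ b₁ b₂ b₃ ≤ b₁ ∧ rateExponent a₁ a₂ a₃ b₁ b₂ b₃ ≤ b₂ ∧
    rateExponent a₁ a₂ a₃ b₁ b₂ b₃ ≤ b₃ := by
  have h : ∀ y, y ≤ rateExponent a₁ a₂ a₃ b₁ b₂ b₃ ↔ y ≤ 1 / 6 ∧ (y ≤ a₁ ∧ y ≤ a₂ ∧ y ≤ a₃) ∧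
      y ≤ b₁ ∧ y ≤ b₂ ∧ y ≤ b₃ := fun y => by simp [rateExponent]
  have := (h _).1 le_rfl
  tauto

lemma rateExponent_pos (ha₁ : 0 < a₁) (ha₂ : 0 < a₂) (ha₃ : 0 < a₃) (hb₁ : 0 < b₁) (hb₂ : 0 < b₂)
    (hb₃ : 0 < b₃) : 0 < rateExponent a₁ a₂ a₃ b₁ b₂ b₃ := by
  simp [rateExponent, *]

lemma WeakerConcaveCondition.countEstimate (h : WeakerConcaveCondition L f g a₁ a₂ a₃ b₁ b₂ b₃)
    (hΓ : IsDecreasingCurve L f g) (hσ : -1 / 2 < σ) (hτ : -1 / 2 < τ) :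
    CountEstimate L f σ τ (rateExponent a₁ a₂ a₃ b₁ b₂ b₃) := by
  obtain ⟨e0, e1, e2, e3, e4, e5, e6⟩ := rateExponent_bounds a₁ a₂ a₃ b₁ b₂ b₃
  obtain ⟨α, β, hα, hαL, hβ, rfl, hf, hg⟩ := h.branches
  have hαL' : α < L := lt_of_le_of_ne hαL (by rintro rfl; exact hβ.ne' hΓ.map_intercept)
  have hβL : f α < L := by
    have := hΓ.strictAntiOn ⟨le_rfl, hΓ.pos.le⟩ ⟨hα.le, hαL⟩ hα
    rwa [hΓ.map_zero] at this
  have hL := hΓ.pos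
  exact hΓ.countEstimate_of_concave h.concave hσ hτ e0 hα hαL' hβ
    (hf.branchBound hα h.a₁_pos e1 e2 e0 (div_nonneg hL.le (by linarith))
      (hΓ.abs_sub_le_of_concaveOn h.concave hαL') σ τ)
    (hg.branchBound hβ h.b₁_pos e4 e5 e0 (div_nonneg hL.le (by linarith))
      (hΓ.symm.abs_sub_le_of_concaveOn (hΓ.concaveOn_inverse h.concave) hβL) τ σ)

lemma WeakerConvexCondition.countEstimate (h : WeakerConvexCondition L f g a₁ a₂ a₃ b₁ b₂ b₃)
    (hΓ : IsDecreasingCurve L f g) (hσ : -1 / 2 < σ) (hτ : -1 / 2 < τ) :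
    CountEstimate L f σ τ (rateExponent a₁ a₂ a₃ b₁ b₂ b₃) := by
  obtain ⟨e0, e1, e2, e3, e4, e5, e6⟩ := rateExponent_bounds a₁ a₂ a₃ b₁ b₂ b₃
  obtain ⟨α, β, hα, hαL, hβ, rfl, hf, hg⟩ := h.branches
  have hαL' : α < L := lt_of_le_of_ne hαL (by rintro rfl; exact hβ.ne' hΓ.map_intercept)
  have hβL : f α < L := by
    have := hΓ.strictAntiOn ⟨le_rfl, hΓ.pos.le⟩ ⟨hα.le, hαL⟩ hα
    rwa [hΓ.map_zero] at this
  have hL := hΓ.pos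
  exact hΓ.countEstimate_of_convex h.convex hσ hτ e0 hα hαL' hβ
    (hf.branchBound hαL' h.a₁_pos e1 e2 e0 (div_nonneg hL.le hα.le)
      (hΓ.abs_sub_le_of_convexOn h.convex hα) σ τ)
    (hg.branchBound hβL h.b₁_pos e4 e5 e0 (div_nonneg hL.le hβ.le)
      (hΓ.symm.abs_sub_le_of_convexOn (hΓ.convexOn_inverse h.convex) hβ) τ σ)
    e3 e6 hf.near_zero hg.near_zero

end CountEstimate

/-! ### Existence of maximizers -/

section Existence

variable {L : ℝ} {f g : ℝ → ℝ} {σ τ r : ℝ}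

/-- Both coordinates of a counted point exceed `1/2`, so the existence of one confines `s` between
`1/(2rL)` and `2rL`. The resulting box is independent of `s`; the counts are then bounded natural
numbers and their supremum is attained. -/
lemma IsDecreasingCurve.latticeSet_subset (hΓ : IsDecreasingCurve L f g) (hσ : -1 / 2 < σ)
    (hτ : -1 / 2 < τ) (hr : 0 < r) {s : ℝ} (hs : 0 < s) :
    latticeSet L f σ τ r s ⊆ ↑(Finset.range (⌊2 * (r * L) ^ 2 + 1⌋₊ + 1) ×ˢ
      Finset.range (⌊2 * (r * L) ^ 2 + 1⌋₊ + 1)) := by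
  rintro ⟨j, k⟩ ⟨h1, h2, h3, h4⟩
  simp only at h1 h2 h3 h4
  have hL := hΓ.pos
  have hj : (1 : ℝ) ≤ j := by exact_mod_cast h1
  have hk : (1 : ℝ) ≤ k := by exact_mod_cast h2
  have hx := abscissa_nonneg hσ hr hs h1
  have hf := (hΓ.mapsTo ⟨hx, h3⟩).2
  have hjs : ((j : ℝ) + σ) * s ≤ r * L := by
    rw [div_le_iff₀ hr] at h3; linarith
  have hks : ((k : ℝ) + τ) ≤ s * (r * L) := by
    calc _ ≤ _ := h4
      _ ≤ r * s * L := by gcongr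
      _ = _ := by ring
  have hs1 : s ≤ 2 * (r * L) := by nlinarith
  have hrL : 0 < r * L := by positivity
  have hprod : ((j : ℝ) + σ) * (1 / 2) ≤ (r * L) ^ 2 := by
    have h5 : (1 / 2 : ℝ) ≤ s * (r * L) := by linarith
    have h6 : ((j : ℝ) + σ) * (1 / 2) ≤ ((j : ℝ) + σ) * (s * (r * L)) := by
      apply mul_le_mul_of_nonneg_left h5; linarith
    nlinarith
  have hkb : (k : ℝ) + τ ≤ 2 * (r * L) ^ 2 := by nlinarith
  rw [Finset.mem_coe, Finset.mem_product, Finset.mem_range, Finset.mem_range, Nat.lt_succ_iff,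
    Nat.lt_succ_iff]
  exact ⟨Nat.le_floor (by simp only; linarith), Nat.le_floor (by simp only; linarith)⟩

lemma IsDecreasingCurve.bddAbove_count (hΓ : IsDecreasingCurve L f g) (hσ : -1 / 2 < σ)
    (hτ : -1 / 2 < τ) (hr : 0 < r) : BddAbove (count L f σ τ r '' Ioi 0) := by
  refine ⟨(↑(Finset.range (⌊2 * (r * L) ^ 2 + 1⌋₊ + 1) ×ˢ
    Finset.range (⌊2 * (r * L) ^ 2 + 1⌋₊ + 1)) : Set (ℕ × ℕ)).ncard, ?_⟩
  rintro _ ⟨s, hs, rfl⟩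
  exact Set.ncard_le_ncard (hΓ.latticeSet_subset hσ hτ hr hs) (Finset.finite_toSet _)

lemma IsDecreasingCurve.maximizers_nonempty (hΓ : IsDecreasingCurve L f g) (hσ : -1 / 2 < σ)
    (hτ : -1 / 2 < τ) (hr : 0 < r) : (maximizers L f σ τ r).Nonempty := by
  have hbdd := hΓ.bddAbove_count hσ hτ hr
  obtain ⟨s, hs, hmax⟩ := Nat.sSup_mem (Set.Nonempty.image _ ⟨1, one_pos⟩) hbdd
  exact ⟨s, hs, fun t ht => hmax ▸ le_csSup hbdd ⟨t, ht, rfl⟩⟩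

lemma maxCount_eq {s : ℝ} (hs : s ∈ maximizers L f σ τ r) : maxCount L f σ τ r = count L f σ τ r s :=
  IsGreatest.csSup_eq ⟨⟨s, hs.1, rfl⟩, by rintro _ ⟨t, ht, rfl⟩; exact hs.2 t ht⟩

end Existence

/-! ### Comparing rectangle sums with integrals -/

section RectangleSums

variable {F : ℝ → ℝ} {M p : ℝ}

lemma integral_add_integral_of_continuousOn (hc : ContinuousOn F (Icc 0 M)) {a b c : ℝ}
    (ha : 0 ≤ a) (hab : a ≤ b) (hbc : b ≤ c) (hcM : c ≤ M) :
    (∫ x in a..b, F x) + ∫ x in b..c, F x = ∫ x in a..c, F x := by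
  apply intervalIntegral.integral_add_adjacent_intervals
  · apply ContinuousOn.intervalIntegrable
    rw [uIcc_of_le hab]
    exact hc.mono (Icc_subset_Icc ha (hbc.trans hcM))
  · apply ContinuousOn.intervalIntegrable
    rw [uIcc_of_le hbc]
    exact hc.mono (Icc_subset_Icc (ha.trans hab) hcM)

lemma ConcaveOn.trapezoid_le_integral (hF : ConcaveOn ℝ (Icc 0 M) F)
    (hc : ContinuousOn F (Icc 0 M)) {a b : ℝ} (ha : 0 ≤ a) (hab : a < b) (hb : b ≤ M) :
    (b - a) * (F a + F b) / 2 ≤ ∫ x in a..b, F x := by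
  have hsub : Icc a b ⊆ Icc 0 M := Icc_subset_Icc ha hb
  have hba : 0 < b - a := by linarith
  have := le_integral_of_linear_le (A := F a) (B := (F b - F a) / (b - a)) hab.le (hc.mono hsub)
    (fun x hx => by
      have := ConvexOn.le_chord hF.neg (hsub ⟨le_rfl, hab.le⟩) (hsub ⟨hab.le, le_rfl⟩) hab hx
      simp only [Pi.neg_apply] at this
      have e : (-F b - -F a) / (b - a) * (x - a) = -((F b - F a) / (b - a) * (x - a)) := by ring
      rw [e] at this
      linarith)
  refine le_trans (le_of_eq ?_) this
  field_simp
  ring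

/-- Trapezoids lie below a concave function. The first interval has length `1 - p` rather than `1`,
which accounts for the asymmetric weights at the left end. -/
lemma sum_le_integral_of_concaveOn (hF : ConcaveOn ℝ (Icc 0 M) F)
    (hc : ContinuousOn F (Icc 0 M)) (hp : p < 1) (n : ℕ) (hn : (n : ℝ) + 1 - p ≤ M) :
    ∑ i ∈ Finset.range (n + 1), F (i + 1 - p) ≤ (∫ x in (0 : ℝ)..(n + 1 - p), F x) +
      p / 2 * F (1 - p) - (1 - p) / 2 * F 0 + F (n + 1 - p) / 2 := by
  induction n with
  | zero =>
    simp only [zero_add, Finset.sum_range_one, Nat.cast_zero] at hn ⊢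
    have := hF.trapezoid_le_integral hc le_rfl (show 0 < 1 - p by linarith) hn
    linarith
  | succ n ih =>
    push_cast at hn ⊢
    have hn0 : (0 : ℝ) ≤ n := by positivity
    have ih' := ih (by linarith)
    have ht := hF.trapezoid_le_integral hc (show 0 ≤ (n : ℝ) + 1 - p by linarith)
      (show (n : ℝ) + 1 - p < n + 1 + 1 - p by linarith) hn
    have hadd := integral_add_integral_of_continuousOn hc le_rfl
      (show 0 ≤ (n : ℝ) + 1 - p by linarith)
      (show (n : ℝ) + 1 - p ≤ n + 1 + 1 - p by linarith) hn
    rw [Finset.sum_range_succ, ← hadd]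
    push_cast
    have e : (n : ℝ) + 1 + 1 - p - (n + 1 - p) = 1 := by ring
    rw [e] at ht
    linarith

/-- Lower bound for the integral of a function lying above the line through `(b, F b)` of slope `-d`. -/
lemma integral_ge_of_left_chord (hc : ContinuousOn F (Icc 0 M)) {a b d : ℝ} (ha : 0 ≤ a)
    (hab : a ≤ b) (hb : b ≤ M) (h : ∀ x ∈ Icc a b, F b + d * (b - x) ≤ F x) :
    F b * (b - a) + d * (b - a) ^ 2 / 2 ≤ ∫ x in a..b, F x := by
  have := le_integral_of_linear_le (A := F b + d * (b - a)) (B := -d) hab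
    (hc.mono (Icc_subset_Icc ha hb)) (fun x hx => by
      have := h x hx
      linarith)
  linarith

lemma ConvexOn.left_of_chord (hF : ConvexOn ℝ (Icc 0 M) F) {a b x : ℝ} (hx : 0 ≤ x) (hxa : x ≤ a)
    (hab : a < b) (hb : b ≤ M) : F a + (F a - F b) / (b - a) * (a - x) ≤ F x := by
  have := hF.chord_le_left (a := a) (b := b) (x := x) ⟨by linarith, hb⟩ ⟨hx, by linarith⟩ hab hxa
  have e : (F b - F a) / (b - a) * (x - a) = (F a - F b) / (b - a) * (a - x) := by ring
  rwa [e] at this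

/-- The zero of `F` at `M` is at distance at most `1` from `a`, so the chord to it descends at rate
at least `F a`. -/
lemma ConvexOn.left_of_zero (hF : ConvexOn ℝ (Icc 0 M) F) (hM : F M = 0) (hpos : ∀ x ∈ Icc 0 M, 0 ≤ F x)
    {a x : ℝ} (hx : 0 ≤ x) (hxa : x ≤ a) (haM : a ≤ M) (ha1 : M ≤ a + 1) :
    F a + F a * (a - x) ≤ F x := by
  rcases haM.eq_or_lt with rfl | hlt
  · rw [hM]
    linarith [hpos x ⟨hx, hxa⟩]
  · have h1 := ConvexOn.left_of_chord hF hx hxa hlt le_rfl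
    rw [hM, sub_zero] at h1
    have h2 : F a ≤ F a / (M - a) := by
      rw [le_div_iff₀ (by linarith)]
      exact mul_le_of_le_one_right (hpos a ⟨by linarith, haM⟩) (by linarith)
    have h3 : F a * (a - x) ≤ F a / (M - a) * (a - x) :=
      mul_le_mul_of_nonneg_right h2 (by linarith)
    linarith

/-- Compare each sample with the unit interval to its left. There the backward extension of the
chord to the next sample lies below `F` and gains half of the drop, and the drops telescope. -/
lemma sum_le_integral_of_convexOn_aux (hF : ConvexOn ℝ (Icc 0 M) F)
    (hc : ContinuousOn F (Icc 0 M)) (hp : p < 1) (k : ℕ) (hk : (k : ℝ) + 2 - p ≤ M) :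
    ∑ i ∈ Finset.range k, F (i + 2 - p) + (F (2 - p) - F (k + 2 - p)) / 2 ≤
      ∫ x in (1 - p)..(k + 1 - p), F x := by
  induction k with
  | zero => simp
  | succ k ih =>
    push_cast at hk ⊢
    have hk0 : (0 : ℝ) ≤ k := by positivity
    have ih' := ih (by linarith)
    have hstep := integral_ge_of_left_chord hc (a := k + 1 - p) (b := k + 2 - p)
      (d := F (k + 2 - p) - F (k + 1 + 2 - p)) (by linarith) (by linarith) (by linarith)
      (fun x hx => by
        have := ConvexOn.left_of_chord hF (a := k + 2 - p) (b := k + 1 + 2 - p) (x := x)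
          (by linarith [hx.1]) hx.2 (by linarith) hk
        rwa [show (k : ℝ) + 1 + 2 - p - (k + 2 - p) = 1 by ring, div_one] at this)
    have hadd := integral_add_integral_of_continuousOn hc (a := 1 - p) (b := k + 1 - p)
      (c := k + 2 - p) (by linarith) (by linarith) (by linarith) (by linarith)
    rw [show (k : ℝ) + 1 + 1 - p = k + 2 - p by ring, ← hadd, Finset.sum_range_succ]
    rw [show (k : ℝ) + 2 - p - (k + 1 - p) = 1 by ring] at hstep
    linarith

/-- The first interval uses the chord through the first two samples, and the last sample uses the
zero at `M`. The condition `M ≤ k + 3 - p` says that no further column fits before `M`, up to the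
boundary case. -/
lemma sum_le_integral_of_convexOn (hF : ConvexOn ℝ (Icc 0 M) F)
    (hc : ContinuousOn F (Icc 0 M)) (hM : F M = 0) (hpos : ∀ x ∈ Icc 0 M, 0 ≤ F x) (hp : p < 1)
    (k : ℕ) (hk : (k : ℝ) + 2 - p ≤ M) (hk' : M ≤ k + 3 - p) :
    ∑ i ∈ Finset.range (k + 2), F (i + 1 - p) ≤ (∫ x in (0 : ℝ)..M, F x) + p * F (1 - p) -
      (1 - p) ^ 2 / 2 * (F (1 - p) - F (2 - p)) - F (2 - p) / 2 := by
  have hk0 : (0 : ℝ) ≤ k := by positivity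
  have h1 := sum_le_integral_of_convexOn_aux hF hc hp k hk
  have h2 := integral_ge_of_left_chord hc (a := 0) (b := 1 - p) (d := F (1 - p) - F (2 - p))
    le_rfl (by linarith) (by linarith) (fun x hx => by
      have := ConvexOn.left_of_chord hF (a := 1 - p) (b := 2 - p) (x := x) hx.1 hx.2 (by linarith)
        (by linarith)
      rwa [show (2 : ℝ) - p - (1 - p) = 1 by ring, div_one] at this)
  have h3 := integral_ge_of_left_chord hc (a := k + 1 - p) (b := k + 2 - p) (d := F (k + 2 - p))
    (by linarith) (by linarith) hk (fun x hx =>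
      ConvexOn.left_of_zero hF hM hpos (by linarith [hx.1]) hx.2 hk (by linarith))
  rw [show (k : ℝ) + 2 - p - (k + 1 - p) = 1 by ring] at h3
  have h4 : 0 ≤ ∫ x in ((k : ℝ) + 2 - p)..M, F x :=
    intervalIntegral.integral_nonneg hk fun x hx => hpos x ⟨by linarith [hx.1], hx.2⟩
  have e1 := integral_add_integral_of_continuousOn hc (a := 0) (b := 1 - p) (c := k + 1 - p)
    le_rfl (by linarith) (by linarith) (by linarith)
  have e2 := integral_add_integral_of_continuousOn hc (a := 0) (b := k + 1 - p) (c := k + 2 - p)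
    le_rfl (by linarith) (by linarith) (by linarith)
  have e3 := integral_add_integral_of_continuousOn hc (a := 0) (b := k + 2 - p) (c := M)
    le_rfl (by linarith) hk le_rfl
  have hsum : ∑ i ∈ Finset.range (k + 2), F (i + 1 - p) =
      F (1 - p) + ∑ i ∈ Finset.range k, F (i + 2 - p) + F (k + 2 - p) := by
    rw [Finset.sum_range_succ, Finset.sum_range_succ']
    push_cast
    rw [zero_add, add_comm (F (1 - p))]
    congr 1
    · congr 1
      refine Finset.sum_congr rfl fun i _ => ?_
      congr 1; ring
    · congr 1; ring
  rw [hsum]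
  linarith

end RectangleSums

/-! ### Upper bounds excluding extreme stretch factors -/

section UpperBound

variable {L : ℝ} {f g : ℝ → ℝ} {σ τ p q : ℝ}

/-- For stretch factors `s ≥ 1` the count falls short of `r² Area(Γ)` by a multiple of `r s`, or by a
fixed proportion. -/
def CountUpperBound (L : ℝ) (f : ℝ → ℝ) (σ τ : ℝ) : Prop :=
  ∃ c > 0, ∃ κ < 1, ∀ r s : ℝ, 0 < r → 1 ≤ s →
    (count L f σ τ r s : ℝ) ≤ r ^ 2 * area L f - c * (r * s) + 1 / 4 ∨
    (count L f σ τ r s : ℝ) ≤ κ * (r ^ 2 * area L f) + 1 / 2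

/-- The scaled profile `x ↦ r s f (s x / r)`. -/
noncomputable def scaledProfile (f : ℝ → ℝ) (r s x : ℝ) : ℝ := r * s * f (x * s / r)

/-- Lowering the shifts to `-p` and `-q` only enlarges each column. Later `p` and `q` are the
negative parts of `σ` and `τ`, and the range consists of the indices whose shifted abscissa lies in
the base. -/
lemma IsDecreasingCurve.count_le_sum (hΓ : IsDecreasingCurve L f g) (hp1 : p < 1)
    (hσ : -p ≤ σ) (hσ' : -1 / 2 < σ) (hτ : -q ≤ τ) (hq : 0 ≤ q) {r s : ℝ} (hr : 0 < r) (hs : 0 < s) :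
    (count L f σ τ r s : ℝ) ≤
      ∑ i ∈ Finset.range ⌊r * L / s + p⌋₊, (scaledProfile f r s (i + 1 - p) + q) := by
  have hset : latticeSet L f σ τ r s = columnSet f σ τ r s ((σ + 1 / 2) * s / r) L := by
    ext ⟨j, k⟩
    rw [mem_columnSet_iff_of_le hr hs le_rfl]
    exact ⟨fun h => ⟨h, h.2.2.1⟩, fun h => h.1⟩
  have hcount : (count L f σ τ r s : ℝ) = _ := (congrArg (fun S : Set (ℕ × ℕ) => (S.ncard : ℝ)) hset).trans
    (columnSet_finite_and_ncard hr hs le_rfl).2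
  have e1 : (σ + 1 / 2) * s / r * r / s - σ = 1 / 2 := by field_simp; ring
  have e2 : ⌊(1 / 2 : ℝ)⌋ = 0 := by rw [Int.floor_eq_zero_iff]; constructor <;> norm_num
  rw [hcount, e1, e2, sum_Ioc_eq_sum_range]
  have hmem : ∀ i ∈ Finset.range ⌊r * L / s + p⌋₊, ((i : ℝ) + 1 - p) * s / r ∈ Icc 0 L := by
    intro i hi
    rw [Finset.mem_range, ← Nat.add_one_le_iff] at hi
    have h1 := (Nat.le_floor_iff' (Nat.succ_ne_zero i)).1 hi
    push_cast at h1
    have h0 : (0 : ℝ) ≤ i := by positivity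
    have h2 : 0 ≤ (i : ℝ) + 1 - p := by linarith
    refine ⟨by positivity, ?_⟩
    have h3 : (i : ℝ) + 1 - p ≤ r * L / s := by linarith
    rw [le_div_iff₀ hs] at h3
    rw [div_le_iff₀ hr]
    linarith
  have hsub : Finset.range (⌊L * r / s - σ⌋ - 0).toNat ⊆ Finset.range ⌊r * L / s + p⌋₊ := by
    apply Finset.range_mono
    rw [sub_zero, Int.floor_toNat]
    apply Nat.floor_le_floor
    rw [mul_comm L r]
    linarith
  refine (Finset.sum_le_sum fun i hi => ?_).trans (Finset.sum_le_sum_of_subset_of_nonneg hsub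
    fun i hi _ => ?_)
  · have hi' := hmem i (hsub hi)
    have hj : (0 + 1 + (i : ℤ)) ∈ Finset.Ioc ⌊(σ + 1 / 2) * s / r * r / s - σ⌋ ⌊L * r / s - σ⌋ := by
      rw [e1, e2, Finset.mem_Ioc]
      rw [Finset.mem_range] at hi
      omega
    rw [mem_Ioc_floor_scaled hr hs] at hj
    have hx0 : 0 ≤ (((0 + 1 + (i : ℤ) : ℤ) : ℝ) + σ) * s / r := by
      have : 0 ≤ (σ + 1 / 2) * s / r := by
        have : 0 ≤ σ + 1 / 2 := by linarith
        positivity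
      linarith [hj.1]
    have hle : ((i : ℝ) + 1 - p) * s / r ≤ (((0 + 1 + (i : ℤ) : ℤ) : ℝ) + σ) * s / r := by
      push_cast
      gcongr ?_ * s / r
      linarith
    have hf := hΓ.strictAntiOn.antitoneOn hi' ⟨hx0, hj.2⟩ hle
    have hf0 := (hΓ.mapsTo hi').1
    have hfl := Int.floor_le (r * s * f ((((0 + 1 + (i : ℤ) : ℤ) : ℝ) + σ) * s / r) - τ)
    have hmul : r * s * f ((((0 + 1 + (i : ℤ) : ℤ) : ℝ) + σ) * s / r) ≤
        r * s * f (((i : ℝ) + 1 - p) * s / r) := by gcongr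
    unfold scaledProfile
    apply max_le
    · linarith
    · positivity
  · have := (hΓ.mapsTo (hmem i hi)).1
    unfold scaledProfile
    positivity

lemma mapsTo_scale {r s : ℝ} (hr : 0 < r) (hs : 0 < s) :
    MapsTo (fun x => x * s / r) (Icc 0 (r * L / s)) (Icc 0 L) := by
  intro x hx
  have h0 := hx.1
  have h1 := hx.2
  rw [le_div_iff₀ hs] at h1
  refine ⟨by positivity, ?_⟩
  rw [div_le_iff₀ hr]
  linarith

lemma IsDecreasingCurve.scaledProfile_facts (hΓ : IsDecreasingCurve L f g) {r s : ℝ} (hr : 0 < r)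
    (hs : 0 < s) :
    ContinuousOn (scaledProfile f r s) (Icc 0 (r * L / s)) ∧
    (∀ x ∈ Icc 0 (r * L / s), 0 ≤ scaledProfile f r s x) ∧
    AntitoneOn (scaledProfile f r s) (Icc 0 (r * L / s)) ∧
    scaledProfile f r s 0 = r * s * L ∧ scaledProfile f r s (r * L / s) = 0 ∧
    ∫ x in (0 : ℝ)..(r * L / s), scaledProfile f r s x = r ^ 2 * area L f := by
  have hmaps : MapsTo (fun x => x * s / r) (Icc 0 (r * L / s)) (Icc 0 L) := mapsTo_scale hr hs
  refine ⟨?_, ?_, ?_, ?_, ?_, ?_⟩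
  · exact continuousOn_const.mul (hΓ.continuousOn.comp (by fun_prop) hmaps)
  · intro x hx
    have := (hΓ.mapsTo (hmaps hx)).1
    unfold scaledProfile
    positivity
  · intro x hx y hy hxy
    have := hΓ.strictAntiOn.antitoneOn (hmaps hx) (hmaps hy)
      (by gcongr : x * s / r ≤ y * s / r)
    unfold scaledProfile
    gcongr
  · simp [scaledProfile, hΓ.map_zero]
  · have : r * L / s * s / r = L := by field_simp
    simp [scaledProfile, this, hΓ.map_intercept]
  · unfold scaledProfile
    have h1 : ∀ x, f (x * s / r) = f (s / r * x) := fun x => by congr 1; ring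
    simp_rw [h1]
    rw [intervalIntegral.integral_const_mul, intervalIntegral.integral_comp_mul_left _
      (by positivity : s / r ≠ 0), smul_eq_mul, mul_zero,
      show s / r * (r * L / s) = L by field_simp]
    unfold area
    field_simp

lemma scaledProfile_comb {r s x y a b : ℝ} (hr : 0 < r) :
    (a * x + b * y) * s / r = a * (x * s / r) + b * (y * s / r) := by
  field_simp

lemma concaveOn_scaledProfile (hf : ConcaveOn ℝ (Icc 0 L) f) {r s : ℝ} (hr : 0 < r) (hs : 0 < s) :
    ConcaveOn ℝ (Icc 0 (r * L / s)) (scaledProfile f r s) := by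
  refine ⟨convex_Icc _ _, fun x hx y hy a b ha hb hab => ?_⟩
  have := hf.2 (mapsTo_scale hr hs hx) (mapsTo_scale hr hs hy)
    ha hb hab
  simp only [smul_eq_mul, scaledProfile] at this ⊢
  rw [scaledProfile_comb hr]
  have h2 := mul_le_mul_of_nonneg_left this (by positivity : 0 ≤ r * s)
  linarith

lemma convexOn_scaledProfile (hf : ConvexOn ℝ (Icc 0 L) f) {r s : ℝ} (hr : 0 < r) (hs : 0 < s) :
    ConvexOn ℝ (Icc 0 (r * L / s)) (scaledProfile f r s) := by
  refine ⟨convex_Icc _ _, fun x hx y hy a b ha hb hab => ?_⟩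
  have := hf.2 (mapsTo_scale hr hs hx) (mapsTo_scale hr hs hy)
    ha hb hab
  simp only [smul_eq_mul, scaledProfile] at this ⊢
  rw [scaledProfile_comb hr]
  have h2 := mul_le_mul_of_nonneg_left this (by positivity : 0 ≤ r * s)
  linarith

lemma scaledProfile_mul {r s c : ℝ} (hr : 0 < r) (hs : 0 < s) :
    scaledProfile f r s (c * (r * L / s)) = r * s * f (c * L) := by
  unfold scaledProfile
  congr 2
  field_simp

/-- The trapezoid bound loses half of the initial height `r s L`, the shifts give back at most `(p +
q) r s L`, and the last column gives back half of its height. The hypothesis says that the balance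
is negative. -/
lemma IsDecreasingCurve.countUpperBound_of_concave (hΓ : IsDecreasingCurve L f g)
    (hf : ConcaveOn ℝ (Icc 0 L) f) (hp0 : 0 ≤ p) (hp : p < 1 / 2) (hq0 : 0 ≤ q) (hq : q < 1 / 2)
    (hσ : -p ≤ σ) (hσ' : -1 / 2 < σ) (hτ : -q ≤ τ)
    (hb : f ((1 - p) / (2 - p) * L) < 2 * (1 / 2 - p - q) * L) : CountUpperBound L f σ τ := by
  refine ⟨((1 / 2 - p - q) * L - f ((1 - p) / (2 - p) * L) / 2), by linarith, 0, one_pos,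
    fun r s hr hs1 => ?_⟩
  have hs : 0 < s := by linarith
  have hL := hΓ.pos
  have hle := hΓ.count_le_sum (p := p) (q := q) (by linarith) hσ hσ' hτ hq0 hr hs
  obtain ⟨hc, hpos, hanti, h0, hM, hint⟩ := hΓ.scaledProfile_facts hr hs
  have hconc := concaveOn_scaledProfile hf hr hs
  set M := r * L / s with hMdef
  set F := scaledProfile f r s with hF
  have hM0 : 0 < M := by positivity
  rcases hn : ⌊M + p⌋₊ with _ | n
  · right
    rw [hn] at hle
    simp only [Finset.range_zero, Finset.sum_empty] at hle
    linarith
  left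
  have hnle : (n : ℝ) + 1 ≤ M + p := by
    have := Nat.floor_le (by linarith : 0 ≤ M + p)
    rw [hn] at this
    exact_mod_cast this
  have hngt : M + p < n + 1 + 1 := by
    have := Nat.lt_floor_add_one (M + p)
    rw [hn] at this
    exact_mod_cast this
  have hn0 : (0 : ℝ) ≤ n := by positivity
  rw [hn, Finset.sum_add_distrib, Finset.sum_const, Finset.card_range, nsmul_eq_mul] at hle
  have hsum := sum_le_integral_of_concaveOn hconc hc (by linarith : p < 1) n (by linarith)
  have hrest : 0 ≤ ∫ x in ((n : ℝ) + 1 - p)..M, F x :=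
    intervalIntegral.integral_nonneg (by linarith) fun x hx => hpos x ⟨by linarith [hx.1], hx.2⟩
  have hadd := integral_add_integral_of_continuousOn hc (a := 0) (b := n + 1 - p) (c := M)
    le_rfl (by linarith) (by linarith) le_rfl
  have h2p : 0 < 2 - p := by linarith
  -- Less than one unit of the base remains after the last column, so that column sits at least at
  -- the fraction `(1-p)/(2-p)` of the base, the worst case being a single column.
  have hcM : (1 - p) / (2 - p) * M ≤ n + 1 - p := by
    rw [div_mul_eq_mul_div, div_le_iff₀ h2p]
    nlinarith
  have hlast : F (n + 1 - p) ≤ r * s * f ((1 - p) / (2 - p) * L) := by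
    rw [← scaledProfile_mul hr hs]
    refine hanti ⟨?_, ?_⟩ ⟨by linarith, by linarith⟩ hcM
    · have : 0 ≤ 1 - p := by linarith
      positivity
    · linarith
  have hfirst : F (1 - p) ≤ r * s * L := by
    rw [← h0]
    exact hanti ⟨le_rfl, hM0.le⟩ ⟨by linarith, by linarith⟩ (by linarith)
  -- This is where `s ≥ 1` enters: the number of columns, each costing `q`, is controlled by the
  -- initial height.
  have hMH : M ≤ r * s * L := by
    rw [hMdef, div_le_iff₀ hs]
    have : 1 ≤ s * s := by nlinarith
    have hrL : 0 < r * L := by positivity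
    nlinarith
  rw [h0] at hsum
  have k1 : p / 2 * F (1 - p) ≤ p / 2 * (r * s * L) := by gcongr
  have k2 : ((n + 1 : ℕ) : ℝ) * q ≤ (r * s * L + p) * q := by
    push_cast
    exact mul_le_mul_of_nonneg_right (by linarith) hq0
  have k3 : p * q ≤ 1 / 4 := by nlinarith
  nlinarith

-- With no column or a single one, the count is a fixed proportion of the area plus a bounded error.
-- With at least two, the chord bounds give a deficit of order `r s`.
set_option maxHeartbeats 800000 in
lemma IsDecreasingCurve.countUpperBound_of_convex (hΓ : IsDecreasingCurve L f g)
    (hf : ConvexOn ℝ (Icc 0 L) f) (hp0 : 0 ≤ p) (hp : p < 1 / 2) (hq0 : 0 ≤ q) (hq : q < 1 / 2)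
    (hσ : -p ≤ σ) (hσ' : -1 / 2 < σ) (hτ : -q ≤ τ)
    (hb : 2 * (p + q) * L < (1 - p) * f ((1 - p) / (2 - p) * L)) : CountUpperBound L f σ τ := by
  have hL := hΓ.pos
  have h2p : 0 < 2 - p := by linarith
  have hcL : (1 - p) / (2 - p) * L ∈ Icc 0 L := by
    have h1 : 0 ≤ (1 - p) / (2 - p) := div_nonneg (by linarith) h2p.le
    have h2 : (1 - p) / (2 - p) ≤ 1 := by rw [div_le_one h2p]; linarith
    exact ⟨by positivity, by nlinarith⟩
  -- A convex curve lies below its chord, so the hypothesis forces `2 p (2 - p) < 1 - p`. The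
  -- resulting bound on `p` is what makes `2 / ((1-p)(3-p))` smaller than `1`.
  have hp4 : p < 1 / 4 := by
    have h1 := hf.2 (show (0 : ℝ) ∈ Icc 0 L from ⟨le_rfl, hL.le⟩) (show L ∈ Icc 0 L from ⟨hL.le, le_rfl⟩)
      (show 0 ≤ 1 / (2 - p) by positivity) (show 0 ≤ (1 - p) / (2 - p) from div_nonneg (by linarith) h2p.le)
      (by field_simp; ring)
    simp only [smul_eq_mul, mul_zero, zero_add, hΓ.map_zero, hΓ.map_intercept, add_zero] at h1
    have h2 : 2 * p * L < (1 - p) * (1 / (2 - p) * L) := by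
      have : (1 - p) * f ((1 - p) / (2 - p) * L) ≤ (1 - p) * (1 / (2 - p) * L) :=
        mul_le_mul_of_nonneg_left h1 (by linarith)
      nlinarith
    have h3 : 2 * p * (2 - p) < 1 - p := by
      have e : (1 - p) * (1 / (2 - p) * L) = (1 - p) / (2 - p) * L := by ring
      rw [e] at h2
      have := lt_of_mul_lt_mul_right h2 hL.le
      rwa [lt_div_iff₀ h2p] at this
    nlinarith
  refine ⟨((1 - p) * f ((1 - p) / (2 - p) * L) / 2 - (p + q) * L), by linarith,
    2 / ((1 - p) * (3 - p)), ?_, fun r s hr hs1 => ?_⟩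
  · rw [div_lt_one (by nlinarith)]
    nlinarith
  have hs : 0 < s := by linarith
  have hle := hΓ.count_le_sum (p := p) (q := q) (by linarith) hσ hσ' hτ hq0 hr hs
  obtain ⟨hc, hpos, hanti, h0, hM, hint⟩ := hΓ.scaledProfile_facts hr hs
  have hconv := convexOn_scaledProfile hf hr hs
  set M := r * L / s with hMdef
  set F := scaledProfile f r s with hF
  have hM0 : 0 < M := by positivity
  have harea := hΓ.area_pos
  rcases hn : ⌊M + p⌋₊ with _ | _ | k
  · right
    rw [hn] at hle
    simp only [Finset.range_zero, Finset.sum_empty] at hle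
    have : 0 ≤ 2 / ((1 - p) * (3 - p)) * (r ^ 2 * area L f) := by
      have : 0 < (1 - p) * (3 - p) := by nlinarith
      positivity
    linarith
  · right
    have hnle : 1 ≤ M + p := by
      have := Nat.floor_le (by linarith : 0 ≤ M + p)
      rw [hn] at this
      push_cast at this
      linarith
    have hngt : M + p < 2 := by
      have := Nat.lt_floor_add_one (M + p)
      rw [hn] at this
      norm_num at this
      exact this
    rw [hn] at hle
    simp only [zero_add, Finset.sum_range_one, Nat.cast_zero] at hle
    -- For a single column the integral is at least `F (1-p)` times `(1-p) + (1-p)²/2 =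
    -- (1-p)(3-p)/2`, which is the origin of the proportion chosen above.
    have h1 := integral_ge_of_left_chord hc (a := 0) (b := 1 - p) (d := F (1 - p)) le_rfl
      (by linarith) (by linarith) (fun x hx =>
        ConvexOn.left_of_zero hconv hM hpos hx.1 hx.2 (by linarith) (by linarith))
    have hrest : 0 ≤ ∫ x in (1 - p)..M, F x :=
      intervalIntegral.integral_nonneg (by linarith) fun x hx => hpos x ⟨by linarith [hx.1], hx.2⟩
    have hadd := integral_add_integral_of_continuousOn hc (a := 0) (b := 1 - p) (c := M)
      le_rfl (by linarith) (by linarith) le_rfl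
    have h13 : 0 < (1 - p) * (3 - p) := by nlinarith
    have h2 : F (1 - p) ≤ 2 / ((1 - p) * (3 - p)) * (r ^ 2 * area L f) := by
      rw [div_mul_eq_mul_div, le_div_iff₀ h13]
      nlinarith
    linarith
  · left
    have hnle : (k : ℝ) + 2 ≤ M + p := by
      have := Nat.floor_le (by linarith : 0 ≤ M + p)
      rw [hn] at this
      push_cast at this
      linarith
    have hngt : M + p < k + 3 := by
      have := Nat.lt_floor_add_one (M + p)
      rw [hn] at this
      push_cast at this
      linarith
    have hk0 : (0 : ℝ) ≤ k := by positivity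
    rw [hn, Finset.sum_add_distrib, Finset.sum_const, Finset.card_range, nsmul_eq_mul] at hle
    have hsum := sum_le_integral_of_convexOn hconv hc hM hpos (by linarith : p < 1) k (by linarith)
      (by linarith)
    rw [hint] at hsum
    set A := F (1 - p) with hA
    set B := F (2 - p) with hB
    -- Extending the chord through the first two samples back to `0` bounds `p A` by a multiple of
    -- the initial height.
    have hH := ConvexOn.left_of_chord hconv (a := 1 - p) (b := 2 - p) (x := 0) le_rfl (by linarith)
      (by linarith) (by linarith)
    rw [show (2 : ℝ) - p - (1 - p) = 1 by ring, div_one, sub_zero, h0] at hH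
    have hAlow : r * s * f ((1 - p) / (2 - p) * L) ≤ A := by
      rw [← scaledProfile_mul hr hs]
      have hle1 : 1 - p ≤ (1 - p) / (2 - p) * M := by
        rw [div_mul_eq_mul_div, le_div_iff₀ h2p]
        have : 2 - p ≤ M := by linarith
        have h1p : 0 ≤ 1 - p := by linarith
        nlinarith
      refine hanti ⟨by linarith, by linarith⟩ ⟨by linarith, ?_⟩ hle1
      have h2 : (1 - p) / (2 - p) ≤ 1 := by rw [div_le_one h2p]; linarith
      nlinarith
    have hAB : B ≤ A := hanti ⟨by linarith, by linarith⟩ ⟨by linarith, by linarith⟩ (by linarith)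
    have hB0 : 0 ≤ B := hpos _ ⟨by linarith, by linarith⟩
    have hMH : M ≤ r * s * L := by
      rw [hMdef, div_le_iff₀ hs]
      have : 1 ≤ s * s := by nlinarith
      have hrL : 0 < r * L := by positivity
      nlinarith
    have k2 : ((k + 1 + 1 : ℕ) : ℝ) * q ≤ (r * s * L + p) * q := by
      push_cast
      exact mul_le_mul_of_nonneg_right (by linarith) hq0
    have k3 : p * q ≤ 1 / 4 := by nlinarith
    have k4 : (1 - p) * (r * s * f ((1 - p) / (2 - p) * L)) ≤ (1 - p) * A :=
      mul_le_mul_of_nonneg_left hAlow (by linarith)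
    have k5 : p * (A + (A - B) * (1 - p)) ≤ p * (r * s * L) :=
      mul_le_mul_of_nonneg_left hH hp0
    have k6 : 0 ≤ p * B := by positivity
    have k7 : 0 ≤ p * (1 - p) * (A - B) :=
      mul_nonneg (mul_nonneg hp0 (by linarith)) (by linarith)
    set H := r * s * L with hHdef
    clear_value A B H
    clear hn hanti hpos hc hint hM hconv hA hB
    linear_combination hle + hsum + k2 + k3 + k4 / 2 + k5 + k6 / 2 + k7 / 2 + (p + q) * hHdef

lemma ConcaveParameterAssumption.countUpperBound (h : ConcaveParameterAssumption L f g σ τ)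
    (hΓ : IsDecreasingCurve L f g) (hσ : -1 / 2 < σ) (hτ : -1 / 2 < τ) :
    CountUpperBound L f σ τ ∧ CountUpperBound L g τ σ := by
  have hσn : σ⁻ < 1 / 2 := by rw [negPart_def]; exact max_lt (by linarith) (by norm_num)
  have hτn : τ⁻ < 1 / 2 := by rw [negPart_def]; exact max_lt (by linarith) (by norm_num)
  have hσ' : -σ⁻ ≤ σ := by linarith [neg_le_negPart σ]
  have hτ' : -τ⁻ ≤ τ := by linarith [neg_le_negPart τ]
  obtain ⟨h1, h2⟩ := max_lt_iff.1 h.bound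
  refine ⟨hΓ.countUpperBound_of_concave h.concave (negPart_nonneg σ) hσn (negPart_nonneg τ) hτn
    hσ' hσ hτ' h1, hΓ.symm.countUpperBound_of_concave (hΓ.concaveOn_inverse h.concave)
    (negPart_nonneg τ) hτn (negPart_nonneg σ) hσn hτ' hτ hσ' ?_⟩
  linarith

lemma ConvexParameterAssumption.countUpperBound (h : ConvexParameterAssumption L f g σ τ)
    (hΓ : IsDecreasingCurve L f g) (hσ : -1 / 2 < σ) (hτ : -1 / 2 < τ) :
    CountUpperBound L f σ τ ∧ CountUpperBound L g τ σ := by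
  have hσn : σ⁻ < 1 / 2 := by rw [negPart_def]; exact max_lt (by linarith) (by norm_num)
  have hτn : τ⁻ < 1 / 2 := by rw [negPart_def]; exact max_lt (by linarith) (by norm_num)
  have hσ' : -σ⁻ ≤ σ := by linarith [neg_le_negPart σ]
  have hτ' : -τ⁻ ≤ τ := by linarith [neg_le_negPart τ]
  obtain ⟨h1, h2⟩ := lt_min_iff.1 h.bound
  refine ⟨hΓ.countUpperBound_of_convex h.convex (negPart_nonneg σ) hσn (negPart_nonneg τ) hτn
    hσ' hσ hτ' h1, hΓ.symm.countUpperBound_of_convex (hΓ.convexOn_inverse h.convex)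
    (negPart_nonneg τ) hτn (negPart_nonneg σ) hσn hτ' hτ hσ' ?_⟩
  linarith

end UpperBound

/-! ### Location of the optimal stretch factor -/

section OptimalStretch

variable {L : ℝ} {f g : ℝ → ℝ} {σ τ E : ℝ}

lemma optimalStretch_pos (hσ : -1 / 2 < σ) (hτ : -1 / 2 < τ) : 0 < optimalStretch σ τ :=
  Real.sqrt_pos.2 (div_pos (by linarith) (by linarith))

lemma add_half_mul_optimalStretch_sq (hσ : -1 / 2 < σ) (hτ : -1 / 2 < τ) :
    (σ + 1 / 2) * optimalStretch σ τ ^ 2 = τ + 1 / 2 := by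
  have h : σ + 1 / 2 ≠ 0 := by linarith
  rw [optimalStretch, Real.sq_sqrt (div_nonneg (by linarith) (by linarith)), mul_div_cancel₀ _ h]

/-- Completing the square with `(σ + 1/2) s*² = τ + 1/2`. The exact quadratic deficit is what turns
an error `r ^ (1-2E)` in the count into a distance `r ^ (-E)`. -/
lemma mainTerm_eq (hσ : -1 / 2 < σ) (hτ : -1 / 2 < τ) {r s : ℝ} (hs : 0 < s) :
    mainTerm L f σ τ r s = mainTerm L f σ τ r (optimalStretch σ τ) -
      r * L * ((σ + 1 / 2) * (s - optimalStretch σ τ) ^ 2 / s) := by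
  have h := add_half_mul_optimalStretch_sq hσ hτ
  have hpos := optimalStretch_pos hσ hτ
  unfold mainTerm
  rw [← h]
  field_simp
  ring

lemma mainTerm_optimalStretch (hσ : -1 / 2 < σ) (hτ : -1 / 2 < τ) (r : ℝ) :
    mainTerm L f σ τ r (optimalStretch σ τ) =
      r ^ 2 * area L f - 2 * r * L * √((σ + 1 / 2) * (τ + 1 / 2)) := by
  have h := add_half_mul_optimalStretch_sq hσ hτ
  have hpos := optimalStretch_pos hσ hτ
  have h0 : 0 ≤ σ + 1 / 2 := by linarith
  have e : √((σ + 1 / 2) * (τ + 1 / 2)) = (σ + 1 / 2) * optimalStretch σ τ := by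
    rw [← h, Real.sqrt_eq_iff_mul_self_eq (by positivity) (by positivity)]
    ring
  rw [e, mainTerm, ← h]
  field_simp
  ring

/-- A stretch factor at least `1` whose lattice count exceeds `r² area - C r` is bounded. -/
lemma CountUpperBound.bounded (h : CountUpperBound L f σ τ) (hA : 0 < area L f) (C : ℝ) :
    ∃ K, ∀ᶠ r : ℝ in atTop, ∀ s, 1 ≤ s → r ^ 2 * area L f - C * r ≤ count L f σ τ r s → s ≤ K := by
  obtain ⟨c, hc, κ, hκ, h⟩ := h
  refine ⟨(C + 1) / c, ?_⟩
  have hκA : 0 < (1 - κ) * area L f := mul_pos (by linarith) hA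
  filter_upwards [eventually_ge_atTop 1, eventually_ge_atTop ((|C| + 1) / ((1 - κ) * area L f))]
    with r hr1 hr2 s hs hcount
  rw [div_le_iff₀ hκA] at hr2
  have hC := le_abs_self C
  have hC0 := abs_nonneg C
  rcases h r s (by linarith) hs with h' | h'
  · rw [le_div_iff₀ hc]
    have : r * (s * c) ≤ r * (C + 1) := by linarith
    exact le_of_mul_le_mul_left this (by linarith)
  · exfalso
    have h1 : r * (|C| + 1) ≤ r * (r * ((1 - κ) * area L f)) :=
      mul_le_mul_of_nonneg_left hr2 (by linarith)
    have h2 : r * C ≤ r * |C| := mul_le_mul_of_nonneg_left hC (by linarith)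
    linarith

lemma CountEstimate.lower_bound (h : CountEstimate L f σ τ E) (hE : 0 ≤ E) {s : ℝ} (hs : 0 < s) :
    ∃ C, ∀ᶠ r : ℝ in atTop, r ^ 2 * area L f - C * r ≤ count L f σ τ r s := by
  obtain ⟨C, hC⟩ := h (max 1 (max s s⁻¹)) (le_max_left _ _)
  refine ⟨L * ((σ + 1 / 2) * s + (τ + 1 / 2) / s) + |C|, ?_⟩
  filter_upwards [hC, eventually_ge_atTop 1] with r hr hr1
  have h1 := hr s (inv_le_of_inv_le₀ hs ((le_max_right _ _).trans (le_max_right _ _)))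
    ((le_max_left _ _).trans (le_max_right _ _))
  have h2 : C * r ^ (1 - 2 * E) ≤ |C| * r :=
    mul_le_mul (le_abs_self C)
      ((Real.rpow_le_rpow_of_exponent_le hr1 (by linarith)).trans_eq (Real.rpow_one r))
      (by positivity) (abs_nonneg C)
  have h3 := (abs_le.1 h1).1
  unfold mainTerm at h3
  linarith

/-- A maximizer does at least as well as the fixed stretch `s₀`, whose count is at least `r² Area -
C r`. `CountUpperBound.bounded` then bounds `s` when `s ≥ 1`, and the reflected curve bounds `1/s`
when `s ≤ 1`. -/
lemma IsDecreasingCurve.eventually_maximizers_subset (hΓ : IsDecreasingCurve L f g)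
    (hσ : -1 / 2 < σ) (hτ : -1 / 2 < τ) (h : CountEstimate L f σ τ E) (hE : 0 ≤ E)
    (hf : CountUpperBound L f σ τ)
    (hg : CountUpperBound L g τ σ) {s₀ : ℝ} (hs₀ : 0 < s₀) :
    ∃ K, 1 ≤ K ∧ s₀ ∈ Icc K⁻¹ K ∧ ∀ᶠ r : ℝ in atTop, maximizers L f σ τ r ⊆ Icc K⁻¹ K := by
  obtain ⟨C, hC⟩ := h.lower_bound hE hs₀
  obtain ⟨K₁, hK₁⟩ := hf.bounded hΓ.area_pos C
  obtain ⟨K₂, hK₂⟩ := hg.bounded hΓ.symm.area_pos C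
  set K := max 1 (max (max s₀ s₀⁻¹) (max K₁ K₂)) with hK
  have k0 : 1 ≤ K := le_max_left _ _
  have hle : max (max s₀ s₀⁻¹) (max K₁ K₂) ≤ K := le_max_right _ _
  simp only [max_le_iff] at hle
  obtain ⟨⟨k1, k2⟩, k3, k4⟩ := hle
  refine ⟨K, k0, ⟨inv_le_of_inv_le₀ hs₀ k2, k1⟩, ?_⟩
  filter_upwards [hC, hK₁, hK₂, eventually_gt_atTop 0] with r h0 h1 h2 hr s hs
  have hlow : r ^ 2 * area L f - C * r ≤ count L f σ τ r s :=
    h0.trans (by exact_mod_cast hs.2 s₀ hs₀)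
  rcases le_total 1 s with hs1 | hs1
  · exact ⟨(inv_le_one_of_one_le₀ k0).trans hs1, (h1 s hs1 hlow).trans k3⟩
  · have hsym := hlow
    rw [hΓ.count_symm hσ hτ hr hs.1, hΓ.area_symm] at hsym
    exact ⟨inv_le_of_inv_le₀ hs.1 ((h2 s⁻¹ ((one_le_inv₀ hs.1).2 hs1) hsym).trans k4),
      hs1.trans k0⟩

/-- Optimal stretch factors converge at rate `r ^ (-E)`, with the resulting asymptotics for the
maximal count, once the count has two-term asymptotics and decays for extreme stretch factors. -/
lemma IsDecreasingCurve.maximizers_asymptotics (hΓ : IsDecreasingCurve L f g)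
    (hσ : -1 / 2 < σ) (hτ : -1 / 2 < τ) (hE : 0 ≤ E) (h : CountEstimate L f σ τ E)
    (hf : CountUpperBound L f σ τ) (hg : CountUpperBound L g τ σ) :
    (∃ C : ℝ, ∀ᶠ r : ℝ in atTop, maximizers L f σ τ r ⊆
      Icc (optimalStretch σ τ - C * r ^ (-E)) (optimalStretch σ τ + C * r ^ (-E))) ∧
    ((fun r : ℝ => (maxCount L f σ τ r : ℝ) -
        (r ^ 2 * area L f - 2 * r * L * √((σ + 1 / 2) * (τ + 1 / 2)))) =O[atTop]
      (fun r : ℝ => r ^ (1 - 2 * E))) := by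
  have hs₀ := optimalStretch_pos hσ hτ
  obtain ⟨K, hK1, hK₀, hK⟩ := hΓ.eventually_maximizers_subset hσ hτ h hE hf hg hs₀
  obtain ⟨C, hC⟩ := h K hK1
  have hL := hΓ.pos
  have hσ' : 0 < σ + 1 / 2 := by linarith
  have hKpos : 0 < K := by linarith
  constructor
  · refine ⟨√(2 * C * K / (L * (σ + 1 / 2))), ?_⟩
    filter_upwards [hK, hC, eventually_gt_atTop 0] with r hr1 hr2 hr s hs
    obtain ⟨hs1, hs2⟩ := hr1 hs
    have e1 := (abs_le.1 (hr2 s hs1 hs2)).2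
    have e2 := (abs_le.1 (hr2 _ hK₀.1 hK₀.2)).1
    have e3 : (count L f σ τ r (optimalStretch σ τ) : ℝ) ≤ count L f σ τ r s := by
      exact_mod_cast hs.2 _ hs₀
    rw [mainTerm_eq hσ hτ hs.1] at e1
    set s₀ := optimalStretch σ τ
    -- Subtract the estimates at `s` and `s₀` and use maximality. Each contributes one error `C * r
    -- ^ (1 - 2 * E)`, hence the factor `2`.
    have e4 : r * L * ((σ + 1 / 2) * (s - s₀) ^ 2 / s) ≤ 2 * C * r ^ (1 - 2 * E) := by linarith
    have e5 : r * (L * (σ + 1 / 2) * (s - s₀) ^ 2 / K) ≤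
        r * L * ((σ + 1 / 2) * (s - s₀) ^ 2 / s) := by
      have : (s - s₀) ^ 2 / K ≤ (s - s₀) ^ 2 / s := by
        have := hs.1
        gcongr
      calc _ = r * L * (σ + 1 / 2) * ((s - s₀) ^ 2 / K) := by ring
        _ ≤ r * L * (σ + 1 / 2) * ((s - s₀) ^ 2 / s) :=
          mul_le_mul_of_nonneg_left this (by positivity)
        _ = _ := by ring
    have e6 : r ^ (1 - 2 * E) = r * (r ^ (-E)) ^ 2 := by
      rw [← Real.rpow_natCast (r ^ (-E)), ← Real.rpow_mul hr.le]
      nth_rw 2 [← Real.rpow_one r]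
      rw [← Real.rpow_add hr]
      congr 1
      push_cast
      ring
    have e7 : L * (σ + 1 / 2) * (s - s₀) ^ 2 / K ≤ 2 * C * (r ^ (-E)) ^ 2 := by
      rw [e6] at e4
      refine le_of_mul_le_mul_left ((e5.trans e4).trans_eq ?_) hr
      ring
    have e8 : (s - s₀) ^ 2 ≤ 2 * C * K / (L * (σ + 1 / 2)) * (r ^ (-E)) ^ 2 := by
      rw [div_le_iff₀ hKpos] at e7
      rw [div_mul_eq_mul_div, le_div_iff₀ (by positivity)]
      linarith
    have hpow : 0 ≤ r ^ (-E) := by positivity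
    have e9 : |s - s₀| ≤ √(2 * C * K / (L * (σ + 1 / 2))) * r ^ (-E) := by
      have := Real.abs_le_sqrt e8
      rwa [Real.sqrt_mul' _ (sq_nonneg _), Real.sqrt_sq hpow] at this
    obtain ⟨e10, e11⟩ := abs_le.1 e9
    exact ⟨by linarith, by linarith⟩
  · refine IsBigO.of_bound C ?_
    -- Upper bound: the estimate at the maximizer, whose main term never exceeds that at the
    -- optimum. Lower bound: the count at the optimum itself.
    filter_upwards [hK, hC, eventually_gt_atTop 0] with r hr1 hr2 hr
    obtain ⟨s, hs⟩ := hΓ.maximizers_nonempty hσ hτ hr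
    obtain ⟨hs1, hs2⟩ := hr1 hs
    have e1 := (abs_le.1 (hr2 s hs1 hs2)).2
    have e2 := (abs_le.1 (hr2 _ hK₀.1 hK₀.2)).1
    have e3 : (count L f σ τ r (optimalStretch σ τ) : ℝ) ≤ count L f σ τ r s := by
      exact_mod_cast hs.2 _ hs₀
    have e4 : 0 ≤ r * L * ((σ + 1 / 2) * (s - optimalStretch σ τ) ^ 2 / s) := by
      have := hs.1
      positivity
    rw [mainTerm_eq hσ hτ hs.1] at e1
    rw [maxCount_eq hs, ← mainTerm_optimalStretch hσ hτ, Real.norm_eq_abs, Real.norm_eq_abs,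
      abs_of_nonneg (Real.rpow_nonneg hr.le _), abs_le]
    exact ⟨by linarith, by linarith⟩

end OptimalStretch

end ShiftedLattice

/-! ### Conclusion -/

theorem theorem3 (L : ℝ) (f g : ℝ → ℝ) (hΓ : IsDecreasingCurve L f g)
    (σ τ : ℝ) (hσ : -1 / 2 < σ) (hτ : -1 / 2 < τ) (a₁ a₂ a₃ b₁ b₂ b₃ : ℝ)
    (h : (ConcaveParameterAssumption L f g σ τ ∧
            WeakerConcaveCondition L f g a₁ a₂ a₃ b₁ b₂ b₃) ∨
         (ConvexParameterAssumption L f g σ τ ∧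
            WeakerConvexCondition L f g a₁ a₂ a₃ b₁ b₂ b₃)) :
    -- the maximum is attained
    (∀ r : ℝ, 0 < r → (maximizers L f σ τ r).Nonempty) ∧
    -- the maximizing stretch factors converge to the optimal one
    (∀ ε : ℝ, 0 < ε → ∀ᶠ r : ℝ in atTop, maximizers L f σ τ r ⊆
      Icc (optimalStretch σ τ - ε) (optimalStretch σ τ + ε)) ∧
    -- rate of convergence
    (∃ C : ℝ, ∀ᶠ r : ℝ in atTop, maximizers L f σ τ r ⊆
      Icc (optimalStretch σ τ - C * r ^ (-rateExponent a₁ a₂ a₃ b₁ b₂ b₃))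
          (optimalStretch σ τ + C * r ^ (-rateExponent a₁ a₂ a₃ b₁ b₂ b₃))) ∧
    -- asymptotic formula for the maximal lattice count
    ((fun r : ℝ => (maxCount L f σ τ r : ℝ) -
        (r ^ 2 * area L f - 2 * r * L * √((σ + 1 / 2) * (τ + 1 / 2)))) =O[atTop]
      (fun r : ℝ => r ^ (1 - 2 * rateExponent a₁ a₂ a₃ b₁ b₂ b₃))) := by 
  have hE : 0 < rateExponent a₁ a₂ a₃ b₁ b₂ b₃ := by
    rcases h with ⟨-, h⟩ | ⟨-, h⟩
    · exact rateExponent_pos h.a₁_pos h.a₂_pos (by rw [h.a₃_eq]; norm_num) h.b₁_pos h.b₂_pos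
        (by rw [h.b₃_eq]; norm_num)
    · exact rateExponent_pos h.a₁_pos h.a₂_pos h.a₃_pos h.b₁_pos h.b₂_pos h.b₃_pos
  obtain ⟨hest, hf, hg⟩ : CountEstimate L f σ τ (rateExponent a₁ a₂ a₃ b₁ b₂ b₃) ∧
      CountUpperBound L f σ τ ∧ CountUpperBound L g τ σ := by
    rcases h with ⟨h, h'⟩ | ⟨h, h'⟩
    · exact ⟨h'.countEstimate hΓ hσ hτ, h.countUpperBound hΓ hσ hτ⟩
    · exact ⟨h'.countEstimate hΓ hσ hτ, h.countUpperBound hΓ hσ hτ⟩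
  obtain ⟨⟨C, hC⟩, hmax⟩ := hΓ.maximizers_asymptotics hσ hτ hE.le hest hf hg
  refine ⟨fun r hr => hΓ.maximizers_nonempty hσ hτ hr, fun ε hε => ?_, ⟨C, hC⟩, hmax⟩
  have hlim : Tendsto (fun r : ℝ => C * r ^ (-rateExponent a₁ a₂ a₃ b₁ b₂ b₃)) atTop (𝓝 0) := by
    simpa using (tendsto_rpow_neg_atTop hE).const_mul C
  filter_upwards [hC, hlim.eventually_lt_const hε] with r h1 h2
  exact h1.trans (Icc_subset_Icc (by linarith) (by linarith))
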